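/- Let $n\ge 2$ and let $\omega\subset\mathbb R^{n-1}$ be an open bounded connected Lipschitz domain for which there is a partition $\partial\omega=\Gamma_1\cup\Gamma_2$ (with $\Gamma_1\cap\Gamma_2=\emptyset$) such that (i) $\Gamma_1$ is a (closed) $d$-dimensional simplex for some $0\le d\le n-1$; (ii) $\omega$ is star-shaped with respect to $\Gamma_1$: for all $x\in\Gamma_1$ and $y\in\omega$ the ray $l_x(y)$ starting from $x$ and going through $y$ contains a point $z\in\Gamma_2$ such that $l_x(y)\cap\omega$ is exactly the open segment $(x,z)$. Let $h>0$ and $\Omega=(0,h)\times\omega\subset\mathbb R^n$; write $x=(x_1,x')$ with $x_1\in(0,h)$, $x'\in\omega$. Let $0<\lambda\le\Lambda$ and let $A=(a_{ij})\in\mathbb R^{n\times n}$ be a constant matrix with $\lambda|\xi|^2\le \xi A\xi^T\le\Lambda|\xi|^2$ for all $\xi\in\mathbb R^n$. Let $k\in\mathbb N$, $c_1,\dots,c_k\ge 0$, $\alpha_1,\dots,\alpha_k\ge0$, and put $$\delta(x)=\operatorname{dist}\bigl(x,(0,h)\times\Gamma_1\bigr),\qquad w(x)=\sum_{i=1}^k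 c_i\,\delta(x)^{\alpha_i},\qquad x\in\Omega .$$ **Part 1.** Let $\beta\in[0,1/2)$ satisfy $$\lambda>\frac{4n\Lambda\beta}{(1-2\beta)^2}.$$ Then there is a constant $C>0$, depending only on $\lambda,\Lambda,n,k$ and $\beta$, such that for all $\omega,\Gamma_1,h,A,c_i,\alpha_i$ as above with $\alpha_i\in[0,\beta]$ for $i=1,\dots,k$, and for every $u\in C^2(\Omega)\cap C(\overline\Omega)$ with $\operatorname{div}(A\nabla u)=0$ in $\Omega$ and $u=0$ on $(0,h)\times\partial\omega$, $$\|w\nabla u\|_{L^2(\Omega)}^2\le C\left(\frac{\|wu\|_{L^2(\Omega)}\,\|wu_{x_1}\|_{L^2(\Omega)}}{h}+\|wu_{x_1}\|_{L^2(\Omega)}^2\right).\qquad(*)$$ Norms of functions that are not square integrable are $+\infty$; in particular, the left-hand side is finite whenever the right-hand side is. **Part 2.** If $n=2$, $\omega=(a,b)$ with $a<b$ (so that $\Gamma_1$ is one of the two endpoints) and $A$ is the identity, so that the equation is $\Delta u=0$, then for every $\beta\in[0,1/2]$ (the value $1/2$ included, and with no further condition on $\beta$) there is a constant $C>0$, depending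 only on $k$ and $\beta$, such that $(*)$ holds for all such $\omega,\Gamma_1,h$, all $c_i\ge0$, all $\alpha_i\in[0,\beta]$ and all $u$ as above. -/

import Mathlib

open MeasureTheory

noncomputable section

namespace Separation

/-- Euclidean space `ℝ^d`. -/
abbrev Eucl (d : ℕ) : Type := EuclideanSpace ℝ (Fin d)

/-- `ω` has Lipschitz boundary: near every boundary point, after the choice of a unit "vertical"
direction `ν`, the set `ω` is the strict epigraph of a Lipschitz function defined on the
hyperplane orthogonal to `ν`. -/
def HasLipschitzBoundary {d : ℕ} (ω : Set (Eucl d)) : Prop :=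
  ∀ p ∈ frontier ω, ∃ (ν : Eucl d) (φ : (ℝ ∙ ν)ᗮ → ℝ) (K : NNReal) (U : Set (Eucl d)),
    ‖ν‖ = 1 ∧ LipschitzWith K φ ∧ IsOpen U ∧ p ∈ U ∧
      ω ∩ U = {x | φ ((ℝ ∙ ν)ᗮ.orthogonalProjectionOnto x) < inner ℝ ν x} ∩ U

/-- Open bounded connected (in particular non-empty) Lipschitz domain. -/
structure IsLipschitzDomain {d : ℕ} (ω : Set (Eucl d)) : Prop where
  isOpen : IsOpen ω
  isBounded : Bornology.IsBounded ω
  isConnected : IsConnected ω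
  lipschitz : HasLipschitzBoundary ω

/-- `Γ` is a (closed, non-degenerate) `j`-dimensional simplex. -/
def IsSimplex {d : ℕ} (j : ℕ) (Γ : Set (Eucl d)) : Prop :=
  ∃ s : Affine.Simplex ℝ (Eucl d) j, Γ = convexHull ℝ (Set.range s.points)

/-- The closed ray starting from `x` and going through `y`. -/
def ray {d : ℕ} (x y : Eucl d) : Set (Eucl d) :=
  {z | ∃ t : ℝ, 0 ≤ t ∧ z = x + t • (y - x)}

/-- `ω` is star shaped with respect to the part `Γ₁` of its boundary: every ray from a point
`x ∈ Γ₁` through a point of `ω` meets the remaining part `Γ₂` in a point `z` such that the open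
segment `(x, z)` is exactly the common part of the ray and `ω`. -/
def StarShapedFrom {d : ℕ} (ω Γ₁ Γ₂ : Set (Eucl d)) : Prop :=
  ∀ x ∈ Γ₁, ∀ y ∈ ω, ∃ z ∈ Γ₂, z ∈ ray x y ∧ ray x y ∩ ω = openSegment ℝ x z

/-- The hypotheses on the cross section `ω ⊂ ℝ^m` and the part `Γ₁` of its boundary. -/
structure IsAdmissible {m : ℕ} (ω Γ₁ : Set (Eucl m)) : Prop where
  domain : IsLipschitzDomain ω
  simplex : ∃ j : ℕ, j ≤ m ∧ IsSimplex j Γ₁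
  starShaped : ∃ Γ₂ : Set (Eucl m),
    frontier ω = Γ₁ ∪ Γ₂ ∧ Disjoint Γ₁ Γ₂ ∧ StarShapedFrom ω Γ₁ Γ₂

/-- The last `m` coordinates `x' = (x₂, …, x_n)` of `x ∈ ℝ^n`, `n = m + 1`. -/
def tail {m : ℕ} (x : Eucl (m + 1)) : Eucl m := WithLp.toLp 2 fun i => x i.succ

/-- The cylinder `(0, h) × S ⊂ ℝ^{m+1}`; the coordinate with index `0` is `x₁`. -/
def cylinder {m : ℕ} (h : ℝ) (S : Set (Eucl m)) : Set (Eucl (m + 1)) :=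
  {x | x 0 ∈ Set.Ioo 0 h ∧ tail x ∈ S}

/-- The partial derivative `∂f/∂x_i`. -/
def pd {d : ℕ} (i : Fin d) (f : Eucl d → ℝ) (x : Eucl d) : ℝ :=
  fderiv ℝ f x (EuclideanSpace.single i 1)

/-- The operator `L(u) = div (A ∇u)`. -/
def ellipticOp {d : ℕ} (A : Matrix (Fin d) (Fin d) ℝ) (u : Eucl d → ℝ) (x : Eucl d) : ℝ :=
  ∑ i, pd i (fun y => ∑ j, A i j * pd j u y) x

/-- `l |ξ|² ≤ ξ A ξᵀ ≤ L |ξ|²` for all `ξ`. -/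
def EllipticBounds {d : ℕ} (A : Matrix (Fin d) (Fin d) ℝ) (l L : ℝ) : Prop :=
  ∀ ξ : Eucl d, l * ‖ξ‖ ^ 2 ≤ ∑ i, ∑ j, ξ i * A i j * ξ j ∧
    ∑ i, ∑ j, ξ i * A i j * ξ j ≤ L * ‖ξ‖ ^ 2

/-- `u ∈ C²(Ω) ∩ C(Ω̄)` solves `div (A ∇u) = 0` in `Ω = (0, h) × ω`, with `u = 0` on
`(0, h) × ∂ω`. -/
structure IsSolution {m : ℕ} (h : ℝ) (ω : Set (Eucl m))
    (A : Matrix (Fin (m + 1)) (Fin (m + 1)) ℝ) (u : Eucl (m + 1) → ℝ) : Prop where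
  contDiffOn : ContDiffOn ℝ 2 u (cylinder h ω)
  continuousOn : ContinuousOn u (closure (cylinder h ω))
  equation : ∀ x ∈ cylinder h ω, ellipticOp A u x = 0
  boundary : ∀ x ∈ cylinder h (frontier ω), u x = 0

/-- The weight `w = ∑ c_i δ^{α_i}`, where `δ` is the distance to `(0, h) × Γ₁`. -/
def weight {m k : ℕ} (h : ℝ) (Γ₁ : Set (Eucl m)) (c α : Fin k → ℝ) (x : Eucl (m + 1)) : ℝ :=
  ∑ i, c i * Metric.infDist x (cylinder h Γ₁) ^ α i

/-- The `L²(Ω)` norm, with value `∞` for functions that are not square integrable. -/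
def normL2 {d : ℕ} {F : Type*} [NormedAddCommGroup F] (Ω : Set (Eucl d)) (f : Eucl d → F) :
    ENNReal :=
  eLpNorm f 2 (volume.restrict Ω)

/-- `‖w∇u‖² ≤ C (‖wu‖ ‖w u_{x₁}‖ / h + ‖w u_{x₁}‖²)` in `L²(Ω)`, `Ω = (0, h) × ω`. The inequality
is one between elements of `[0, ∞]`, so it contains the finiteness of the left-hand side whenever
the right-hand side is finite. -/
def SeparationEstimate {m : ℕ} (C h : ℝ) (ω : Set (Eucl m)) (w u : Eucl (m + 1) → ℝ) : Prop :=
  normL2 (cylinder h ω) (fun x => w x • gradient u x) ^ 2 ≤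
    ENNReal.ofReal C *
      (normL2 (cylinder h ω) (fun x => w x * u x) *
          normL2 (cylinder h ω) (fun x => w x * pd 0 u x) / ENNReal.ofReal h +
        normL2 (cylinder h ω) (fun x => w x * pd 0 u x) ^ 2)

end Separation

end

open MeasureTheory

noncomputable section

/-! Let `d = t (h - t) / h` in the variable x₁, and let W = δ^(2α) be the square of one summand of
the weight. Since c_i² δ^(2α_i) ≤ w² ≤ k ∑ c_i² δ^(2α_i), it suffices to bound ∫ W |∇u|² by a
multiple of (1/h) ∫ W |u u_{x₁}| + ∫ W u_{x₁}². On the cylinder W does not depend on x₁.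

A C¹ function on (0, h) satisfies ∫ f² ≤ ∫ d² (72 f² / h² + 16 f'²) without any boundary condition
(`lintegral_sum_sq_le`). Applied to the components of ∇u on lines parallel to the x₁-axis
(`lintegral_energy_le`), this leaves h⁻² ∫ d² W |∇u|² and ∫ d² W |∇u_{x₁}|². The derivative u_{x₁}
solves the same equation, so a weighted Caccioppoli inequality bounds the second integral by C ∫ W
u_{x₁}²; difference quotients replace u_{x₁}, which need not be continuous up to the boundary
(`IsSolution.caccioppoli_deriv`). For the first integral a bound by ∫ W u² would be too weak. Adding
a skew matrix to A does not change the operator, and `lowered A` is the choice whose flux in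
direction x₁ is a₁₁ u_{x₁}. Testing with d² W u then produces only the product u u_{x₁} from the
cutoff, together with ∫ W u_{x₁}² (`IsSolution.interior_energy`).

Both tests create a first order term with u ∇W · B∇u, which is abstracted in `WeightBound`. As |∇W|
= 2α W / δ, Young's inequality and the Hardy inequality ∫ δ^(2α-2) g² ≤ 4 / (1-2α)² ∫ δ^(2α) |∇g|²
(`IsAdmissible.hardy`) bound it by a multiple θ < λ of the energy; this is where the condition on β
enters. The Hardy inequality depends on the codimension of the affine span of Γ₁: in codimension one
ω lies in a half space, in codimension two it avoids a half hyperplane ending on the span, and from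
codimension three on no further geometry is needed. In Part 2, W is a concave power of the distance
to an end point, and an integration by parts shows that the first order term has the favourable
sign.

As u is only continuous up to the boundary, all tests use `trunc s u`, which vanishes where |u| ≤ s,
and `trunc s d`; their product has compact support in Ω. Letting s → 0 with Fatou's lemma gives
inequalities in [0, ∞], which include the finiteness claim. -/

namespace Separation

/-! ### Integration by parts for functions supported in a compact subset of an open set. -/

section Support

lemma integrable_of_eq_zero_off {E : Type*} [NormedAddCommGroup E] [MeasurableSpace E]
    [BorelSpace E] {μ : Measure E} [IsFiniteMeasureOnCompacts μ] {f : E → ℝ} {Ω K : Set E}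
    (hK : IsCompact K) (hKΩ : K ⊆ Ω) (hf : ContinuousOn f Ω) (h0 : ∀ x ∉ K, f x = 0) : Integrable f μ := by
  have h1 : IntegrableOn f K μ := (hf.mono hKΩ).integrableOn_compact hK
  have h2 : f = K.indicator f := by
    ext x
    by_cases hx : x ∈ K
    · simp [hx]
    · simp [hx, h0 x hx]
  rw [h2]
  exact (integrable_indicator_iff hK.measurableSet).2 h1

variable {E : Type*} [NormedAddCommGroup E] [NormedSpace ℝ E]

lemma fderiv_eq_zero_of_eq_zero_off {f : E → ℝ} {K : Set E} (hK : IsClosed K)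
    (h0 : ∀ x ∉ K, f x = 0) {x : E} (hx : x ∉ K) : fderiv ℝ f x = 0 := by
  have : f =ᶠ[nhds x] fun _ => (0 : ℝ) := by
    filter_upwards [hK.isOpen_compl.mem_nhds hx] with y hy using h0 y hy
  rw [this.fderiv_eq]; simp

lemma contDiff_of_eq_zero_off {f : E → ℝ} {Ω K : Set E} (hΩ : IsOpen Ω) (hK : IsClosed K)
    (hKΩ : K ⊆ Ω) (hf : ContDiffOn ℝ 1 f Ω) (h0 : ∀ x ∉ K, f x = 0) : ContDiff ℝ 1 f := by
  rw [contDiff_iff_contDiffAt]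
  intro x
  by_cases hx : x ∈ Ω
  · exact hf.contDiffAt (hΩ.mem_nhds hx)
  · have : f =ᶠ[nhds x] fun _ => (0 : ℝ) := by
      filter_upwards [hK.isOpen_compl.mem_nhds fun h => hx (hKΩ h)] with y hy using h0 y hy
    exact contDiffAt_const.congr_of_eventuallyEq this

lemma continuousOn_fderiv_apply {f : E → ℝ} {Ω : Set E} (hΩ : IsOpen Ω)
    (hf : ContDiffOn ℝ 1 f Ω) (v : E) : ContinuousOn (fun x => fderiv ℝ f x v) Ω :=
  (hf.continuousOn_fderiv_of_isOpen hΩ le_rfl).clm_apply continuousOn_const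

variable [MeasurableSpace E] [BorelSpace E] {μ : Measure E}

lemma integrable_fderiv_of_eq_zero_off [IsFiniteMeasureOnCompacts μ] {f : E → ℝ} {Ω K : Set E}
    (hΩ : IsOpen Ω)
    (hK : IsCompact K) (hKΩ : K ⊆ Ω) (hf : ContDiffOn ℝ 1 f Ω) (h0 : ∀ x ∉ K, f x = 0) (v : E) :
    Integrable (fun x => fderiv ℝ f x v) μ :=
  integrable_of_eq_zero_off hK hKΩ (continuousOn_fderiv_apply hΩ hf v) fun x hx => by
    rw [fderiv_eq_zero_of_eq_zero_off hK.isClosed h0 hx]; simp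

/-- The integral of a directional derivative of a compactly supported `C¹` function vanishes. -/
lemma integral_fderiv_eq_zero_of_eq_zero_off [FiniteDimensional ℝ E] [μ.IsAddHaarMeasure]
    {f : E → ℝ} {Ω K : Set E} (hΩ : IsOpen Ω)
    (hK : IsCompact K) (hKΩ : K ⊆ Ω) (hf : ContDiffOn ℝ 1 f Ω) (h0 : ∀ x ∉ K, f x = 0) (v : E) :
    ∫ x, fderiv ℝ f x v ∂μ = 0 := by
  have hc := contDiff_of_eq_zero_off hΩ hK.isClosed hKΩ hf h0
  have h1 := integrable_fderiv_of_eq_zero_off (μ := μ) hΩ hK hKΩ hf h0 v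
  have h2 : Integrable f μ := integrable_of_eq_zero_off hK hKΩ hf.continuousOn h0
  have := integral_mul_fderiv_eq_neg_fderiv_mul_of_integrable (μ := μ) (f := fun _ => (1 : ℝ))
    (g := f) (v := v) (by simp) (by simpa using h1) (by simpa using h2)
    (fun x _ => by fun_prop) (fun x _ => (hc.differentiable one_ne_zero) x)
  simpa using this

end Support

/-! ### The smooth truncation at level `s`. -/

section Truncation

/-- The derivative of the truncation `trunc s`. -/
def truncDeriv (s r : ℝ) : ℝ := Real.smoothTransition ((r / s) ^ 2 - 1)

/-- A smooth odd function which vanishes on `[-s, s]`, is convex on `[0, ∞)` and satisfies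
`trunc s r → r` as `s → 0`. -/
def trunc (s r : ℝ) : ℝ := ∫ t in (0 : ℝ)..r, truncDeriv s t

lemma contDiff_truncDeriv {n : ℕ∞} (s : ℝ) : ContDiff ℝ n (truncDeriv s) := by
  unfold truncDeriv
  exact Real.smoothTransition.contDiff.comp (by fun_prop)

lemma truncDeriv_nonneg (s r : ℝ) : 0 ≤ truncDeriv s r := Real.smoothTransition.nonneg _

lemma truncDeriv_le_one (s r : ℝ) : truncDeriv s r ≤ 1 := Real.smoothTransition.le_one _

lemma truncDeriv_eq_zero {s r : ℝ} (hs : 0 < s) (hr : |r| ≤ s) : truncDeriv s r = 0 := by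
  apply Real.smoothTransition.zero_of_nonpos
  have : (r / s) ^ 2 ≤ 1 := by
    rw [sq_le_one_iff_abs_le_one, abs_div, abs_of_pos hs]
    exact (div_le_one hs).2 hr
  linarith

lemma truncDeriv_eq_one {s r : ℝ} (hs : 0 < s) (hr : 2 * s ≤ |r|) : truncDeriv s r = 1 := by
  apply Real.smoothTransition.one_of_one_le
  have h1 : 2 ≤ |r / s| := by
    rw [abs_div, abs_of_pos hs]
    exact (le_div_iff₀ hs).2 hr
  have : (r / s) ^ 2 = |r / s| ^ 2 := (sq_abs _).symm
  nlinarith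

lemma hasDerivAt_trunc (s r : ℝ) : HasDerivAt (trunc s) (truncDeriv s r) r := by
  have hc : Continuous (truncDeriv s) := (contDiff_truncDeriv (n := 0) s).continuous
  exact intervalIntegral.integral_hasDerivAt_right (hc.intervalIntegrable _ _)
    (hc.stronglyMeasurableAtFilter _ _) hc.continuousAt

lemma deriv_trunc (s : ℝ) : deriv (trunc s) = truncDeriv s :=
  funext fun r => (hasDerivAt_trunc s r).deriv

lemma contDiff_trunc (s : ℝ) : ContDiff ℝ 2 (trunc s) := by
  rw [show (2 : WithTop ℕ∞) = 1 + 1 by norm_num, contDiff_succ_iff_deriv]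
  refine ⟨fun r => (hasDerivAt_trunc s r).differentiableAt, by simp, ?_⟩
  rw [deriv_trunc]
  exact contDiff_truncDeriv (n := 1) s

lemma trunc_nonneg {s r : ℝ} (hr : 0 ≤ r) : 0 ≤ trunc s r :=
  intervalIntegral.integral_nonneg hr fun _ _ => truncDeriv_nonneg _ _

lemma trunc_neg (s r : ℝ) : trunc s (-r) = - trunc s r := by
  have h := intervalIntegral.integral_comp_neg (a := 0) (b := r) (truncDeriv s)
  have h2 : ∀ t, truncDeriv s (-t) = truncDeriv s t := fun t => by
    simp [truncDeriv, neg_div]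
  simp only [h2, neg_zero] at h
  rw [trunc, trunc, h, intervalIntegral.integral_symm]

lemma mul_trunc_nonneg (s r : ℝ) : 0 ≤ r * trunc s r := by
  rcases le_total 0 r with h | h
  · exact mul_nonneg h (trunc_nonneg h)
  · have := trunc_nonneg (s := s) (neg_nonneg.2 h)
    rw [trunc_neg] at this
    nlinarith

lemma trunc_le {s r : ℝ} (hr : 0 ≤ r) : trunc s r ≤ r := by
  have hc : Continuous (truncDeriv s) := (contDiff_truncDeriv (n := 0) s).continuous
  have := intervalIntegral.integral_mono_on hr (hc.intervalIntegrable 0 r)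
    (intervalIntegrable_const (μ := volume) (c := (1 : ℝ))) fun t _ => truncDeriv_le_one s t
  simpa [trunc] using this

lemma abs_trunc_le (s r : ℝ) : |trunc s r| ≤ |r| := by
  rcases le_total 0 r with h | h
  · rw [abs_of_nonneg h, abs_of_nonneg (trunc_nonneg h)]
    exact trunc_le h
  · rw [← abs_neg r, ← abs_neg (trunc s r), ← trunc_neg, abs_of_nonneg (neg_nonneg.2 h),
      abs_of_nonneg (trunc_nonneg (neg_nonneg.2 h))]
    exact trunc_le (neg_nonneg.2 h)

lemma trunc_eq_zero {s r : ℝ} (hs : 0 < s) (hr : |r| ≤ s) : trunc s r = 0 := by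
  rw [trunc, intervalIntegral.integral_congr (g := fun _ => (0 : ℝ))]
  · simp
  · intro t ht
    refine truncDeriv_eq_zero hs (le_trans ?_ hr)
    simpa using Set.abs_sub_left_of_mem_uIcc ht

lemma sub_two_mul_le_trunc {s r : ℝ} (hs : 0 < s) (hr : 0 ≤ r) : r - 2 * s ≤ trunc s r := by
  rcases le_total r (2 * s) with h | h
  · linarith [trunc_nonneg (s := s) hr]
  · have hc : Continuous (truncDeriv s) := (contDiff_truncDeriv (n := 0) s).continuous
    have h1 : trunc s r = trunc s (2 * s) + ∫ t in (2 * s)..r, truncDeriv s t :=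
      (intervalIntegral.integral_add_adjacent_intervals (hc.intervalIntegrable _ _)
        (hc.intervalIntegrable _ _)).symm
    have h2 : ∫ t in (2 * s)..r, truncDeriv s t = ∫ t in (2 * s)..r, (1 : ℝ) := by
      refine intervalIntegral.integral_congr fun t ht => ?_
      rw [Set.uIcc_of_le h] at ht
      exact truncDeriv_eq_one hs (ht.1.trans (le_abs_self t))
    rw [h1, h2]
    simp only [intervalIntegral.integral_const, smul_eq_mul, mul_one]
    linarith [trunc_nonneg (s := s) (by linarith : (0 : ℝ) ≤ 2 * s)]

lemma tendsto_trunc {r : ℝ} (hr : 0 ≤ r) :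
    Filter.Tendsto (fun s => trunc s r) (nhdsWithin 0 (Set.Ioi 0)) (nhds r) := by
  have h : Filter.Tendsto (fun s : ℝ => r - 2 * s) (nhdsWithin 0 (Set.Ioi 0)) (nhds r) := by
    have : Filter.Tendsto (fun s : ℝ => r - 2 * s) (nhds 0) (nhds (r - 2 * 0)) :=
      (by fun_prop : Continuous fun s : ℝ => r - 2 * s).tendsto 0
    simpa using this.mono_left nhdsWithin_le_nhds
  refine tendsto_of_tendsto_of_tendsto_of_le_of_le' h tendsto_const_nhds ?_ ?_
  · filter_upwards [self_mem_nhdsWithin] with s hs using sub_two_mul_le_trunc hs hr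
  · exact Filter.Eventually.of_forall fun s => trunc_le hr

/-- The point 0 has to be excluded: `truncDeriv s 0 = 0` for every `s > 0`. The zero set of the
solution is therefore treated separately in the limit. -/
lemma tendsto_truncDeriv {r : ℝ} (hr : r ≠ 0) :
    Filter.Tendsto (fun s => truncDeriv s r) (nhdsWithin 0 (Set.Ioi 0)) (nhds 1) := by
  refine tendsto_const_nhds.congr' ?_
  have : Set.Ioo (0 : ℝ) (|r| / 2) ∈ nhdsWithin (0 : ℝ) (Set.Ioi 0) :=
    Ioo_mem_nhdsGT (by positivity)
  filter_upwards [this] with s hs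
  exact (truncDeriv_eq_one hs.1 (by linarith [hs.2])).symm

/-- The product `trunc s * truncDeriv s` has derivative at least `truncDeriv s ^ 2`. -/
lemma exists_hasDerivAt_trunc_mul_truncDeriv (s r : ℝ) :
    ∃ D, HasDerivAt (fun r => trunc s r * truncDeriv s r) D r ∧ truncDeriv s r ^ 2 ≤ D := by
  have h1 : HasDerivAt (fun r : ℝ => (r / s) ^ 2 - 1) (2 * (r / s) * (1 / s)) r := by
    have := (((hasDerivAt_id r).div_const s).pow 2).sub_const 1
    simpa using this
  have hd : DifferentiableAt ℝ Real.smoothTransition ((r / s) ^ 2 - 1) :=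
    (Real.smoothTransition.contDiff (n := 1)).differentiable one_ne_zero _
  have h2 : HasDerivAt (truncDeriv s)
      (deriv Real.smoothTransition ((r / s) ^ 2 - 1) * (2 * (r / s) * (1 / s))) r :=
    hd.hasDerivAt.comp r h1
  refine ⟨_, (hasDerivAt_trunc s r).mul h2, ?_⟩
  have h3 : 0 ≤ deriv Real.smoothTransition ((r / s) ^ 2 - 1) :=
    Real.smoothTransition.monotone.deriv_nonneg
  -- The derivative of T T' is T'² + T T'', and the second summand is nonnegative because T and T''
  -- both have the sign of `r`.
  have h4 : 0 ≤ deriv Real.smoothTransition ((r / s) ^ 2 - 1) * (2 * (1 / s) ^ 2)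
      * (r * trunc s r) := by
    have := mul_trunc_nonneg s r
    positivity
  calc truncDeriv s r ^ 2 ≤ truncDeriv s r ^ 2 +
      deriv Real.smoothTransition ((r / s) ^ 2 - 1) * (2 * (1 / s) ^ 2) * (r * trunc s r) := by
        linarith
    _ = _ := by ring

end Truncation

/-! ### The squared distance to a closed convex set. -/

section Distance

variable {V : Type*} [NormedAddCommGroup V] [InnerProductSpace ℝ V] [ProperSpace V]

/-- The metric projection onto a closed convex set and the derivative of the squared distance. -/
lemma exists_metric_projection {Γ : Set V} (hc : IsClosed Γ) (hcv : Convex ℝ Γ)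
    (hne : Γ.Nonempty) :
    ∃ P : V → V, Continuous P ∧ (∀ x, P x ∈ Γ) ∧ (∀ x, ‖x - P x‖ = Metric.infDist x Γ) ∧
      ∀ x, HasFDerivAt (fun x => Metric.infDist x Γ ^ 2) ((2 : ℝ) • innerSL ℝ (x - P x)) x := by
  choose P hP hPd using fun x => hc.exists_infDist_eq_dist hne x
  have hn : ∀ x, ‖x - P x‖ = Metric.infDist x Γ := fun x => by rw [hPd x, dist_eq_norm]
  have hin : ∀ x, ∀ w ∈ Γ, inner ℝ (x - P x) (w - P x) ≤ 0 := by
    intro x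
    refine (norm_eq_iInf_iff_real_inner_le_zero hcv (hP x)).1 ?_
    rw [hn x, Metric.infDist_eq_iInf]
    simp only [dist_eq_norm]
  have hlip : ∀ x y, ‖P x - P y‖ ≤ ‖x - y‖ := by
    intro x y
    -- Adding the obtuse angle inequalities at `x` and at `y` gives ‖P x - P y‖² ≤ ⟨x - y, P x - P
    -- y⟩, hence P is 1-Lipschitz.
    have h1 := hin x (P y) (hP y)
    have h2 := hin y (P x) (hP x)
    have h3 : ‖P x - P y‖ ^ 2 ≤ inner ℝ (x - y) (P x - P y) := by
      have e : inner ℝ (x - y) (P x - P y) - ‖P x - P y‖ ^ 2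
          = - (inner ℝ (x - P x) (P y - P x) + inner ℝ (y - P y) (P x - P y)) := by
        rw [← real_inner_self_eq_norm_sq]
        simp only [inner_sub_left, inner_sub_right]
        ring
      linarith
    have h4 := real_inner_le_norm (x - y) (P x - P y)
    by_contra! hlt
    nlinarith [norm_nonneg (P x - P y), norm_nonneg (x - y)]
  refine ⟨P, ?_, hP, hn, fun x => ?_⟩
  · have : LipschitzWith 1 P := LipschitzWith.of_dist_le_mul fun x y => by
      simpa [dist_eq_norm] using hlip x y
    exact this.continuous
  -- The upper bound comes from `P x` as a competitor for `y`; the lower bound from expanding ‖y - P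
  -- y‖² around x - P x and the obtuse angle inequality. The error is thus at most ‖y - x‖².
  · have key : ∀ y, ‖Metric.infDist y Γ ^ 2 - Metric.infDist x Γ ^ 2
        - 2 * inner ℝ (x - P x) (y - x)‖ ≤ 1 * ‖‖y - x‖ ^ 2‖ := by
      intro y
      have hup : Metric.infDist y Γ ^ 2 ≤ ‖y - P x‖ ^ 2 := by
        have := Metric.infDist_le_dist_of_mem (x := y) (hP x)
        rw [dist_eq_norm] at this
        exact pow_le_pow_left₀ Metric.infDist_nonneg this 2
      have e1 : ‖y - P x‖ ^ 2 = ‖x - P x‖ ^ 2 + 2 * inner ℝ (x - P x) (y - x) + ‖y - x‖ ^ 2 := by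
        rw [← norm_add_sq_real]; congr 2; abel
      have e2 : ‖y - P y‖ ^ 2 = ‖x - P x‖ ^ 2
          + 2 * inner ℝ (x - P x) ((y - x) - (P y - P x)) + ‖(y - x) - (P y - P x)‖ ^ 2 := by
        rw [← norm_add_sq_real]; congr 2; abel
      rw [inner_sub_right] at e2
      have h1 := hin x (P y) (hP y)
      rw [← hn x, ← hn y] at *
      rw [Real.norm_eq_abs, Real.norm_eq_abs, abs_of_nonneg (by positivity : 0 ≤ ‖y - x‖ ^ 2),
        abs_le]
      constructor <;> nlinarith [sq_nonneg ‖(y - x) - (P y - P x)‖, sq_nonneg ‖y - x‖]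
    have h0 : HasFDerivAt (fun y => Metric.infDist y Γ ^ 2 - Metric.infDist x Γ ^ 2
        - 2 * inner ℝ (x - P x) (y - x)) (0 : V →L[ℝ] ℝ) x :=
      (Asymptotics.IsBigO.of_bound 1 (Filter.Eventually.of_forall key)).hasFDerivAt (by norm_num)
    have h1 : HasFDerivAt (fun y => Metric.infDist x Γ ^ 2 + 2 * inner ℝ (x - P x) (y - x))
        ((2 : ℝ) • innerSL ℝ (x - P x)) x := by
      have h2 : HasFDerivAt (fun y => y - x) (ContinuousLinearMap.id ℝ V) x :=
        (hasFDerivAt_id x).sub_const x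
      have := HasFDerivAt.comp (f := fun y => y - x) x
        (innerSL ℝ (x - P x)).hasFDerivAt h2
      exact ((this.const_mul (2 : ℝ)).const_add _).congr_fderiv (by ext; simp)
    refine ((h0.add h1).congr_fderiv (by simp)).congr_of_eventuallyEq
      (Filter.Eventually.of_forall fun y => ?_)
    simp only [Pi.add_apply]
    ring

end Distance

/-! ### Weighted Hardy inequalities by integrating a divergence and completing squares. -/

section Hardy

variable {E : Type*} [NormedAddCommGroup E] [NormedSpace ℝ E]

lemma hasLineDerivAt_of_contDiffOn {f : E → ℝ} {Ω : Set E} (hΩ : IsOpen Ω)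
    (hf : ContDiffOn ℝ 1 f Ω) {x : E} (hx : x ∈ Ω) (v : E) :
    HasLineDerivAt ℝ f (fderiv ℝ f x v) x v :=
  (((hf.contDiffAt (hΩ.mem_nhds hx)).differentiableAt one_ne_zero).hasFDerivAt).hasLineDerivAt v

lemma fderiv_apply_eq_of_hasLineDerivAt {f : E → ℝ} {Ω : Set E} (hΩ : IsOpen Ω)
    (hf : ContDiffOn ℝ 1 f Ω) {x : E} (hx : x ∈ Ω) {v : E} {d : ℝ}
    (h : HasLineDerivAt ℝ f d x v) : fderiv ℝ f x v = d :=
  HasDerivAt.unique (hasLineDerivAt_of_contDiffOn hΩ hf hx v) h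

lemma ContDiffOn.rpow_pos {σ : E → ℝ} {Ω : Set E} (h : ContDiffOn ℝ 1 σ Ω)
    (hpos : ∀ x ∈ Ω, 0 < σ x) (a : ℝ) : ContDiffOn ℝ 1 (fun x => σ x ^ a) Ω :=
  h.rpow_const_of_ne fun x hx => (hpos x hx).ne'

lemma HasLineDerivAt.mul' {f g : E → ℝ} {f' g' : ℝ} {x v : E} (hf : HasLineDerivAt ℝ f f' x v)
    (hg : HasLineDerivAt ℝ g g' x v) :
    HasLineDerivAt ℝ (fun y => f y * g y) (f' * g x + f x * g') x v := by
  refine HasDerivAt.congr_deriv (HasDerivAt.mul hf hg) ?_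
  simp

lemma HasLineDerivAt.div' {f g : E → ℝ} {f' g' : ℝ} {x v : E} (hf : HasLineDerivAt ℝ f f' x v)
    (hg : HasLineDerivAt ℝ g g' x v) (h0 : g x ≠ 0) :
    HasLineDerivAt ℝ (fun y => f y / g y) ((f' * g x - f x * g') / g x ^ 2) x v := by
  refine HasDerivAt.congr_deriv (HasDerivAt.div hf hg (by simpa using h0)) ?_
  simp

lemma HasLineDerivAt.rpow_const' {f : E → ℝ} {f' : ℝ} {x v : E} (hf : HasLineDerivAt ℝ f f' x v)
    (h0 : 0 < f x) (a : ℝ) :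
    HasLineDerivAt ℝ (fun y => f y ^ a) (a * f x ^ (a - 1) * f') x v := by
  refine HasDerivAt.congr_deriv
    (HasDerivAt.rpow_const (p := a) hf (Or.inl (by simpa using h0.ne'))) ?_
  simp only [zero_smul, add_zero]
  ring

lemma HasLineDerivAt.sq' {f : E → ℝ} {f' : ℝ} {x v : E} (hf : HasLineDerivAt ℝ f f' x v) :
    HasLineDerivAt ℝ (fun y => f y ^ 2) (2 * f x * f') x v := by
  refine HasDerivAt.congr_deriv (HasDerivAt.pow hf 2) ?_
  simp

variable [FiniteDimensional ℝ E] [MeasurableSpace E] [BorelSpace E] (μ : Measure E)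
  [μ.IsAddHaarMeasure]

/-- One-dimensional Hardy inequality with the weight `σ ^ α`, `σ ≥ y ^ 2`, in the half space
`y > 0`. -/
lemma hardy_half_space {Ω K : Set E} (hΩ : IsOpen Ω) (hK : IsCompact K) (hKΩ : K ⊆ Ω)
    {σ y g : E → ℝ} {e : E} (hσ : ContDiffOn ℝ 1 σ Ω) (hy : ContDiffOn ℝ 1 y Ω)
    (hg : ContDiffOn ℝ 1 g Ω) (hg0 : ∀ x ∉ K, g x = 0)
    (hpos : ∀ x ∈ Ω, 0 < σ x) (hypos : ∀ x ∈ Ω, 0 < y x) (hle : ∀ x ∈ Ω, y x ^ 2 ≤ σ x)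
    (hσe : ∀ x ∈ Ω, fderiv ℝ σ x e = 2 * y x) (hye : ∀ x ∈ Ω, fderiv ℝ y x e = 1)
    {α : ℝ} (hα : 0 ≤ α) (hα2 : α < 1 / 2) :
    ∫ x, σ x ^ (α - 1) * g x ^ 2 ∂μ ≤
      4 / (1 - 2 * α) ^ 2 * ∫ x, σ x ^ α * (fderiv ℝ g x e) ^ 2 ∂μ := by
  set γ := 1 - 2 * α with hγ
  have hγ0 : 0 < γ := by linarith
  -- In the model case σ = y² this is y^(2α-1) g², the function behind the classical one-dimensional
  -- Hardy inequality with constant 4 / (1 - 2α)².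
  set f : E → ℝ := fun x => σ x ^ α / y x * g x ^ 2 with hf
  have hfc : ContDiffOn ℝ 1 f Ω :=
    ((ContDiffOn.rpow_pos hσ hpos α).div hy fun x hx => (hypos x hx).ne').mul (hg.pow 2)
  have hf0 : ∀ x ∉ K, f x = 0 := fun x hx => by simp [hf, hg0 x hx]
  have hz : ∀ x ∉ K, fderiv ℝ g x e = 0 := fun x hx => by
    simp [fderiv_eq_zero_of_eq_zero_off hK.isClosed hg0 hx]
  have hz' : ∀ x ∉ K, fderiv ℝ f x e = 0 := fun x hx => by
    simp [fderiv_eq_zero_of_eq_zero_off hK.isClosed hf0 hx]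
  have i1 : Integrable (fun x => σ x ^ (α - 1) * g x ^ 2) μ :=
    integrable_of_eq_zero_off hK hKΩ
      ((ContDiffOn.rpow_pos hσ hpos _).continuousOn.mul (hg.continuousOn.pow 2))
      fun x hx => by simp [hg0 x hx]
  have i2 : Integrable (fun x => σ x ^ α * (fderiv ℝ g x e) ^ 2) μ :=
    integrable_of_eq_zero_off hK hKΩ
      ((ContDiffOn.rpow_pos hσ hpos _).continuousOn.mul
        ((continuousOn_fderiv_apply hΩ hg e).pow 2)) fun x hx => by simp [hz x hx]
  have i3 := integrable_fderiv_of_eq_zero_off (μ := μ) hΩ hK hKΩ hfc hf0 e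
  have h3 := integral_fderiv_eq_zero_of_eq_zero_off (μ := μ) hΩ hK hKΩ hfc hf0 e
  have key : ∀ x, γ / 2 * (σ x ^ (α - 1) * g x ^ 2) ≤
      2 / γ * (σ x ^ α * (fderiv ℝ g x e) ^ 2) - fderiv ℝ f x e := by
    intro x
    by_cases hx : x ∈ K
    swap
    · simp [hg0 x hx, hz x hx, hz' x hx]
    have hx := hKΩ hx
    have l1 := hasLineDerivAt_of_contDiffOn hΩ hσ hx e
    have l2 := hasLineDerivAt_of_contDiffOn hΩ hy hx e
    have l3 := hasLineDerivAt_of_contDiffOn hΩ hg hx e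
    rw [hσe x hx] at l1
    rw [hye x hx] at l2
    have l4 := HasLineDerivAt.mul' (HasLineDerivAt.div' (HasLineDerivAt.rpow_const' l1 (hpos x hx) α)
      l2 (hypos x hx).ne') (HasLineDerivAt.sq' l3)
    rw [fderiv_apply_eq_of_hasLineDerivAt hΩ hfc hx l4]
    have hs := hpos x hx
    have hy0 := hypos x hx
    have hle' := hle x hx
    have e1 : σ x ^ α = σ x ^ (α - 1) * σ x := by
      rw [Real.rpow_sub_one hs.ne']; field_simp
    rw [e1]
    have hw : 0 < σ x ^ (α - 1) := Real.rpow_pos_of_pos hs _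
    set w := σ x ^ (α - 1)
    set p := fderiv ℝ g x e
    set G := g x
    set Y := y x
    set S := σ x
    -- The defect is a square plus a multiple of σ - y², so directions of σ other than y only help.
    have : 2 / γ * (w * S * p ^ 2) - ((α * w * (2 * Y) * Y - w * S * 1) / Y ^ 2 * G ^ 2 +
        w * S / Y * (2 * G * p)) - γ / 2 * (w * G ^ 2) =
        2 / γ * (w * S) * (p - γ / 2 * (G / Y)) ^ 2
        + w * (G / Y) ^ 2 * ((1 - γ / 2) * (S - Y ^ 2)) := by
      rw [hγ] at hγ0 ⊢
      field_simp
      ring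
    have h1 : 0 ≤ 2 / γ * (w * S) * (p - γ / 2 * (G / Y)) ^ 2 := by positivity
    have h2 : 0 ≤ w * (G / Y) ^ 2 * ((1 - γ / 2) * (S - Y ^ 2)) := by
      have : 0 ≤ 1 - γ / 2 := by linarith
      have : 0 ≤ S - Y ^ 2 := by linarith
      positivity
    linarith
  have hintegral := integral_mono (i1.const_mul _) ((i2.const_mul (2 / γ)).sub i3) key
  simp only [Pi.sub_apply] at hintegral
  rw [integral_sub (i2.const_mul _) i3, integral_const_mul, integral_const_mul, h3, sub_zero]
    at hintegral
  have h5 := mul_le_mul_of_nonneg_left hintegral (by positivity : 0 ≤ 2 / γ)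
  rw [← mul_assoc, ← mul_assoc] at h5
  have e5 : 2 / γ * (γ / 2) = 1 := by field_simp
  have e6 : 2 / γ * (2 / γ) = 4 / γ ^ 2 := by field_simp; norm_num
  rwa [e5, e6, one_mul] at h5

/-- Hardy inequality in the complement of a half hyperplane `{y₂ = 0, y₁ ≤ 0}`. -/
lemma hardy_slit {Ω K : Set E} (hΩ : IsOpen Ω) (hK : IsCompact K) (hKΩ : K ⊆ Ω)
    {σ y₁ y₂ g : E → ℝ} {e₁ e₂ : E} (hσ : ContDiffOn ℝ 1 σ Ω) (hy₁ : ContDiffOn ℝ 1 y₁ Ω)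
    (hy₂ : ContDiffOn ℝ 1 y₂ Ω)
    (hg : ContDiffOn ℝ 1 g Ω) (hg0 : ∀ x ∉ K, g x = 0)
    (hpos : ∀ x ∈ Ω, 0 < σ x) (hypos : ∀ x ∈ Ω, 0 < √(y₁ x ^ 2 + y₂ x ^ 2) + y₁ x)
    (hle : ∀ x ∈ Ω, y₁ x ^ 2 + y₂ x ^ 2 ≤ σ x)
    (hσ₁ : ∀ x ∈ Ω, fderiv ℝ σ x e₁ = 2 * y₁ x) (hσ₂ : ∀ x ∈ Ω, fderiv ℝ σ x e₂ = 2 * y₂ x)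
    (h11 : ∀ x ∈ Ω, fderiv ℝ y₁ x e₁ = 1) (h12 : ∀ x ∈ Ω, fderiv ℝ y₁ x e₂ = 0)
    (h21 : ∀ x ∈ Ω, fderiv ℝ y₂ x e₁ = 0) (h22 : ∀ x ∈ Ω, fderiv ℝ y₂ x e₂ = 1)
    (α : ℝ) :
    ∫ x, σ x ^ (α - 1) * g x ^ 2 ∂μ ≤
      4 * ∫ x, σ x ^ α * ((fderiv ℝ g x e₁) ^ 2 + (fderiv ℝ g x e₂) ^ 2) ∂μ := by
  have hr : ∀ x ∈ Ω, 0 < y₁ x ^ 2 + y₂ x ^ 2 := by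
    intro x hx
    by_contra! h
    have h1 : y₁ x = 0 := by nlinarith [sq_nonneg (y₁ x), sq_nonneg (y₂ x)]
    have h2 : y₂ x = 0 := by nlinarith [sq_nonneg (y₁ x), sq_nonneg (y₂ x)]
    have := hypos x hx
    simp [h1, h2] at this
  set s : E → ℝ := fun x => √(y₁ x ^ 2 + y₂ x ^ 2) with hs
  have hsc : ContDiffOn ℝ 1 s Ω :=
    ((hy₁.pow 2).add (hy₂.pow 2)).sqrt fun x hx => (hr x hx).ne'
  -- `q` is tan(ϑ/2) for the polar angle ϑ ∈ (-π, π) in the (y₁, y₂)-plane, smooth off the slit. Its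
  -- angular derivative is (1 + q²)/2, while σ is invariant under rotation. Integrating the angular
  -- derivative of σ^(α-1) q g² is the proof of ∫ g² ≤ 4 ∫ g_ϑ² on an interval of length 2π with
  -- zero end values; no restriction on α arises.
  set q : E → ℝ := fun x => y₂ x / (s x + y₁ x) with hq
  have hqc : ContDiffOn ℝ 1 q Ω := hy₂.div (hsc.add hy₁) fun x hx => (hypos x hx).ne'
  set f₁ : E → ℝ := fun x => q x * σ x ^ (α - 1) * y₂ x * g x ^ 2 with hf₁
  set f₂ : E → ℝ := fun x => q x * σ x ^ (α - 1) * y₁ x * g x ^ 2 with hf₂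
  have hc := ContDiffOn.rpow_pos hσ hpos
  have hf₁c : ContDiffOn ℝ 1 f₁ Ω := ((hqc.mul (hc _)).mul hy₂).mul (hg.pow 2)
  have hf₂c : ContDiffOn ℝ 1 f₂ Ω := ((hqc.mul (hc _)).mul hy₁).mul (hg.pow 2)
  have hf₁0 : ∀ x ∉ K, f₁ x = 0 := fun x hx => by simp [hf₁, hg0 x hx]
  have hf₂0 : ∀ x ∉ K, f₂ x = 0 := fun x hx => by simp [hf₂, hg0 x hx]
  have hz : ∀ x ∉ K, fderiv ℝ g x = 0 := fun x hx =>
    fderiv_eq_zero_of_eq_zero_off hK.isClosed hg0 hx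
  have i1 : Integrable (fun x => σ x ^ (α - 1) * g x ^ 2) μ :=
    integrable_of_eq_zero_off hK hKΩ ((hc _).continuousOn.mul (hg.continuousOn.pow 2))
      fun x hx => by simp [hg0 x hx]
  have i2 : Integrable (fun x => σ x ^ α * ((fderiv ℝ g x e₁) ^ 2 + (fderiv ℝ g x e₂) ^ 2)) μ :=
    integrable_of_eq_zero_off hK hKΩ
      ((hc _).continuousOn.mul (((continuousOn_fderiv_apply hΩ hg e₁).pow 2).add
        ((continuousOn_fderiv_apply hΩ hg e₂).pow 2))) fun x hx => by simp [hz x hx]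
  have i3 := integrable_fderiv_of_eq_zero_off (μ := μ) hΩ hK hKΩ hf₁c hf₁0 e₁
  have h3 := integral_fderiv_eq_zero_of_eq_zero_off (μ := μ) hΩ hK hKΩ hf₁c hf₁0 e₁
  have i4 := integrable_fderiv_of_eq_zero_off (μ := μ) hΩ hK hKΩ hf₂c hf₂0 e₂
  have h4 := integral_fderiv_eq_zero_of_eq_zero_off (μ := μ) hΩ hK hKΩ hf₂c hf₂0 e₂
  have key : ∀ x, σ x ^ (α - 1) * g x ^ 2 ≤
      4 * (σ x ^ α * ((fderiv ℝ g x e₁) ^ 2 + (fderiv ℝ g x e₂) ^ 2))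
        - (2 * fderiv ℝ f₁ x e₁ - 2 * fderiv ℝ f₂ x e₂) := by
    intro x
    by_cases hx : x ∈ K
    swap
    · simp [hg0 x hx, hz x hx, fderiv_eq_zero_of_eq_zero_off hK.isClosed hf₁0 hx,
        fderiv_eq_zero_of_eq_zero_off hK.isClosed hf₂0 hx]
    have hx := hKΩ hx
    have hD : ∀ v, HasLineDerivAt ℝ s ((y₁ x * fderiv ℝ y₁ x v + y₂ x * fderiv ℝ y₂ x v) / s x)
        x v := by
      intro v
      have a1 := HasLineDerivAt.sq' (hasLineDerivAt_of_contDiffOn hΩ hy₁ hx v)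
      have a2 := HasLineDerivAt.sq' (hasLineDerivAt_of_contDiffOn hΩ hy₂ hx v)
      have a3 := HasDerivAt.sqrt (HasDerivAt.add a1 a2) (by simpa using (hr x hx).ne')
      refine HasDerivAt.congr_deriv a3 ?_
      simp only [zero_smul, add_zero, Pi.add_apply, hs]
      have : 0 < √(y₁ x ^ 2 + y₂ x ^ 2) := Real.sqrt_pos.2 (hr x hx)
      field_simp
    have hq' : ∀ v, HasLineDerivAt ℝ q ((fderiv ℝ y₂ x v * (s x + y₁ x) - y₂ x *
        ((y₁ x * fderiv ℝ y₁ x v + y₂ x * fderiv ℝ y₂ x v) / s x + fderiv ℝ y₁ x v))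
          / (s x + y₁ x) ^ 2) x v := fun v =>
      HasLineDerivAt.div' (hasLineDerivAt_of_contDiffOn hΩ hy₂ hx v)
        (HasDerivAt.add (hD v) (hasLineDerivAt_of_contDiffOn hΩ hy₁ hx v)) (hypos x hx).ne'
    have hσ' : ∀ v, HasLineDerivAt ℝ (fun x => σ x ^ (α - 1)) ((α - 1) * σ x ^ (α - 1 - 1) *
        fderiv ℝ σ x v) x v := fun v =>
      HasLineDerivAt.rpow_const' (hasLineDerivAt_of_contDiffOn hΩ hσ hx v) (hpos x hx) _
    have d1 := HasLineDerivAt.mul' (HasLineDerivAt.mul' (HasLineDerivAt.mul' (hq' e₁) (hσ' e₁))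
      (hasLineDerivAt_of_contDiffOn hΩ hy₂ hx e₁))
      (HasLineDerivAt.sq' (hasLineDerivAt_of_contDiffOn hΩ hg hx e₁))
    have d2 := HasLineDerivAt.mul' (HasLineDerivAt.mul' (HasLineDerivAt.mul' (hq' e₂) (hσ' e₂))
      (hasLineDerivAt_of_contDiffOn hΩ hy₁ hx e₂))
      (HasLineDerivAt.sq' (hasLineDerivAt_of_contDiffOn hΩ hg hx e₂))
    rw [fderiv_apply_eq_of_hasLineDerivAt hΩ hf₁c hx d1,
      fderiv_apply_eq_of_hasLineDerivAt hΩ hf₂c hx d2, hσ₁ x hx, hσ₂ x hx, h11 x hx, h12 x hx,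
      h21 x hx, h22 x hx]
    have hS := hpos x hx
    have hsp := hypos x hx
    have hle' := hle x hx
    have hs0 : 0 < s x := Real.sqrt_pos.2 (hr x hx)
    have hss : s x ^ 2 = y₁ x ^ 2 + y₂ x ^ 2 := Real.sq_sqrt (hr x hx).le
    have e1 : σ x ^ α = σ x ^ (α - 1) * σ x := by
      rw [Real.rpow_sub_one hS.ne']; field_simp
    have hw : 0 < σ x ^ (α - 1) := Real.rpow_pos_of_pos hS _
    rw [e1]
    change 0 < s x + y₁ x at hsp
    simp only [hq]
    set w := σ x ^ (α - 1)
    set w' := σ x ^ (α - 1 - 1)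
    set p₁ := fderiv ℝ g x e₁
    set p₂ := fderiv ℝ g x e₂
    set G := g x
    set A := y₁ x
    set B := y₂ x
    set S := σ x
    set r := s x
    have hq1 : (0 * (r + A) - B * ((A * 1 + B * 0) / r + 1)) / (r + A) ^ 2
        = - (B / (r * (r + A))) := by
      field_simp; ring
    have hq2 : (1 * (r + A) - B * ((A * 0 + B * 1) / r + 0)) / (r + A) ^ 2
        = A / (r * (r + A)) := by
      rw [div_eq_div_iff (by positivity) (by positivity)]
      field_simp
      linear_combination hss
    rw [hq1, hq2]
    set Q := B / (r + A) with hQ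
    have hQ2 : 2 * r / (r + A) = 1 + Q ^ 2 := by
      rw [hQ]; field_simp; linear_combination hss
    have hR : (A * p₂ - B * p₁) ^ 2 ≤ S * (p₁ ^ 2 + p₂ ^ 2) := by
      nlinarith [sq_nonneg (A * p₁ + B * p₂), sq_nonneg p₁, sq_nonneg p₂]
    have h1 : w * (A * p₂ - B * p₁) ^ 2 ≤ w * (S * (p₁ ^ 2 + p₂ ^ 2)) :=
      mul_le_mul_of_nonneg_left hR hw.le
    have main : 4 * (w * (A * p₂ - B * p₁) ^ 2) - (2 * (((-(B / (r * (r + A))) * w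
        + Q * ((α - 1) * w' * (2 * A))) * B + Q * w * 0) * G ^ 2 + Q * w * B * (2 * G * p₁))
        - 2 * (((A / (r * (r + A)) * w + Q * ((α - 1) * w' * (2 * B))) * A + Q * w * 0) * G ^ 2
          + Q * w * A * (2 * G * p₂))) - w * G ^ 2
        = w * (2 * (A * p₂ - B * p₁) + Q * G) ^ 2 := by
      have : (2 * (B / (r * (r + A))) * B + 2 * (A / (r * (r + A))) * A) = 1 + Q ^ 2 := by
        rw [← hQ2]; field_simp; linear_combination -hss
      linear_combination (w * G ^ 2) * this
    have : 0 ≤ w * (2 * (A * p₂ - B * p₁) + Q * G) ^ 2 := by positivity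
    linarith
  have i5 : Integrable (fun x => 2 * fderiv ℝ f₁ x e₁ - 2 * fderiv ℝ f₂ x e₂) μ :=
    (i3.const_mul 2).sub (i4.const_mul 2)
  have hintegral := integral_mono i1 ((i2.const_mul 4).sub i5) key
  simp only [Pi.sub_apply] at hintegral
  rw [integral_sub (i2.const_mul _) i5, integral_sub (i3.const_mul 2) (i4.const_mul 2),
    integral_const_mul, integral_const_mul,
    integral_const_mul, h3, h4] at hintegral
  linarith

/-- Hardy inequality with three free directions. -/
lemma hardy_three {Ω K : Set E} (hΩ : IsOpen Ω) (hK : IsCompact K) (hKΩ : K ⊆ Ω)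
    {σ g : E → ℝ} {y : Fin 3 → E → ℝ} {e : Fin 3 → E} (hσ : ContDiffOn ℝ 1 σ Ω)
    (hy : ∀ i, ContDiffOn ℝ 1 (y i) Ω)
    (hg : ContDiffOn ℝ 1 g Ω) (hg0 : ∀ x ∉ K, g x = 0)
    (hpos : ∀ x ∈ Ω, 0 < σ x) (hle : ∀ x ∈ Ω, ∑ i, y i x ^ 2 ≤ σ x)
    (hσe : ∀ i, ∀ x ∈ Ω, fderiv ℝ σ x (e i) = 2 * y i x)
    (hye : ∀ i, ∀ x ∈ Ω, fderiv ℝ (y i) x (e i) = 1)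
    {α : ℝ} (hα : 0 ≤ α) (hα1 : α ≤ 1) :
    ∫ x, σ x ^ (α - 1) * g x ^ 2 ∂μ ≤
      4 * ∫ x, σ x ^ α * ∑ i, (fderiv ℝ g x (e i)) ^ 2 ∂μ := by
  -- The radial field σ^(α-1) y g². With N directions its divergence contains N σ^(α-1) g², and
  -- completing the square needs 2N - 2 ≥ 4 (1 - α); N = 3 is enough for all α ≥ 0. Lagrange's
  -- identity supplies the remaining squares.
  set f : Fin 3 → E → ℝ := fun i x => σ x ^ (α - 1) * y i x * g x ^ 2 with hf
  have hc := ContDiffOn.rpow_pos hσ hpos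
  have hfc : ∀ i, ContDiffOn ℝ 1 (f i) Ω := fun i => ((hc _).mul (hy i)).mul (hg.pow 2)
  have hf0 : ∀ i, ∀ x ∉ K, f i x = 0 := fun i x hx => by simp [hf, hg0 x hx]
  have hz : ∀ x ∉ K, fderiv ℝ g x = 0 := fun x hx =>
    fderiv_eq_zero_of_eq_zero_off hK.isClosed hg0 hx
  have i1 : Integrable (fun x => σ x ^ (α - 1) * g x ^ 2) μ :=
    integrable_of_eq_zero_off hK hKΩ ((hc _).continuousOn.mul (hg.continuousOn.pow 2))
      fun x hx => by simp [hg0 x hx]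
  have i2 : Integrable (fun x => σ x ^ α * ∑ i, (fderiv ℝ g x (e i)) ^ 2) μ :=
    integrable_of_eq_zero_off hK hKΩ
      ((hc _).continuousOn.mul (continuousOn_finsetSum _ fun i _ =>
        (continuousOn_fderiv_apply hΩ hg (e i)).pow 2)) fun x hx => by simp [hz x hx]
  have i3 := fun i => integrable_fderiv_of_eq_zero_off (μ := μ) hΩ hK hKΩ (hfc i) (hf0 i) (e i)
  have h3 := fun i => integral_fderiv_eq_zero_of_eq_zero_off (μ := μ) hΩ hK hKΩ (hfc i) (hf0 i)
    (e i)
  have i4 : Integrable (fun x => ∑ i, fderiv ℝ (f i) x (e i)) μ :=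
    integrable_finsetSum _ fun i _ => i3 i
  have h4 : ∫ x, ∑ i, fderiv ℝ (f i) x (e i) ∂μ = 0 := by
    rw [integral_finsetSum _ fun i _ => i3 i]
    simp [h3]
  have key : ∀ x, σ x ^ (α - 1) * g x ^ 2 ≤
      4 * (σ x ^ α * ∑ i, (fderiv ℝ g x (e i)) ^ 2) + 2 * ∑ i, fderiv ℝ (f i) x (e i) := by
    intro x
    by_cases hx : x ∈ K
    swap
    · simp [hg0 x hx, hz x hx, fun i => fderiv_eq_zero_of_eq_zero_off hK.isClosed (hf0 i) hx]
    have hx := hKΩ hx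
    have hd : ∀ i, fderiv ℝ (f i) x (e i) = ((α - 1) * σ x ^ (α - 1 - 1) * (2 * y i x) * y i x +
        σ x ^ (α - 1) * 1) * g x ^ 2 + σ x ^ (α - 1) * y i x * (2 * g x * fderiv ℝ g x (e i)) := by
      intro i
      have l1 := hasLineDerivAt_of_contDiffOn hΩ hσ hx (e i)
      have l2 := hasLineDerivAt_of_contDiffOn hΩ (hy i) hx (e i)
      rw [hσe i x hx] at l1
      rw [hye i x hx] at l2
      exact fderiv_apply_eq_of_hasLineDerivAt hΩ (hfc i) hx
        (HasLineDerivAt.mul' (HasLineDerivAt.mul' (HasLineDerivAt.rpow_const' l1 (hpos x hx) _) l2)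
          (HasLineDerivAt.sq' (hasLineDerivAt_of_contDiffOn hΩ hg hx (e i))))
    simp only [hd]
    have hS := hpos x hx
    have hle' := hle x hx
    have e1 : σ x ^ α = σ x ^ (α - 1 - 1) * σ x ^ 2 := by
      rw [Real.rpow_sub_one hS.ne', Real.rpow_sub_one hS.ne']; field_simp
    have e2 : σ x ^ (α - 1) = σ x ^ (α - 1 - 1) * σ x := by
      rw [Real.rpow_sub_one hS.ne' (α - 1)]; field_simp
    have hw : 0 < σ x ^ (α - 1 - 1) := Real.rpow_pos_of_pos hS _
    rw [e1, e2]
    simp only [Fin.sum_univ_three] at hle' ⊢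
    set w := σ x ^ (α - 1 - 1)
    set p₁ := fderiv ℝ g x (e 0)
    set p₂ := fderiv ℝ g x (e 1)
    set p₃ := fderiv ℝ g x (e 2)
    set G := g x
    set A := y 0 x
    set B := y 1 x
    set C := y 2 x
    set S := σ x
    have h0 : 0 ≤ S - (A ^ 2 + B ^ 2 + C ^ 2) := by linarith
    have h1 : 0 ≤ w * S * ((2 * p₁ * A + 2 * p₂ * B + 2 * p₃ * C + G) ^ 2) := by positivity
    have h2 : 0 ≤ w * ((4 * (1 - α)) * (S - (A ^ 2 + B ^ 2 + C ^ 2)) * G ^ 2) := by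
      have : 0 ≤ 1 - α := by linarith
      positivity
    have h2' : 0 ≤ w * S * (4 * α * G ^ 2) := by positivity
    have h3 : 0 ≤ w * S * (4 * (S - (A ^ 2 + B ^ 2 + C ^ 2)) * (p₁ ^ 2 + p₂ ^ 2 + p₃ ^ 2)) := by
      positivity
    have h4 : 0 ≤ w * S * (4 * ((A * p₂ - B * p₁) ^ 2 + (A * p₃ - C * p₁) ^ 2
        + (B * p₃ - C * p₂) ^ 2)) := by positivity
    nlinarith
  have hintegral := integral_mono i1 ((i2.const_mul 4).add (i4.const_mul 2)) key
  simp only [Pi.add_apply] at hintegral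
  rw [integral_add (i2.const_mul _) (i4.const_mul 2), integral_const_mul, integral_const_mul, h4]
    at hintegral
  linarith

end Hardy

/-! ### Directions missed by a star-shaped Lipschitz cross section. -/

section Geometry

lemma exists_ball_subset_of_mem_intrinsicInterior {V : Type*} [NormedAddCommGroup V]
    [NormedSpace ℝ V] {Γ : Set V} {p : V} (hp : p ∈ intrinsicInterior ℝ Γ) :
    ∃ r > 0, ∀ v ∈ (affineSpan ℝ Γ).direction, ‖v‖ < r → p + v ∈ Γ := by
  obtain ⟨y, hy, rfl⟩ := mem_intrinsicInterior.1 hp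
  obtain ⟨r, hr, hb⟩ := Metric.mem_nhds_iff.1 (mem_interior_iff_mem_nhds.1 hy)
  refine ⟨r, hr, fun v hv hvr => ?_⟩
  have hm : v +ᵥ (y : V) ∈ affineSpan ℝ Γ := AffineSubspace.vadd_mem_of_mem_direction hv y.2
  have : (⟨v +ᵥ (y : V), hm⟩ : affineSpan ℝ Γ) ∈ Metric.ball y r := by
    rw [Metric.mem_ball, Subtype.dist_eq]
    simpa [dist_eq_norm] using hvr
  have h := hb this
  simpa [add_comm] using h

variable {m : ℕ} {ω Γ₁ : Set (Eucl m)}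

lemma IsSimplex.isCompact {j : ℕ} (h : IsSimplex j Γ₁) : IsCompact Γ₁ := by
  obtain ⟨s, rfl⟩ := h
  exact (Set.finite_range s.points).isCompact_convexHull ℝ

lemma IsSimplex.convex {j : ℕ} (h : IsSimplex j Γ₁) : Convex ℝ Γ₁ := by
  obtain ⟨s, rfl⟩ := h
  exact convex_convexHull _ _

lemma IsSimplex.nonempty {j : ℕ} (h : IsSimplex j Γ₁) : Γ₁.Nonempty := by
  obtain ⟨s, rfl⟩ := h
  exact (Set.range_nonempty _).convexHull

lemma IsAdmissible.isCompact (h : IsAdmissible ω Γ₁) : IsCompact Γ₁ := by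
  obtain ⟨j, -, hj⟩ := h.simplex
  exact hj.isCompact

lemma IsAdmissible.convex (h : IsAdmissible ω Γ₁) : Convex ℝ Γ₁ := by
  obtain ⟨j, -, hj⟩ := h.simplex
  exact hj.convex

lemma IsAdmissible.nonempty (h : IsAdmissible ω Γ₁) : Γ₁.Nonempty := by
  obtain ⟨j, -, hj⟩ := h.simplex
  exact hj.nonempty

lemma IsAdmissible.subset_frontier (h : IsAdmissible ω Γ₁) : Γ₁ ⊆ frontier ω := by
  obtain ⟨Γ₂, hΓ, -, -⟩ := h.starShaped
  rw [hΓ]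
  exact Set.subset_union_left

lemma IsAdmissible.notMem (h : IsAdmissible ω Γ₁) {x : Eucl m} (hx : x ∈ Γ₁) : x ∉ ω := by
  have := h.subset_frontier hx
  rw [h.domain.isOpen.frontier_eq] at this
  exact this.2

/-- The point `y` lies on an open segment that starts at `x` and is contained in ω, so the part of
it between `x` and `y` is in ω as well. -/
lemma IsAdmissible.segment_mem (h : IsAdmissible ω Γ₁) {x y : Eucl m} (hx : x ∈ Γ₁) (hy : y ∈ ω)
    {t : ℝ} (ht : 0 < t) (ht1 : t ≤ 1) : x + t • (y - x) ∈ ω := by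
  obtain ⟨Γ₂, -, -, hs⟩ := h.starShaped
  obtain ⟨z, -, -, hz⟩ := hs x hx y hy
  have hy' : y ∈ openSegment ℝ x z := by
    rw [← hz]
    exact ⟨⟨1, by norm_num, by simp⟩, hy⟩
  obtain ⟨a, b, ha, hb, hab, rfl⟩ := hy'
  have : x + t • (a • x + b • z - x) ∈ openSegment ℝ x z := by
    refine ⟨1 - t * b, t * b, by nlinarith, by positivity, by ring, ?_⟩
    obtain rfl : a = 1 - b := by linarith
    module
  rw [← hz] at this
  exact this.2

/-- At a boundary point of a Lipschitz domain there is a direction outside a given proper subspace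
which points to the exterior. -/
lemma exists_exterior_direction (h : HasLipschitzBoundary ω) (ho : IsOpen ω) {p : Eucl m}
    (hp : p ∈ frontier ω) {D : Submodule ℝ (Eucl m)} (hD : D ≠ ⊤) :
    ∃ d ∉ D, ∀ᶠ τ in nhdsWithin (0 : ℝ) (Set.Ioi 0), p + τ • d ∉ ω := by
  obtain ⟨ν, φ, K, U, hν, hφ, hU, hpU, hω⟩ := h p hp
  -- The downward direction -ν is exterior and may be tilted by a vector of norm at most 1 / (1 + K)
  -- without crossing the graph. Such a tilt moves it out of `D` if necessary.
  obtain ⟨e, he, heD⟩ : ∃ e : Eucl m, ‖e‖ * (1 + K) ≤ 1 ∧ -ν + e ∉ D := by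
    by_cases hνD : ν ∈ D
    · obtain ⟨v, hv⟩ : ∃ v, v ∉ D := by
        by_contra! hall
        exact hD (eq_top_iff.2 fun v _ => hall v)
      have hK : (0 : ℝ) < 1 + K := by positivity
      refine ⟨(((1 + K : ℝ) * (‖v‖ + 1))⁻¹) • v, ?_, fun hmem => hv ?_⟩
      · rw [norm_smul, Real.norm_of_nonneg (by positivity)]
        rw [inv_mul_eq_div, div_mul_eq_mul_div, div_le_one (by positivity)]
        nlinarith [norm_nonneg v]
      · have : (((1 + K : ℝ) * (‖v‖ + 1))⁻¹) • v ∈ D := by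
          have := D.add_mem hνD hmem
          simpa using this
        exact (D.smul_mem_iff (by positivity)).1 this
    · exact ⟨0, by simp, by simpa using hνD⟩
  refine ⟨-ν + e, heD, ?_⟩
  have hcont : Filter.Tendsto (fun τ : ℝ => p + τ • (-ν + e)) (nhdsWithin 0 (Set.Ioi 0))
      (nhds p) := by
    have : Continuous fun τ : ℝ => p + τ • (-ν + e) := by fun_prop
    have := this.tendsto 0
    simp only [zero_smul, add_zero] at this
    exact this.mono_left nhdsWithin_le_nhds
  filter_upwards [hcont.eventually (hU.mem_nhds hpU), self_mem_nhdsWithin] with τ hτU hτ hmem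
  have hτ0 : 0 < τ := hτ
  have h1 : p + τ • (-ν + e) ∈ ω ∩ U := ⟨hmem, hτU⟩
  rw [hω] at h1
  have h2 := h1.1
  simp only [Set.mem_ofPred_eq] at h2
  have hpω : p ∉ ω := by
    rw [ho.frontier_eq] at hp
    exact hp.2
  have h3 : inner ℝ ν p ≤ φ ((ℝ ∙ ν)ᗮ.orthogonalProjectionOnto p) := by
    by_contra! hlt
    have : p ∈ ω ∩ U := by
      rw [hω]
      exact ⟨hlt, hpU⟩
    exact hpω this.1
  have hproj : (ℝ ∙ ν)ᗮ.orthogonalProjectionOnto ν = 0 := by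
    simp
  have h4 : (ℝ ∙ ν)ᗮ.orthogonalProjectionOnto (p + τ • (-ν + e))
      - (ℝ ∙ ν)ᗮ.orthogonalProjectionOnto p = τ • (ℝ ∙ ν)ᗮ.orthogonalProjectionOnto e := by
    simp [hproj]
  have h5 := hφ.dist_le_mul ((ℝ ∙ ν)ᗮ.orthogonalProjectionOnto (p + τ • (-ν + e)))
    ((ℝ ∙ ν)ᗮ.orthogonalProjectionOnto p)
  rw [dist_eq_norm, dist_eq_norm, h4, norm_smul, Real.norm_of_nonneg hτ0.le] at h5
  have h6 : ‖(ℝ ∙ ν)ᗮ.orthogonalProjectionOnto e‖ ≤ ‖e‖ :=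
    Submodule.norm_orthogonalProjectionOnto_apply_le _ e
  have h7 : inner ℝ ν (p + τ • (-ν + e)) = inner ℝ ν p + τ * (-1 + inner ℝ ν e) := by
    rw [inner_add_right, inner_smul_right, inner_add_right, inner_neg_right,
      real_inner_self_eq_norm_sq, hν]
    norm_num
  have h8 : inner ℝ ν e ≤ ‖e‖ := by simpa [hν] using real_inner_le_norm ν e
  rw [h7] at h2
  have h9 := (abs_le.1 h5).1
  have h10 : K * (τ * ‖(ℝ ∙ ν)ᗮ.orthogonalProjectionOnto e‖) ≤ K * (τ * ‖e‖) := by gcongr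
  nlinarith

/-- The cross section avoids the affine span of `Γ₁`, and modulo this span it avoids some open
half line. -/
lemma IsAdmissible.exists_missing_direction (h : IsAdmissible ω Γ₁) :
    ∃ p ∈ Γ₁, (∀ x ∈ ω, x - p ∉ (affineSpan ℝ Γ₁).direction) ∧
      ∃ θ ∈ ((affineSpan ℝ Γ₁).direction)ᗮ, θ ≠ 0 ∧
        ∀ x ∈ ω, ∀ s : ℝ, 0 < s → x - p - s • θ ∉ (affineSpan ℝ Γ₁).direction := by
  set D := (affineSpan ℝ Γ₁).direction with hDdef
  obtain ⟨p, hp⟩ := h.nonempty.intrinsicInterior h.convex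
  have hpΓ := intrinsicInterior_subset hp
  obtain ⟨r, hr, hball⟩ := exists_ball_subset_of_mem_intrinsicInterior hp
  rw [← hDdef] at hball
  have hmiss : ∀ x ∈ ω, x - p ∉ D := by
    intro x hx hxD
    -- If x - p were in `D`, points of the segment from `p` to `x` close to `p` would be in Γ₁, as
    -- `p` is a relative interior point, and also in ω.
    set t := min 1 (r / (2 * (‖x - p‖ + 1)))
    have ht : 0 < t := lt_min one_pos (by positivity)
    refine h.notMem (hball (t • (x - p)) (D.smul_mem _ hxD) ?_)
      (h.segment_mem hpΓ hx ht (min_le_left _ _))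
    rw [norm_smul, Real.norm_of_nonneg ht.le]
    calc t * ‖x - p‖ ≤ r / (2 * (‖x - p‖ + 1)) * ‖x - p‖ := by gcongr; exact min_le_right _ _
      _ < r := by
        rw [div_mul_eq_mul_div, div_lt_iff₀ (by positivity)]
        nlinarith [norm_nonneg (x - p)]
  obtain ⟨x₀, hx₀⟩ := h.domain.isConnected.nonempty
  have hDtop : D ≠ ⊤ := fun hT => hmiss x₀ hx₀ (hT ▸ Submodule.mem_top)
  obtain ⟨d, hd, hext⟩ := exists_exterior_direction h.domain.lipschitz h.domain.isOpen
    (h.subset_frontier hpΓ) hDtop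
  refine ⟨p, hpΓ, hmiss, Dᗮ.starProjection d, Dᗮ.starProjection_apply_mem d, ?_, ?_⟩
  · intro h0
    have := Dᗮ.sub_starProjection_mem_orthogonal d
    rw [h0, sub_zero, Submodule.orthogonal_orthogonal] at this
    exact hd this
  · intro x hx s hs hmem
    set θ := Dᗮ.starProjection d
    have hr' : d - θ ∈ D := by
      have := Dᗮ.sub_starProjection_mem_orthogonal d
      rwa [Submodule.orthogonal_orthogonal] at this
    -- If x - p - s θ is in `D`, then p + τ d lies on the segment from the point p + v τ of Γ₁ to
    -- `x`, at parameter τ / s; this determines `v`. So p + τ d is in ω for small τ > 0, although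
    -- `d` points outwards.
    set v : ℝ → Eucl m := fun τ =>
      (1 - τ / s)⁻¹ • (τ • (d - θ) - (τ / s) • (x - p - s • θ)) with hv
    have hvc : Filter.Tendsto v (nhdsWithin (0 : ℝ) (Set.Ioi 0)) (nhds 0) := by
      have : ContinuousAt v 0 := by
        have h1 : ContinuousAt (fun τ : ℝ => (1 - τ / s)⁻¹) 0 :=
          ContinuousAt.inv₀ (by fun_prop) (by simp)
        exact h1.smul (by fun_prop)
      have h0 : v 0 = 0 := by simp [hv]
      have := this.tendsto
      rw [h0] at this
      exact this.mono_left nhdsWithin_le_nhds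
    have hvD : ∀ τ, v τ ∈ D := fun τ =>
      D.smul_mem _ (D.sub_mem (D.smul_mem _ hr') (D.smul_mem _ hmem))
    have e1 : ∀ᶠ τ in nhdsWithin (0 : ℝ) (Set.Ioi 0), ‖v τ‖ < r := by
      have := hvc.norm
      rw [norm_zero] at this
      exact this.eventually (gt_mem_nhds hr)
    have e2 : ∀ᶠ τ in nhdsWithin (0 : ℝ) (Set.Ioi 0), τ ∈ Set.Ioo 0 s :=
      Ioo_mem_nhdsGT hs
    obtain ⟨τ, ⟨h1, h2⟩, h3⟩ := ((e1.and e2).and hext).exists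
    apply h3
    have h4 := h.segment_mem (hball (v τ) (hvD τ) h1) hx (div_pos h2.1 hs)
      ((div_le_one hs).2 h2.2.le)
    convert h4 using 1
    have hne : 1 - τ / s ≠ 0 := by
      have : τ / s < 1 := (div_lt_one hs).2 h2.2
      linarith
    have h5 : (1 - τ / s) • v τ = τ • (d - θ) - (τ / s) • (x - p - s • θ) := by
      rw [hv]; simp only; rw [smul_smul, mul_inv_cancel₀ hne, one_smul]
    have h6 : p + v τ + (τ / s) • (x - (p + v τ))
        = p + (1 - τ / s) • v τ + (τ / s) • (x - p) := by module
    rw [h6, h5, smul_sub (τ / s) (x - p), smul_smul, div_mul_cancel₀ _ hs.ne']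
    module

end Geometry

/-! ### The distance on the cylinder, and the Hardy inequality over an admissible cross section. -/

section Cylinder

variable {m : ℕ}

/-- `tail` as a continuous linear map. -/
def tailL (m : ℕ) : Eucl (m + 1) →L[ℝ] Eucl m :=
  LinearMap.toContinuousLinearMap
    { toFun := tail
      map_add' := fun x y => by ext i; simp [tail]
      map_smul' := fun c x => by ext i; simp [tail] }

@[simp] lemma tailL_apply (x : Eucl (m + 1)) : tailL m x = tail x := rfl

lemma continuous_tail : Continuous (tail : Eucl (m + 1) → Eucl m) := (tailL m).continuous

/-- The embedding `x' ↦ (0, x')`. -/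
def embed (e : Eucl m) : Eucl (m + 1) := WithLp.toLp 2 (Fin.cons 0 e)

@[simp] lemma tail_embed (e : Eucl m) : tail (embed e) = e := by
  ext i; simp [tail, embed]

@[simp] lemma tail_single_zero : tail (EuclideanSpace.single 0 1 : Eucl (m + 1)) = 0 := by
  ext i; simp [tail]

@[simp] lemma tail_single_succ (i : Fin m) :
    tail (EuclideanSpace.single i.succ 1 : Eucl (m + 1)) = EuclideanSpace.single i 1 := by
  ext j; simp [tail]

lemma isOpen_cylinder {ω : Set (Eucl m)} (h : ℝ) (hω : IsOpen ω) : IsOpen (cylinder h ω) :=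
  (isOpen_Ioo.preimage (by fun_prop : Continuous fun x : Eucl (m + 1) => x 0)).inter
    (hω.preimage continuous_tail)

lemma fderiv_apply_eq_sum_pd {d : ℕ} (f : Eucl d → ℝ) (x v : Eucl d) :
    fderiv ℝ f x v = ∑ i, v i * pd i f x := by
  have : v = ∑ i, v i • EuclideanSpace.single i (1 : ℝ) := by
    ext j; simp [Finset.sum_apply, Pi.single_apply]
  conv_lhs => rw [this]
  simp [pd]

lemma fderiv_apply_embed (f : Eucl (m + 1) → ℝ) (x : Eucl (m + 1)) (e : Eucl m) :
    fderiv ℝ f x (embed e) = inner ℝ e (WithLp.toLp 2 fun i => pd i.succ f x) := by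
  rw [fderiv_apply_eq_sum_pd, Fin.sum_univ_succ]
  simp [embed, PiLp.inner_apply, mul_comm]

/-- Square of the distance of the cross-sectional variable to `Γ`. -/
def sqDist (Γ : Set (Eucl m)) (x : Eucl (m + 1)) : ℝ := Metric.infDist (tail x) Γ ^ 2

lemma sqDist_nonneg (Γ : Set (Eucl m)) (x : Eucl (m + 1)) : 0 ≤ sqDist Γ x := sq_nonneg _

lemma exists_sqDist_projection {Γ : Set (Eucl m)} (hc : IsClosed Γ) (hcv : Convex ℝ Γ)
    (hne : Γ.Nonempty) :
    ContDiff ℝ 1 (sqDist Γ) ∧ ∃ P : Eucl m → Eucl m, (∀ x, P x ∈ Γ) ∧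
      (∀ x, sqDist Γ x = ‖tail x - P (tail x)‖ ^ 2) ∧
      ∀ x v, fderiv ℝ (sqDist Γ) x v = 2 * inner ℝ (tail x - P (tail x)) (tail v) := by
  obtain ⟨P, hPc, hP, hn, hd⟩ := exists_metric_projection hc hcv hne
  have hd' : ∀ x, HasFDerivAt (sqDist Γ)
      (((2 : ℝ) • innerSL ℝ (tail x - P (tail x))).comp (tailL m)) x := fun x =>
    HasFDerivAt.comp x (hd (tail x)) (tailL m).hasFDerivAt
  refine ⟨?_, P, hP, fun x => by rw [sqDist, hn], fun x v => ?_⟩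
  · rw [contDiff_one_iff_fderiv]
    refine ⟨fun x => (hd' x).differentiableAt, ?_⟩
    have : fderiv ℝ (sqDist Γ) =
        fun x => ((2 : ℝ) • innerSL ℝ (tail x - P (tail x))).comp (tailL m) :=
      funext fun x => (hd' x).fderiv
    rw [this]
    have h1 : Continuous fun x : Eucl (m + 1) => tail x - P (tail x) :=
      continuous_tail.sub (hPc.comp continuous_tail)
    have h2 : Continuous fun x : Eucl (m + 1) => (2 : ℝ) • innerSL ℝ (tail x - P (tail x)) :=
      ((innerSL ℝ).continuous.comp h1).const_smul (2 : ℝ)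
    exact h2.clm_comp continuous_const
  · rw [(hd' x).fderiv]
    simp [inner_sub_left]

lemma sum_pd_sqDist_sq {Γ : Set (Eucl m)} (hc : IsClosed Γ) (hcv : Convex ℝ Γ)
    (hne : Γ.Nonempty) (x : Eucl (m + 1)) :
    ∑ i, pd i (sqDist Γ) x ^ 2 = 4 * sqDist Γ x := by
  obtain ⟨-, P, -, hn, hd⟩ := exists_sqDist_projection hc hcv hne
  simp only [pd, hd]
  rw [Fin.sum_univ_succ, hn x, EuclideanSpace.norm_sq_eq]
  simp [Finset.mul_sum, mul_pow, EuclideanSpace.inner_single_right]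
  norm_num

lemma pd_zero_sqDist {Γ : Set (Eucl m)} (hc : IsClosed Γ) (hcv : Convex ℝ Γ)
    (hne : Γ.Nonempty) (x : Eucl (m + 1)) : pd 0 (sqDist Γ) x = 0 := by
  obtain ⟨-, P, -, hn, hd⟩ := exists_sqDist_projection hc hcv hne
  simp [pd, hd]

variable {ω Γ₁ : Set (Eucl m)}

lemma IsAdmissible.contDiff_sqDist (h : IsAdmissible ω Γ₁) : ContDiff ℝ 1 (sqDist Γ₁) :=
  (exists_sqDist_projection h.isCompact.isClosed h.convex h.nonempty).1

lemma IsAdmissible.sqDist_pos (h : IsAdmissible ω Γ₁) {x : Eucl (m + 1)} (hx : tail x ∈ ω) :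
    0 < sqDist Γ₁ x := by
  have : 0 < Metric.infDist (tail x) Γ₁ :=
    (h.isCompact.isClosed.notMem_iff_infDist_pos h.nonempty).1 fun hm => h.notMem hm hx
  exact pow_pos this 2

/-- If the affine span of `Γ₁` is a hyperplane, then `ω` lies on one side of it. -/
lemma IsAdmissible.exists_half_space (h : IsAdmissible ω Γ₁)
    (hD : Module.finrank ℝ ((affineSpan ℝ Γ₁).direction)ᗮ = 1) :
    ∃ p ∈ Γ₁, ∃ e ∈ ((affineSpan ℝ Γ₁).direction)ᗮ, ‖e‖ = 1 ∧ ∀ x ∈ ω, 0 < inner ℝ e (x - p) := by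
  obtain ⟨p, hp, hmiss, θ, hθ, hθ0, hdir⟩ := h.exists_missing_direction
  set D := (affineSpan ℝ Γ₁).direction
  have hn : 0 < ‖θ‖ := norm_pos_iff.2 hθ0
  refine ⟨p, hp, (-‖θ‖⁻¹) • θ, Dᗮ.smul_mem _ hθ, ?_, fun x hx => ?_⟩
  · rw [norm_smul, norm_neg, norm_inv, norm_norm, inv_mul_cancel₀ hn.ne']
  · obtain ⟨c, hc⟩ : ∃ c : ℝ, c • θ = Dᗮ.starProjection (x - p) := by
      have h0 : (⟨θ, hθ⟩ : Dᗮ) ≠ 0 := fun h => hθ0 (congrArg Subtype.val h)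
      obtain ⟨c, hc⟩ := (finrank_eq_one_iff_of_nonzero' _ h0).1 hD
        ⟨_, Dᗮ.starProjection_apply_mem (x - p)⟩
      exact ⟨c, congrArg Subtype.val hc⟩
    have hmem : x - p - c • θ ∈ D := by
      have := Dᗮ.sub_starProjection_mem_orthogonal (x - p)
      rwa [Submodule.orthogonal_orthogonal, ← hc] at this
    -- The value 0 is excluded since ω misses the affine span of Γ₁, positive values since it misses
    -- the direction θ.
    have hc0 : c < 0 := by
      rcases lt_trichotomy c 0 with h | h | h
      · exact h
      · exact absurd (by simpa [h] using hmem) (hmiss x hx)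
      · exact absurd hmem (hdir x hx c h)
    have h1 : inner ℝ θ (x - p) = c * ‖θ‖ ^ 2 := by
      have h2 : inner ℝ θ (x - p - c • θ) = 0 :=
        Submodule.inner_left_of_mem_orthogonal hmem hθ
      rw [inner_sub_right, inner_smul_right, real_inner_self_eq_norm_sq] at h2
      linarith
    rw [inner_smul_left, h1]
    simp only [conj_trivial]
    have : -‖θ‖⁻¹ * (c * ‖θ‖ ^ 2) = -c * ‖θ‖ := by field_simp
    rw [this]
    nlinarith

/-- If the affine span of `Γ₁` has codimension two, then `ω` avoids a half hyperplane bounded by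
it. -/
lemma IsAdmissible.exists_slit (h : IsAdmissible ω Γ₁)
    (hD : Module.finrank ℝ ((affineSpan ℝ Γ₁).direction)ᗮ = 2) :
    ∃ p ∈ Γ₁, ∃ e : Fin 2 → Eucl m, Orthonormal ℝ e ∧
      (∀ i, e i ∈ ((affineSpan ℝ Γ₁).direction)ᗮ) ∧
      ∀ x ∈ ω, 0 < √(inner ℝ (e 0) (x - p) ^ 2 + inner ℝ (e 1) (x - p) ^ 2)
        + inner ℝ (e 0) (x - p) := by
  obtain ⟨p, hp, hmiss, θ, hθ, hθ0, hdir⟩ := h.exists_missing_direction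
  set D := (affineSpan ℝ Γ₁).direction
  have hn : 0 < ‖θ‖ := norm_pos_iff.2 hθ0
  -- With the missing direction as the negative first axis, the slit is the one of `hardy_slit`.
  set f : Dᗮ := ⟨(-‖θ‖⁻¹) • θ, Dᗮ.smul_mem _ hθ⟩ with hf
  have hfn : ‖f‖ = 1 := by
    rw [hf, Submodule.coe_norm, norm_smul, norm_neg, norm_inv, norm_norm, inv_mul_cancel₀ hn.ne']
  obtain ⟨b, hb⟩ := Orthonormal.exists_orthonormalBasis_extension_of_card_eq (𝕜 := ℝ) (ι := Fin 2)
    (by simpa using hD) (v := fun _ => f) (s := {0}) (by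
      constructor
      · intro i; simpa using hfn
      · intro i j hij; exact absurd (Subsingleton.elim i j) hij)
  have hb0 : b 0 = f := hb 0 rfl
  refine ⟨p, hp, fun i => (b i : Eucl m), ?_, fun i => (b i).2, fun x hx => ?_⟩
  · exact b.orthonormal.comp_linearIsometry Dᗮ.subtypeₗᵢ
  · set a₀ := inner ℝ (b 0 : Eucl m) (x - p)
    set a₁ := inner ℝ (b 1 : Eucl m) (x - p)
    have hproj : Dᗮ.starProjection (x - p) = a₀ • (b 0 : Eucl m) + a₁ • (b 1 : Eucl m) := by
      have := b.sum_repr' (Dᗮ.orthogonalProjectionOnto (x - p))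
      rw [Fin.sum_univ_two] at this
      have h2 := congrArg Subtype.val this
      simp only [Submodule.coe_add, Submodule.coe_smul,
        Submodule.inner_orthogonalProjectionOnto_eq_of_mem_left] at h2
      exact h2.symm
    have hmem : x - p - (a₀ • (b 0 : Eucl m) + a₁ • (b 1 : Eucl m)) ∈ D := by
      have := Dᗮ.sub_starProjection_mem_orthogonal (x - p)
      rwa [Submodule.orthogonal_orthogonal, hproj] at this
    by_contra! hle
    have h1 : |a₀| ≤ √(a₀ ^ 2 + a₁ ^ 2) := Real.abs_le_sqrt (by nlinarith [sq_nonneg a₁])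
    have h2 : a₀ ≤ 0 := by nlinarith [abs_nonneg a₀]
    have h3 : √(a₀ ^ 2 + a₁ ^ 2) ≤ -a₀ := by linarith
    have h4 : a₁ = 0 := by
      have := Real.sqrt_le_iff.1 h3
      nlinarith [this.2, sq_nonneg a₁]
    rw [h4, zero_smul, add_zero, hb0] at hmem
    rcases h2.lt_or_eq with h5 | h5
    · refine hdir x hx (-a₀ * ‖θ‖⁻¹) (mul_pos (by linarith) (by positivity)) ?_
      convert hmem using 2
      rw [hf, smul_smul]
      congr 1; ring
    · rw [h5, zero_smul, sub_zero] at hmem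
      exact hmiss x hx hmem

lemma finrank_orthogonal_direction_pos (h : IsAdmissible ω Γ₁) :
    0 < Module.finrank ℝ ((affineSpan ℝ Γ₁).direction)ᗮ := by
  obtain ⟨p, hp, hmiss, θ, hθ, hθ0, hdir⟩ := h.exists_missing_direction
  have : Nontrivial ((affineSpan ℝ Γ₁).direction)ᗮ :=
    ⟨⟨θ, hθ⟩, 0, fun h => hθ0 (congrArg Subtype.val h)⟩
  exact Module.finrank_pos

/-- A direction orthogonal to the affine span of Γ₁ does not see which point of Γ₁ is subtracted, so
the projection of `tail x` may be replaced by the fixed `p`. In these directions `sqDist` thus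
differentiates like a squared norm. -/
lemma IsAdmissible.fderiv_sqDist (h : IsAdmissible ω Γ₁) {p e : Eucl m} (hp : p ∈ Γ₁)
    (he : e ∈ ((affineSpan ℝ Γ₁).direction)ᗮ) (x : Eucl (m + 1)) :
    fderiv ℝ (sqDist Γ₁) x (embed e) = 2 * inner ℝ e (tail x - p) := by
  obtain ⟨-, P, hP, -, hd⟩ :=
    exists_sqDist_projection h.isCompact.isClosed h.convex h.nonempty
  have h1 : P (tail x) - p ∈ (affineSpan ℝ Γ₁).direction :=
    AffineSubspace.vsub_mem_direction (subset_affineSpan ℝ _ (hP _)) (subset_affineSpan ℝ _ hp)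
  have h2 : inner ℝ e (P (tail x) - p) = 0 := Submodule.inner_left_of_mem_orthogonal h1 he
  rw [hd, tail_embed, real_inner_comm,
    show tail x - P (tail x) = (tail x - p) - (P (tail x) - p) by abel, inner_sub_right, h2,
    sub_zero]

/-- Bessel's inequality, after replacing `p` by the projection of `tail x`, which does not change
the inner products. -/
lemma IsAdmissible.sum_inner_sq_le {ι : Type*} [Fintype ι] (h : IsAdmissible ω Γ₁) {p : Eucl m}
    {e : ι → Eucl m} (hp : p ∈ Γ₁) (ho : Orthonormal ℝ e)
    (he : ∀ i, e i ∈ ((affineSpan ℝ Γ₁).direction)ᗮ) (x : Eucl (m + 1)) :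
    ∑ i, inner ℝ (e i) (tail x - p) ^ 2 ≤ sqDist Γ₁ x := by
  obtain ⟨-, P, hP, hn, hd⟩ :=
    exists_sqDist_projection h.isCompact.isClosed h.convex h.nonempty
  have h1 : ∀ i, inner ℝ (e i) (tail x - p) = inner ℝ (e i) (tail x - P (tail x)) := by
    intro i
    have h2 := h.fderiv_sqDist hp (he i) x
    rw [hd, tail_embed, real_inner_comm] at h2
    linarith
  rw [hn x]
  simp only [h1]
  simpa using ho.sum_inner_products_le (x := tail x - P (tail x)) (s := Finset.univ)

lemma hasFDerivAt_inner_tail (e p : Eucl m) (x : Eucl (m + 1)) :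
    HasFDerivAt (fun x : Eucl (m + 1) => inner ℝ e (tail x - p))
      ((innerSL ℝ e).comp (tailL m)) x := by
  have := ((innerSL ℝ e).comp (tailL m)).hasFDerivAt (x := x)
  refine (this.sub_const (inner ℝ e p)).congr_of_eventuallyEq (Filter.Eventually.of_forall ?_)
  intro y
  simp [inner_sub_right]

lemma contDiff_inner_tail (e p : Eucl m) {n : ℕ∞} :
    ContDiff ℝ n (fun x : Eucl (m + 1) => inner ℝ e (tail x - p)) :=
  contDiff_const.inner ℝ ((tailL m).contDiff.sub contDiff_const)

lemma fderiv_inner_tail_embed (e e' p : Eucl m) (x : Eucl (m + 1)) :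
    fderiv ℝ (fun x : Eucl (m + 1) => inner ℝ e (tail x - p)) x (embed e') = inner ℝ e e' := by
  rw [(hasFDerivAt_inner_tail e p x).fderiv]
  simp

lemma sum_fderiv_embed_sq_le {ι : Type*} [Fintype ι] {e : ι → Eucl m} (ho : Orthonormal ℝ e)
    (g : Eucl (m + 1) → ℝ) (x : Eucl (m + 1)) :
    ∑ i, fderiv ℝ g x (embed (e i)) ^ 2 ≤ ∑ j : Fin m, pd j.succ g x ^ 2 := by
  simp only [fderiv_apply_embed]
  have := ho.sum_inner_products_le (x := (WithLp.toLp 2 fun i => pd i.succ g x : Eucl m))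
    (s := Finset.univ)
  rw [EuclideanSpace.norm_sq_eq] at this
  simpa using this

/-- Weighted Hardy inequality on the cylinder over an admissible cross section. -/
theorem IsAdmissible.hardy (h : IsAdmissible ω Γ₁) {a : ℝ} {K : Set (Eucl (m + 1))}
    (hK : IsCompact K) (hKΩ : K ⊆ cylinder a ω) {g : Eucl (m + 1) → ℝ}
    (hg : ContDiffOn ℝ 1 g (cylinder a ω)) (hg0 : ∀ x ∉ K, g x = 0) {α : ℝ} (hα : 0 ≤ α)
    (hα2 : α < 1 / 2) :
    ∫ x, sqDist Γ₁ x ^ (α - 1) * g x ^ 2 ≤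
      4 / (1 - 2 * α) ^ 2 * ∫ x, sqDist Γ₁ x ^ α * ∑ j : Fin m, pd j.succ g x ^ 2 := by
  have hΩ := isOpen_cylinder a h.domain.isOpen
  have hσ : ContDiffOn ℝ 1 (sqDist Γ₁) (cylinder a ω) := h.contDiff_sqDist.contDiffOn
  have hpos : ∀ x ∈ cylinder a ω, 0 < sqDist Γ₁ x := fun x hx => h.sqDist_pos hx.2
  have hz : ∀ x ∉ K, fderiv ℝ g x = 0 := fun x hx =>
    fderiv_eq_zero_of_eq_zero_off hK.isClosed hg0 hx
  have iR : Integrable (fun x => sqDist Γ₁ x ^ α * ∑ j : Fin m, pd j.succ g x ^ 2) :=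
    integrable_of_eq_zero_off hK hKΩ
      ((ContDiffOn.rpow_pos hσ hpos α).continuousOn.mul (continuousOn_finsetSum _ fun j _ =>
        (continuousOn_fderiv_apply hΩ hg _).pow 2)) fun x hx => by simp [pd, hz x hx]
  have iL : ∀ {ι : Type} [Fintype ι] (e : ι → Eucl m),
      Integrable (fun x => sqDist Γ₁ x ^ α * ∑ i, fderiv ℝ g x (embed (e i)) ^ 2) := fun e =>
    integrable_of_eq_zero_off hK hKΩ
      ((ContDiffOn.rpow_pos hσ hpos α).continuousOn.mul (continuousOn_finsetSum _ fun j _ =>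
        (continuousOn_fderiv_apply hΩ hg _).pow 2)) fun x hx => by simp [hz x hx]
  have mono : ∀ {ι : Type} [Fintype ι] {e : ι → Eucl m}, Orthonormal ℝ e →
      ∫ x, sqDist Γ₁ x ^ α * ∑ i, fderiv ℝ g x (embed (e i)) ^ 2 ≤
        ∫ x, sqDist Γ₁ x ^ α * ∑ j : Fin m, pd j.succ g x ^ 2 := fun ho =>
    integral_mono (iL _) iR fun x => mul_le_mul_of_nonneg_left (sum_fderiv_embed_sq_le ho g x)
      (Real.rpow_nonneg (sqDist_nonneg _ _) _)
  have nonneg : 0 ≤ ∫ x, sqDist Γ₁ x ^ α * ∑ j : Fin m, pd j.succ g x ^ 2 :=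
    integral_nonneg fun x => mul_nonneg (Real.rpow_nonneg (sqDist_nonneg _ _) _)
      (Finset.sum_nonneg fun _ _ => sq_nonneg _)
  have h4 : (4 : ℝ) ≤ 4 / (1 - 2 * α) ^ 2 := by
    have h1 : 0 < 1 - 2 * α := by linarith
    rw [le_div_iff₀ (by positivity)]
    nlinarith
  have hfin := finrank_orthogonal_direction_pos h
  -- The codimension of the affine span decides which Hardy inequality applies. The last two have
  -- the constant 4, which is at most 4 / (1 - 2α)² because 0 ≤ α < 1/2.
  obtain hD | hD | hD : Module.finrank ℝ ((affineSpan ℝ Γ₁).direction)ᗮ = 1 ∨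
    Module.finrank ℝ ((affineSpan ℝ Γ₁).direction)ᗮ = 2 ∨
    3 ≤ Module.finrank ℝ ((affineSpan ℝ Γ₁).direction)ᗮ := by omega
  · obtain ⟨p, hp, e, he, hen, hpe⟩ := h.exists_half_space hD
    have ho : Orthonormal ℝ (fun _ : Unit => e) :=
      ⟨fun _ => hen, fun i j hij => absurd (Subsingleton.elim i j) hij⟩
    have h1 := hardy_half_space volume hΩ hK hKΩ (y := fun x => inner ℝ e (tail x - p))
      (e := embed e) hσ (contDiff_inner_tail (n := 1) e p).contDiffOn hg hg0 hpos
      (fun x hx => hpe _ hx.2)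
      (fun x _ => by simpa using h.sum_inner_sq_le hp ho (fun _ => he) x)
      (fun x _ => h.fderiv_sqDist hp he x)
      (fun x _ => by rw [fderiv_inner_tail_embed, real_inner_self_eq_norm_sq, hen, one_pow])
      hα hα2
    refine h1.trans (mul_le_mul_of_nonneg_left ?_ (by positivity))
    simpa using mono ho
  · obtain ⟨p, hp, e, ho, he, hpe⟩ := h.exists_slit hD
    have hoo := orthonormal_iff_ite.1 ho
    have h1 := hardy_slit volume hΩ hK hKΩ (y₁ := fun x => inner ℝ (e 0) (tail x - p))
      (y₂ := fun x => inner ℝ (e 1) (tail x - p)) (e₁ := embed (e 0)) (e₂ := embed (e 1)) hσ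
      (contDiff_inner_tail (n := 1) _ p).contDiffOn (contDiff_inner_tail (n := 1) _ p).contDiffOn
      hg hg0 hpos (fun x hx => hpe _ hx.2)
      (fun x _ => by simpa [Fin.sum_univ_two] using h.sum_inner_sq_le hp ho he x)
      (fun x _ => h.fderiv_sqDist hp (he 0) x) (fun x _ => h.fderiv_sqDist hp (he 1) x)
      (fun x _ => by rw [fderiv_inner_tail_embed, hoo]; simp)
      (fun x _ => by rw [fderiv_inner_tail_embed, hoo]; simp)
      (fun x _ => by rw [fderiv_inner_tail_embed, hoo]; simp)
      (fun x _ => by rw [fderiv_inner_tail_embed, hoo]; simp) α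
    have h2 := mono ho
    simp only [Fin.sum_univ_two] at h2
    calc _ ≤ _ := h1
      _ ≤ 4 * _ := mul_le_mul_of_nonneg_left h2 (by norm_num)
      _ ≤ _ := mul_le_mul_of_nonneg_right h4 nonneg
  · set D := (affineSpan ℝ Γ₁).direction
    obtain ⟨p, hp⟩ := h.nonempty
    set b := stdOrthonormalBasis ℝ Dᗮ
    set e : Fin 3 → Eucl m := fun i => (b (Fin.castLE hD i) : Eucl m) with hedef
    have ho : Orthonormal ℝ e :=
      (b.orthonormal.comp_linearIsometry Dᗮ.subtypeₗᵢ).comp _ (Fin.castLE_injective hD)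
    have he : ∀ i, e i ∈ Dᗮ := fun i => (b _).2
    have h1 := hardy_three volume hΩ hK hKΩ (y := fun i x => inner ℝ (e i) (tail x - p))
      (e := fun i => embed (e i)) hσ
      (fun i => (contDiff_inner_tail (n := 1) _ p).contDiffOn)
      hg hg0 hpos (fun x _ => h.sum_inner_sq_le hp ho he x)
      (fun i x _ => h.fderiv_sqDist hp (he i) x)
      (fun i x _ => by
        rw [fderiv_inner_tail_embed, real_inner_self_eq_norm_sq, ho.1 i, one_pow]) hα
      (by linarith)
    calc _ ≤ _ := h1
      _ ≤ 4 * _ := mul_le_mul_of_nonneg_left (mono ho) (by norm_num)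
      _ ≤ _ := mul_le_mul_of_nonneg_right h4 nonneg

end Cylinder

/-! ### The operator depends only on the symmetric part of its matrix. -/

section Operator

variable {d : ℕ}

lemma pd_congr {f g : Eucl d → ℝ} {x : Eucl d} (h : f =ᶠ[nhds x] g) (i : Fin d) :
    pd i f x = pd i g x := by
  rw [pd, pd, h.fderiv_eq]

lemma ellipticOp_congr_of_eventuallyEq {A : Matrix (Fin d) (Fin d) ℝ} {f g : Eucl d → ℝ}
    {x : Eucl d} (h : f =ᶠ[nhds x] g) : ellipticOp A f x = ellipticOp A g x := by
  refine Finset.sum_congr rfl fun i _ => pd_congr ?_ i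
  filter_upwards [h.eventuallyEq_nhds] with y hy
  exact Finset.sum_congr rfl fun j _ => by rw [pd_congr hy]

lemma ContDiffOn.pd {f : Eucl d → ℝ} {Ω : Set (Eucl d)} (hΩ : IsOpen Ω)
    (hf : ContDiffOn ℝ 2 f Ω) (i : Fin d) : ContDiffOn ℝ 1 (pd i f) Ω :=
  (hf.fderiv_of_isOpen hΩ (m := 1) (by norm_num)).clm_apply contDiffOn_const

lemma pd_mul {f g : Eucl d → ℝ} {x : Eucl d} (hf : DifferentiableAt ℝ f x)
    (hg : DifferentiableAt ℝ g x) (i : Fin d) :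
    pd i (fun y => f y * g y) x = pd i f x * g x + f x * pd i g x := by
  simp only [pd, fderiv_fun_mul hf hg]
  simp
  ring

lemma pd_comp {f : Eucl d → ℝ} {x : Eucl d} {F : ℝ → ℝ} {F' : ℝ} (hF : HasDerivAt F F' (f x))
    (hf : DifferentiableAt ℝ f x) (i : Fin d) :
    pd i (fun y => F (f y)) x = F' * pd i f x := by
  have := (hF.comp_hasFDerivAt x hf.hasFDerivAt).fderiv
  simp only [pd]
  rw [show (fun y => F (f y)) = F ∘ f from rfl, this]
  simp

lemma pd_pd_comm {f : Eucl d → ℝ} {Ω : Set (Eucl d)} (hΩ : IsOpen Ω)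
    (hf : ContDiffOn ℝ 2 f Ω) {x : Eucl d} (hx : x ∈ Ω) (i j : Fin d) :
    pd i (pd j f) x = pd j (pd i f) x := by
  have hc := hf.contDiffAt (hΩ.mem_nhds hx)
  have hs := hc.isSymmSndFDerivAt (by simp)
  have hd : DifferentiableAt ℝ (fderiv ℝ f) x :=
    (hc.fderiv_right (m := 1) (by norm_num)).differentiableAt one_ne_zero
  have key : ∀ a b : Eucl d, fderiv ℝ (fun y => fderiv ℝ f y b) x a
      = fderiv ℝ (fderiv ℝ f) x a b := by
    intro a b
    rw [fderiv_clm_apply hd (differentiableAt_const b)]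
    simp
  change fderiv ℝ (fun y => fderiv ℝ f y _) x _ = fderiv ℝ (fun y => fderiv ℝ f y _) x _
  rw [key, key]
  exact hs.eq _ _

lemma pd_sum_mul {f : Fin d → Eucl d → ℝ} (c : Fin d → ℝ) {x : Eucl d}
    (hf : ∀ j, DifferentiableAt ℝ (f j) x) (i : Fin d) :
    pd i (fun y => ∑ j, c j * f j y) x = ∑ j, c j * pd i (f j) x := by
  simp only [pd]
  rw [fderiv_fun_sum fun j _ => (hf j).const_mul (c j)]
  simp only [sum_apply]
  refine Finset.sum_congr rfl fun j _ => ?_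
  rw [fderiv_const_mul (hf j)]
  simp

lemma ellipticOp_eq_sum {A : Matrix (Fin d) (Fin d) ℝ} {f : Eucl d → ℝ} {Ω : Set (Eucl d)}
    (hΩ : IsOpen Ω) (hf : ContDiffOn ℝ 2 f Ω) {x : Eucl d} (hx : x ∈ Ω) :
    ellipticOp A f x = ∑ i, ∑ j, A i j * pd i (pd j f) x :=
  Finset.sum_congr rfl fun i _ => pd_sum_mul (fun j => A i j) (fun j =>
    ((ContDiffOn.pd hΩ hf j).contDiffAt (hΩ.mem_nhds hx)).differentiableAt one_ne_zero) i

/-- Second derivatives of a C² function are symmetric, so a skew part cancels. This freedom allows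
one solution to be tested with both `symPart A` and `lowered A`. -/
lemma ellipticOp_eq_of_add_transpose {A B : Matrix (Fin d) (Fin d) ℝ}
    (hAB : A + A.transpose = B + B.transpose) {f : Eucl d → ℝ} {Ω : Set (Eucl d)}
    (hΩ : IsOpen Ω) (hf : ContDiffOn ℝ 2 f Ω) {x : Eucl d} (hx : x ∈ Ω) :
    ellipticOp A f x = ellipticOp B f x := by
  rw [ellipticOp_eq_sum hΩ hf hx, ellipticOp_eq_sum hΩ hf hx]
  have key : ∀ M : Matrix (Fin d) (Fin d) ℝ, 2 * ∑ i, ∑ j, M i j * pd i (pd j f) x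
      = ∑ i, ∑ j, (M + M.transpose) i j * pd i (pd j f) x := by
    intro M
    have h1 : ∑ i, ∑ j, M i j * pd i (pd j f) x = ∑ i, ∑ j, M j i * pd i (pd j f) x := by
      rw [Finset.sum_comm]
      refine Finset.sum_congr rfl fun i _ => Finset.sum_congr rfl fun j _ => ?_
      rw [pd_pd_comm hΩ hf hx]
    rw [two_mul]
    nth_rewrite 2 [h1]
    simp only [← Finset.sum_add_distrib, Matrix.add_apply, Matrix.transpose_apply, add_mul]
  have := (key A).trans (hAB ▸ (key B).symm)
  linarith

end Operator

/-! ### Testing the equation with a truncated solution. -/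

section Energy

variable {m : ℕ} {Ω : Set (Eucl (m + 1))}

/-- Only the product φ z is known to vanish off `K`. Near a point off `K` with φ ≠ 0 the factor `z`
vanishes identically, and so do its derivatives. -/
lemma mul_pd_eq_zero_off {K : Set (Eucl (m + 1))} (hK : IsClosed K) {φ : ℝ → ℝ}
    (hφ : Continuous φ) {z : Eucl (m + 1) → ℝ} (h0 : ∀ x ∉ K, φ (x 0) * z x = 0)
    {x : Eucl (m + 1)} (hx : x ∉ K) (i : Fin (m + 1)) : φ (x 0) * pd i z x = 0 := by
  by_cases hφx : φ (x 0) = 0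
  · simp [hφx]
  · have h1 : ∀ᶠ y in nhds x, φ (y 0) ≠ 0 :=
      (hφ.comp (by fun_prop : Continuous fun y : Eucl (m + 1) => y 0)).continuousAt.eventually_ne
        hφx
    have h2 : z =ᶠ[nhds x] fun _ => (0 : ℝ) := by
      filter_upwards [h1, hK.isOpen_compl.mem_nhds hx] with y hy hyK
      exact (mul_eq_zero.1 (h0 y hyK)).resolve_left hy
    rw [pd_congr h2]
    simp [pd]

lemma contDiff_comp_coord {φ : ℝ → ℝ} {n : WithTop ℕ∞} (hφ : ContDiff ℝ n φ) :
    ContDiff ℝ n fun x : Eucl (m + 1) => φ (x 0) :=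
  hφ.comp (by fun_prop)

lemma pd_comp_coord {φ : ℝ → ℝ} (hφ : ContDiff ℝ 1 φ) (x : Eucl (m + 1)) (i : Fin (m + 1)) :
    pd i (fun x : Eucl (m + 1) => φ (x 0)) x = if i = 0 then deriv φ (x 0) else 0 := by
  have h1 : HasFDerivAt (fun x : Eucl (m + 1) => x 0)
      (EuclideanSpace.proj (0 : Fin (m + 1)) : Eucl (m + 1) →L[ℝ] ℝ) x :=
    (EuclideanSpace.proj (0 : Fin (m + 1)) : Eucl (m + 1) →L[ℝ] ℝ).hasFDerivAt
  rw [pd_comp (hφ.differentiable one_ne_zero (x 0)).hasDerivAt h1.differentiableAt, pd, h1.fderiv]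
  split_ifs with h
  · subst h; simp
  · simp [Ne.symm h]

/-- The energy inequality obtained by testing the equation with `φ² W T(v) T'(v)`, where `T` is
the truncation. -/
lemma energy_inequality (hΩ : IsOpen Ω) {v W : Eucl (m + 1) → ℝ} (hv : ContDiffOn ℝ 2 v Ω)
    {B : Matrix (Fin (m + 1)) (Fin (m + 1)) ℝ} (heq : ∀ x ∈ Ω, ellipticOp B v x = 0)
    (hB : ∀ ξ : Fin (m + 1) → ℝ, 0 ≤ ∑ i, ξ i * ∑ j, B i j * ξ j)
    (hW : ContDiffOn ℝ 1 W Ω) (hW0 : ∀ x ∈ Ω, 0 ≤ W x) {φ : ℝ → ℝ} (hφ : ContDiff ℝ 1 φ)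
    {K : Set (Eucl (m + 1))} (hK : IsCompact K) (hKΩ : K ⊆ Ω) {s : ℝ}
    {z : Eucl (m + 1) → ℝ} (hz : z = fun x => trunc s (v x))
    (h0 : ∀ x ∉ K, φ (x 0) * z x = 0) :
    ∫ x, φ (x 0) ^ 2 * (W x * ∑ i, pd i z x * ∑ j, B i j * pd j z x) ≤
      - (∫ x, 2 * φ (x 0) * deriv φ (x 0) * (W x * (z x * ∑ j, B 0 j * pd j z x)))
      - ∫ x, φ (x 0) ^ 2 * z x * ∑ i, pd i W x * ∑ j, B i j * pd j z x := by
  have hzc : ContDiffOn ℝ 1 z Ω := by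
    rw [hz]
    exact ((contDiff_trunc s).comp_contDiffOn hv).of_le (by norm_num)
  have hφx : ContDiff ℝ 1 fun x : Eucl (m + 1) => φ (x 0) := contDiff_comp_coord hφ
  have hφ'x : Continuous fun x : Eucl (m + 1) => deriv φ (x 0) :=
    (hφ.continuous_deriv le_rfl).comp (by fun_prop)
  have hpz : ∀ i, ContinuousOn (pd i z) Ω := fun i => continuousOn_fderiv_apply hΩ hzc _
  have hpW : ∀ i, ContinuousOn (pd i W) Ω := fun i => continuousOn_fderiv_apply hΩ hW _
  have hBz : ∀ i, ContinuousOn (fun x => ∑ j, B i j * pd j z x) Ω := fun i =>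
    continuousOn_finsetSum _ fun j _ => continuousOn_const.mul (hpz j)
  have hp0 : ∀ x ∉ K, ∀ i, φ (x 0) * pd i z x = 0 := fun x hx i =>
    mul_pd_eq_zero_off hK.isClosed hφ.continuous h0 hx i
  have hdz : ∀ x ∈ Ω, ∀ i, pd i z x = truncDeriv s (v x) * pd i v x := by
    intro x hx i
    rw [hz]
    exact pd_comp (hasDerivAt_trunc s (v x))
      ((hv.contDiffAt (hΩ.mem_nhds hx)).differentiableAt two_ne_zero) i
  -- the test field
  set f : Fin (m + 1) → Eucl (m + 1) → ℝ := fun i x =>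
    φ (x 0) ^ 2 * (W x * (trunc s (v x) * truncDeriv s (v x))) * ∑ j, B i j * pd j v x with hf
  have hSc : ContDiff ℝ 1 fun r => trunc s r * truncDeriv s r :=
    ((contDiff_trunc s).of_le (by norm_num)).mul (contDiff_truncDeriv (n := 1) s)
  have hv1 : ContDiffOn ℝ 1 v Ω := hv.of_le (by norm_num)
  have hfc : ∀ i, ContDiffOn ℝ 1 (f i) Ω := fun i =>
    ((hφx.contDiffOn.pow 2).mul (hW.mul (hSc.comp_contDiffOn hv1))).mul
      (ContDiffOn.sum fun j _ => contDiffOn_const.mul (ContDiffOn.pd hΩ hv j))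
  have hf0 : ∀ i, ∀ x ∉ K, f i x = 0 := by
    intro i x hx
    have h1 := h0 x hx
    simp only [hz] at h1
    simp only [hf]
    rcases mul_eq_zero.1 h1 with h | h <;> simp [h]
  have i3 : ∀ i, Integrable fun x => pd i (f i) x := fun i =>
    integrable_fderiv_of_eq_zero_off (μ := volume) hΩ hK hKΩ (hfc i) (hf0 i)
      (EuclideanSpace.single i 1)
  have h3 : ∀ i, ∫ x, pd i (f i) x = 0 := fun i =>
    integral_fderiv_eq_zero_of_eq_zero_off (μ := volume) hΩ hK hKΩ (hfc i)
    (hf0 i) (EuclideanSpace.single i 1)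
  have i4 : Integrable (fun x => ∑ i, pd i (f i) x) := integrable_finsetSum _ fun i _ => i3 i
  have h4 : ∫ x, ∑ i, pd i (f i) x = 0 := by
    rw [integral_finsetSum _ fun i _ => i3 i]
    simp [h3]
  have j1 : Integrable (fun x => φ (x 0) ^ 2 * (W x * ∑ i, pd i z x * ∑ j, B i j * pd j z x)) := by
    refine integrable_of_eq_zero_off hK hKΩ ((hφx.continuous.pow 2).continuousOn.mul
      (hW.continuousOn.mul (continuousOn_finsetSum _ fun i _ => (hpz i).mul (hBz i)))) ?_
    intro x hx
    rcases eq_or_ne (φ (x 0)) 0 with h | h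
    · simp [h]
    · have : ∀ i, pd i z x = 0 := fun i => (mul_eq_zero.1 (hp0 x hx i)).resolve_left h
      simp [this]
  have j2 : Integrable (fun x => 2 * φ (x 0) * deriv φ (x 0) *
      (W x * (z x * ∑ j, B 0 j * pd j z x))) := by
    refine integrable_of_eq_zero_off hK hKΩ (((hφx.continuous.const_mul 2).mul
      hφ'x).continuousOn.mul (hW.continuousOn.mul (hzc.continuousOn.mul (hBz 0)))) ?_
    intro x hx
    rcases mul_eq_zero.1 (h0 x hx) with h | h <;> simp [h]
  have j3 : Integrable (fun x => φ (x 0) ^ 2 * z x * ∑ i, pd i W x * ∑ j, B i j * pd j z x) := by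
    refine integrable_of_eq_zero_off hK hKΩ (((hφx.continuous.pow 2).continuousOn.mul
      hzc.continuousOn).mul (continuousOn_finsetSum _ fun i _ => (hpW i).mul (hBz i))) ?_
    intro x hx
    rcases mul_eq_zero.1 (h0 x hx) with h | h <;> simp [h]
  have key : ∀ x, φ (x 0) ^ 2 * (W x * ∑ i, pd i z x * ∑ j, B i j * pd j z x) ≤
      ∑ i, pd i (f i) x
      - 2 * φ (x 0) * deriv φ (x 0) * (W x * (z x * ∑ j, B 0 j * pd j z x))
      - φ (x 0) ^ 2 * z x * ∑ i, pd i W x * ∑ j, B i j * pd j z x := by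
    intro x
    by_cases hx : x ∈ K
    swap
    · have hpf : ∀ i, pd i (f i) x = 0 := fun i => by
        simp [pd, fderiv_eq_zero_of_eq_zero_off hK.isClosed (hf0 i) hx]
      rcases eq_or_ne (φ (x 0)) 0 with h | h
      · simp [h, hpf]
      · have : ∀ i, pd i z x = 0 := fun i => (mul_eq_zero.1 (hp0 x hx i)).resolve_left h
        simp [this, hpf]
    replace hx := hKΩ hx
    have hnx := hΩ.mem_nhds hx
    have dv : DifferentiableAt ℝ v x := (hv1.contDiffAt hnx).differentiableAt one_ne_zero
    have dW : DifferentiableAt ℝ W x := (hW.contDiffAt hnx).differentiableAt one_ne_zero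
    have dφ : DifferentiableAt ℝ (fun x : Eucl (m + 1) => φ (x 0)) x :=
      hφx.differentiable one_ne_zero x
    have dpv : ∀ j, DifferentiableAt ℝ (pd j v) x := fun j =>
      ((ContDiffOn.pd hΩ hv j).contDiffAt hnx).differentiableAt one_ne_zero
    obtain ⟨S', hS', hSle⟩ := exists_hasDerivAt_trunc_mul_truncDeriv s (v x)
    have dS : DifferentiableAt ℝ (fun y => trunc s (v y) * truncDeriv s (v y)) x :=
      hS'.differentiableAt.comp x dv
    have dWS : DifferentiableAt ℝ (fun y => W y * (trunc s (v y) * truncDeriv s (v y))) x :=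
      dW.mul dS
    have dφ2 : DifferentiableAt ℝ (fun x : Eucl (m + 1) => φ (x 0) ^ 2) x := dφ.pow 2
    have dφWS : DifferentiableAt ℝ
        (fun y => φ (y 0) ^ 2 * (W y * (trunc s (v y) * truncDeriv s (v y)))) x := dφ2.mul dWS
    have dB : ∀ i, DifferentiableAt ℝ (fun y => ∑ j, B i j * pd j v y) x := fun i =>
      DifferentiableAt.fun_sum fun j _ => (dpv j).const_mul _
    have hfi : ∀ i, pd i (f i) x =
        ((2 * φ (x 0) * (if i = 0 then deriv φ (x 0) else 0)) *
            (W x * (trunc s (v x) * truncDeriv s (v x)))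
          + φ (x 0) ^ 2 * (pd i W x * (trunc s (v x) * truncDeriv s (v x))
            + W x * (S' * pd i v x))) * ∑ j, B i j * pd j v x
        + φ (x 0) ^ 2 * (W x * (trunc s (v x) * truncDeriv s (v x))) *
          pd i (fun y => ∑ j, B i j * pd j v y) x := by
      intro i
      have hφ2 : pd i (fun x : Eucl (m + 1) => φ (x 0) ^ 2) x
          = 2 * φ (x 0) * (if i = 0 then deriv φ (x 0) else 0) := by
        have : (fun x : Eucl (m + 1) => φ (x 0) ^ 2) = fun x => φ (x 0) * φ (x 0) := by
          ext; ring
        rw [this, pd_mul dφ dφ, pd_comp_coord hφ]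
        ring
      simp only [hf]
      rw [pd_mul dφWS (dB i), pd_mul dφ2 dWS, pd_mul dW dS, hφ2, pd_comp hS' dv]
    have hsum : ∑ i, pd i (f i) x =
        2 * φ (x 0) * deriv φ (x 0) * (W x * (trunc s (v x) * truncDeriv s (v x))) *
          (∑ j, B 0 j * pd j v x)
        + φ (x 0) ^ 2 * (trunc s (v x) * truncDeriv s (v x)) *
          (∑ i, pd i W x * ∑ j, B i j * pd j v x)
        + φ (x 0) ^ 2 * W x * S' * (∑ i, pd i v x * ∑ j, B i j * pd j v x) := by
      have he := heq x hx
      rw [ellipticOp] at he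
      simp only [hfi]
      rw [Finset.sum_add_distrib, ← Finset.mul_sum, he, mul_zero, add_zero]
      have : ∀ i, ((2 * φ (x 0) * (if i = 0 then deriv φ (x 0) else 0)) *
            (W x * (trunc s (v x) * truncDeriv s (v x)))
          + φ (x 0) ^ 2 * (pd i W x * (trunc s (v x) * truncDeriv s (v x))
            + W x * (S' * pd i v x))) * ∑ j, B i j * pd j v x
          = (if i = 0 then 2 * φ (x 0) * deriv φ (x 0) *
              (W x * (trunc s (v x) * truncDeriv s (v x))) * (∑ j, B i j * pd j v x) else 0)
            + φ (x 0) ^ 2 * (trunc s (v x) * truncDeriv s (v x)) *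
              (pd i W x * ∑ j, B i j * pd j v x)
            + φ (x 0) ^ 2 * W x * S' * (pd i v x * ∑ j, B i j * pd j v x) := by
        intro i
        split_ifs <;> ring
      simp only [this]
      rw [Finset.sum_add_distrib, Finset.sum_add_distrib, ← Finset.mul_sum, ← Finset.mul_sum,
        Finset.sum_ite_eq' Finset.univ]
      simp
    have hB' : ∀ i, ∑ j, B i j * pd j z x = truncDeriv s (v x) * ∑ j, B i j * pd j v x := by
      intro i
      rw [Finset.mul_sum]
      exact Finset.sum_congr rfl fun j _ => by rw [hdz x hx]; ring
    have hQ : ∑ i, pd i z x * ∑ j, B i j * pd j z x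
        = truncDeriv s (v x) ^ 2 * ∑ i, pd i v x * ∑ j, B i j * pd j v x := by
      rw [Finset.mul_sum]
      exact Finset.sum_congr rfl fun j _ => by rw [hdz x hx, hB']; ring
    have hR : ∑ i, pd i W x * ∑ j, B i j * pd j z x
        = truncDeriv s (v x) * ∑ i, pd i W x * ∑ j, B i j * pd j v x := by
      rw [Finset.mul_sum]
      exact Finset.sum_congr rfl fun j _ => by rw [hB']; ring
    rw [hsum, hQ, hR, hB']
    have hzx : z x = trunc s (v x) := by rw [hz]
    rw [hzx]
    have hq := hB fun i => pd i v x
    have hw := hW0 x hx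
    -- The only inequality in the computation is (T T')' ≥ T'², combined with the nonnegativity of
    -- the form of `B`; the other terms agree exactly, since T T' ∇v = z ∇z.
    have : 0 ≤ φ (x 0) ^ 2 * W x * (S' - truncDeriv s (v x) ^ 2) *
        (∑ i, pd i v x * ∑ j, B i j * pd j v x) := by
      have : 0 ≤ S' - truncDeriv s (v x) ^ 2 := by linarith
      positivity
    linarith
  have hintegral := integral_mono j1 ((i4.sub j2).sub j3) key
  have i5 : Integrable (fun x => ∑ i, pd i (f i) x
      - 2 * φ (x 0) * deriv φ (x 0) * (W x * (z x * ∑ j, B 0 j * pd j z x))) := i4.sub j2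
  simp only [Pi.sub_apply] at hintegral
  rw [integral_sub i5 j3, integral_sub i4 j2, h4] at hintegral
  linarith

end Energy

/-! ### Choice of the matrix representing the operator. -/

section Matrices

variable {m d : ℕ}

/-- The symmetric part of a matrix. -/
def symPart (A : Matrix (Fin d) (Fin d) ℝ) : Matrix (Fin d) (Fin d) ℝ :=
  fun i j => (A i j + A j i) / 2

/-- The matrix with the same symmetric part as `A` whose first row vanishes off the diagonal. -/
def lowered (A : Matrix (Fin (m + 1)) (Fin (m + 1)) ℝ) :
    Matrix (Fin (m + 1)) (Fin (m + 1)) ℝ := fun i j =>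
  symPart A i j + (if j = 0 then if i = 0 then 0 else symPart A i j else 0)
    - (if i = 0 then if j = 0 then 0 else symPart A i j else 0)

lemma symPart_comm (A : Matrix (Fin d) (Fin d) ℝ) (i j : Fin d) :
    symPart A i j = symPart A j i := by
  simp only [symPart]; ring

lemma symPart_add_transpose (A : Matrix (Fin d) (Fin d) ℝ) :
    symPart A + (symPart A).transpose = A + A.transpose := by
  ext i j
  simp only [Matrix.add_apply, Matrix.transpose_apply, symPart]; ring

lemma lowered_add_transpose (A : Matrix (Fin (m + 1)) (Fin (m + 1)) ℝ) :
    lowered A + (lowered A).transpose = A + A.transpose := by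
  rw [← symPart_add_transpose A]
  ext i j
  simp only [Matrix.add_apply, Matrix.transpose_apply, lowered, symPart_comm A j i]
  ring

/-- The purpose of `lowered`: the flux in direction x₁ contains no cross-sectional derivatives. -/
lemma sum_lowered_zero (A : Matrix (Fin (m + 1)) (Fin (m + 1)) ℝ) (η : Fin (m + 1) → ℝ) :
    ∑ j, lowered A 0 j * η j = A 0 0 * η 0 := by
  rw [Finset.sum_eq_single 0]
  · simp [lowered, symPart]
  · intro j _ hj
    simp [lowered, hj]
  · simp

/-- The price for the vanishing first row is a doubled first column below the diagonal. Paired with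
the gradient of a weight independent of x₁, it adds a term containing only the x₁-derivative. -/
lemma sum_lowered (A : Matrix (Fin (m + 1)) (Fin (m + 1)) ℝ) {ξ : Fin (m + 1) → ℝ}
    (hξ : ξ 0 = 0) (η : Fin (m + 1) → ℝ) :
    ∑ i, ξ i * ∑ j, lowered A i j * η j =
      ∑ i, ξ i * ∑ j, symPart A i j * η j
      + ∑ i, ξ i * ∑ j, symPart A i j * (if j = 0 then η 0 else 0) := by
  rw [← Finset.sum_add_distrib]
  refine Finset.sum_congr rfl fun i _ => ?_
  rw [← mul_add, ← Finset.sum_add_distrib]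
  by_cases hi : i = 0
  · simp [hi, hξ]
  · congr 1
    refine Finset.sum_congr rfl fun j _ => ?_
    by_cases hj : j = 0
    · subst hj; simp [lowered, hi]; ring
    · simp [lowered, hi, hj]

lemma quadratic_eq_of_add_transpose {A B : Matrix (Fin d) (Fin d) ℝ}
    (hAB : A + A.transpose = B + B.transpose) (ξ : Fin d → ℝ) :
    ∑ i, ξ i * ∑ j, A i j * ξ j = ∑ i, ξ i * ∑ j, B i j * ξ j := by
  have key : ∀ M : Matrix (Fin d) (Fin d) ℝ, 2 * ∑ i, ξ i * ∑ j, M i j * ξ j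
      = ∑ i, ∑ j, (M + M.transpose) i j * (ξ i * ξ j) := by
    intro M
    have h0 : ∑ i, ξ i * ∑ j, M i j * ξ j = ∑ i, ∑ j, M i j * (ξ i * ξ j) := by
      refine Finset.sum_congr rfl fun i _ => ?_
      rw [Finset.mul_sum]
      exact Finset.sum_congr rfl fun j _ => by ring
    have h1 : ∑ i, ∑ j, M i j * (ξ i * ξ j) = ∑ i, ∑ j, M j i * (ξ i * ξ j) := by
      rw [Finset.sum_comm]
      exact Finset.sum_congr rfl fun i _ => Finset.sum_congr rfl fun j _ => by ring
    rw [h0, two_mul]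
    nth_rewrite 2 [h1]
    simp only [← Finset.sum_add_distrib, Matrix.add_apply, Matrix.transpose_apply, add_mul]
  have := (key A).trans (hAB ▸ (key B).symm)
  linarith

lemma EllipticBounds.quadratic {A : Matrix (Fin d) (Fin d) ℝ} {l L : ℝ}
    (h : EllipticBounds A l L) (ξ : Fin d → ℝ) :
    l * ∑ i, ξ i ^ 2 ≤ ∑ i, ξ i * ∑ j, A i j * ξ j ∧
      ∑ i, ξ i * ∑ j, A i j * ξ j ≤ L * ∑ i, ξ i ^ 2 := by
  have h1 := h (WithLp.toLp 2 ξ)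
  rw [EuclideanSpace.norm_sq_eq] at h1
  have e : ∀ i, ξ i * ∑ j, A i j * ξ j = ∑ j, ξ i * A i j * ξ j := fun i => by
    rw [Finset.mul_sum]
    exact Finset.sum_congr rfl fun j _ => by ring
  simp only [e]
  simpa using h1

/-- Cauchy-Schwarz inequality for the symmetric part, in the form of Young's inequality. -/
lemma EllipticBounds.young {A : Matrix (Fin d) (Fin d) ℝ} {l L : ℝ}
    (h : EllipticBounds A l L) (hl : 0 ≤ l) (ξ η : Fin d → ℝ) {μ : ℝ} (hμ : 0 < μ) :
    |∑ i, ξ i * ∑ j, symPart A i j * η j| ≤ L / 2 * (μ * ∑ i, ξ i ^ 2 + (∑ i, η i ^ 2) / μ) := by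
  set M := symPart A with hM
  have hq : ∀ ζ : Fin d → ℝ, ∑ i, ζ i * ∑ j, M i j * ζ j = ∑ i, ζ i * ∑ j, A i j * ζ j :=
    quadratic_eq_of_add_transpose (symPart_add_transpose A)
  have hsymm : ∑ i, η i * ∑ j, M i j * ξ j = ∑ i, ξ i * ∑ j, M i j * η j := by
    simp only [Finset.mul_sum]
    rw [Finset.sum_comm]
    refine Finset.sum_congr rfl fun i _ => Finset.sum_congr rfl fun j _ => ?_
    rw [hM, symPart_comm]; ring
  have hexp : ∀ c : ℝ, ∑ i, (μ * ξ i + c * η i) * ∑ j, M i j * (μ * ξ j + c * η j)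
      = μ ^ 2 * ∑ i, ξ i * ∑ j, M i j * ξ j + 2 * (μ * c) * ∑ i, ξ i * ∑ j, M i j * η j
        + c ^ 2 * ∑ i, η i * ∑ j, M i j * η j := by
    intro c
    have e1 : ∀ i, ∑ j, M i j * (μ * ξ j + c * η j)
        = μ * ∑ j, M i j * ξ j + c * ∑ j, M i j * η j := fun i => by
      rw [Finset.mul_sum, Finset.mul_sum, ← Finset.sum_add_distrib]
      exact Finset.sum_congr rfl fun j _ => by ring
    have e2 : ∀ i, (μ * ξ i + c * η i) * (μ * ∑ j, M i j * ξ j + c * ∑ j, M i j * η j)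
        = μ ^ 2 * (ξ i * ∑ j, M i j * ξ j) + (μ * c) * (ξ i * ∑ j, M i j * η j)
          + (μ * c) * (η i * ∑ j, M i j * ξ j) + c ^ 2 * (η i * ∑ j, M i j * η j) := fun i => by
      ring
    simp only [e1, e2, Finset.sum_add_distrib, ← Finset.mul_sum]
    rw [hsymm]; ring
  have hnn : ∀ ζ : Fin d → ℝ, 0 ≤ ∑ i, ζ i * ∑ j, M i j * ζ j := fun ζ => by
    rw [hq]
    exact le_trans (mul_nonneg hl (Finset.sum_nonneg fun _ _ => sq_nonneg _)) (h.quadratic ζ).1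
  -- Nonnegativity of the quadratic form at μξ + η and at μξ - η bounds the mixed term from both
  -- sides.
  have h1 := hnn fun i => μ * ξ i + 1 * η i
  have h2 := hnn fun i => μ * ξ i + (-1) * η i
  rw [hexp] at h1 h2
  have u1 := (hq ξ).le.trans (h.quadratic ξ).2
  have u2 := (hq η).le.trans (h.quadratic η).2
  set b := ∑ i, ξ i * ∑ j, M i j * η j
  have hb : μ * |b| ≤ μ * (L / 2 * (μ * ∑ i, ξ i ^ 2 + (∑ i, η i ^ 2) / μ)) := by
    have e : μ * (L / 2 * (μ * ∑ i, ξ i ^ 2 + (∑ i, η i ^ 2) / μ))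
        = (μ ^ 2 * (L * ∑ i, ξ i ^ 2) + L * ∑ i, η i ^ 2) / 2 := by field_simp
    rw [e]
    have u3 := mul_le_mul_of_nonneg_left u1 (sq_nonneg μ)
    rcases abs_cases b with ⟨hb, -⟩ | ⟨hb, -⟩ <;> rw [hb] <;> linarith
  exact le_of_mul_le_mul_left hb hμ

end Matrices

/-! ### Control of the first order term by Young and Hardy. -/

section WeightBounds

variable {m : ℕ}

/-- The weight `W` satisfies a one-sided bound for the first order term which it produces in the
energy inequality for the matrix `B`. -/
def WeightBound (Ω : Set (Eucl (m + 1))) (W : Eucl (m + 1) → ℝ)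
    (B : Matrix (Fin (m + 1)) (Fin (m + 1)) ℝ) (θ κ : ℝ) : Prop :=
  ∀ (K : Set (Eucl (m + 1))) (φ : ℝ → ℝ) (z : Eucl (m + 1) → ℝ), IsCompact K → K ⊆ Ω →
    ContDiff ℝ 1 φ → ContDiffOn ℝ 1 z Ω → (∀ x ∉ K, φ (x 0) * z x = 0) →
    - ∫ x, φ (x 0) ^ 2 * z x * ∑ i, pd i W x * ∑ j, B i j * pd j z x ≤
      θ * (∫ x, φ (x 0) ^ 2 * (W x * ∑ i, pd i z x ^ 2))
        + κ * ∫ x, φ (x 0) ^ 2 * (W x * pd 0 z x ^ 2)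

section Integrability

variable {Ω K : Set (Eucl (m + 1))} {W z : Eucl (m + 1) → ℝ} {φ : ℝ → ℝ}

lemma integrable_energy (hΩ : IsOpen Ω) (hK : IsCompact K) (hKΩ : K ⊆ Ω)
    (hφ : ContDiff ℝ 1 φ) (hz : ContDiffOn ℝ 1 z Ω) (hW : ContinuousOn W Ω)
    (h0 : ∀ x ∉ K, φ (x 0) * z x = 0) :
    Integrable fun x => φ (x 0) ^ 2 * (W x * ∑ i, pd i z x ^ 2) := by
  have hp0 : ∀ x ∉ K, ∀ i, φ (x 0) * pd i z x = 0 := fun x hx i =>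
    mul_pd_eq_zero_off hK.isClosed hφ.continuous h0 hx i
  refine integrable_of_eq_zero_off hK hKΩ
    (((contDiff_comp_coord hφ).continuous.pow 2).continuousOn.mul
      (hW.mul (continuousOn_finsetSum _ fun i _ => (continuousOn_fderiv_apply hΩ hz _).pow 2))) ?_
  intro x hx
  rcases eq_or_ne (φ (x 0)) 0 with h | h
  · simp [h]
  · have : ∀ i, pd i z x = 0 := fun i => (mul_eq_zero.1 (hp0 x hx i)).resolve_left h
    simp [this]

lemma integrable_energy_zero (hΩ : IsOpen Ω) (hK : IsCompact K) (hKΩ : K ⊆ Ω)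
    (hφ : ContDiff ℝ 1 φ) (hz : ContDiffOn ℝ 1 z Ω) (hW : ContinuousOn W Ω)
    (h0 : ∀ x ∉ K, φ (x 0) * z x = 0) :
    Integrable fun x => φ (x 0) ^ 2 * (W x * pd 0 z x ^ 2) := by
  refine integrable_of_eq_zero_off hK hKΩ
    (((contDiff_comp_coord hφ).continuous.pow 2).continuousOn.mul
      (hW.mul ((continuousOn_fderiv_apply hΩ hz _).pow 2))) ?_
  intro x hx
  rcases mul_eq_zero.1 (mul_pd_eq_zero_off hK.isClosed hφ.continuous h0 hx 0) with h | h <;>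
    simp [h]

lemma integrable_first_order (hΩ : IsOpen Ω) (hK : IsCompact K) (hKΩ : K ⊆ Ω)
    (hφ : ContDiff ℝ 1 φ) (hz : ContDiffOn ℝ 1 z Ω) (hW : ContDiffOn ℝ 1 W Ω)
    (h0 : ∀ x ∉ K, φ (x 0) * z x = 0) (B : Matrix (Fin (m + 1)) (Fin (m + 1)) ℝ) :
    Integrable fun x => φ (x 0) ^ 2 * z x * ∑ i, pd i W x * ∑ j, B i j * pd j z x := by
  refine integrable_of_eq_zero_off hK hKΩ
    ((((contDiff_comp_coord hφ).continuous.pow 2).continuousOn.mul hz.continuousOn).mul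
      (continuousOn_finsetSum _ fun i _ => (continuousOn_fderiv_apply hΩ hW _).mul
        (continuousOn_finsetSum _ fun j _ =>
          continuousOn_const.mul (continuousOn_fderiv_apply hΩ hz _)))) ?_
  intro x hx
  rcases mul_eq_zero.1 (h0 x hx) with h | h <;> simp [h]

end Integrability

variable {ω Γ₁ : Set (Eucl m)}

lemma IsAdmissible.contDiffOn_weight (h : IsAdmissible ω Γ₁) (a α : ℝ) :
    ContDiffOn ℝ 1 (fun x => sqDist Γ₁ x ^ α) (cylinder a ω) :=
  ContDiffOn.rpow_pos h.contDiff_sqDist.contDiffOn (fun _ hx => h.sqDist_pos hx.2) α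

lemma IsAdmissible.pd_weight (h : IsAdmissible ω Γ₁) {x : Eucl (m + 1)} (hx : tail x ∈ ω) (α : ℝ)
    (i : Fin (m + 1)) :
    pd i (fun x => sqDist Γ₁ x ^ α) x = α * sqDist Γ₁ x ^ (α - 1) * pd i (sqDist Γ₁) x :=
  pd_comp (F := fun r => r ^ α) (Real.hasDerivAt_rpow_const (Or.inl (h.sqDist_pos hx).ne'))
    (h.contDiff_sqDist.differentiable one_ne_zero x) i

lemma IsAdmissible.pd_zero_weight (h : IsAdmissible ω Γ₁) {x : Eucl (m + 1)} (hx : tail x ∈ ω)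
    (α : ℝ) : pd 0 (fun x => sqDist Γ₁ x ^ α) x = 0 := by
  rw [h.pd_weight hx, pd_zero_sqDist h.isCompact.isClosed h.convex h.nonempty, mul_zero]

lemma IsAdmissible.sum_pd_weight_sq (h : IsAdmissible ω Γ₁) {x : Eucl (m + 1)} (hx : tail x ∈ ω)
    (α : ℝ) : ∑ i, pd i (fun x => sqDist Γ₁ x ^ α) x ^ 2
      = 4 * α ^ 2 * sqDist Γ₁ x ^ (α - 1) * sqDist Γ₁ x ^ α := by
  simp only [h.pd_weight hx, mul_pow, ← Finset.mul_sum]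
  rw [sum_pd_sqDist_sq h.isCompact.isClosed h.convex h.nonempty]
  have hs := h.sqDist_pos hx
  have e : sqDist Γ₁ x ^ α = sqDist Γ₁ x ^ (α - 1) * sqDist Γ₁ x := by
    rw [Real.rpow_sub_one hs.ne']; field_simp
  rw [e]; ring

/-- The two terms on the right are matched to the two sides of Hardy's inequality, since |∇(σ^α)|² =
4 α² σ^(α-1) σ^α. -/
lemma IsAdmissible.young_weight (h : IsAdmissible ω Γ₁)
    {A : Matrix (Fin (m + 1)) (Fin (m + 1)) ℝ} {l L : ℝ} (hA : EllipticBounds A l L) (hl : 0 ≤ l)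
    (hL : 0 ≤ L) {x : Eucl (m + 1)} (hx : tail x ∈ ω) {α β μ : ℝ} (hα : 0 ≤ α) (hαβ : α ≤ β)
    (hμ : 0 < μ) (r : ℝ) (η : Fin (m + 1) → ℝ) :
    |r * ∑ i, pd i (fun x => sqDist Γ₁ x ^ α) x * ∑ j, symPart A i j * η j| ≤
      2 * L * β ^ 2 * μ * (sqDist Γ₁ x ^ (α - 1) * r ^ 2)
        + L / (2 * μ) * (sqDist Γ₁ x ^ α * ∑ i, η i ^ 2) := by
  have hs := h.sqDist_pos hx
  have hw : 0 < sqDist Γ₁ x ^ α := Real.rpow_pos_of_pos hs _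
  have hw' : 0 < sqDist Γ₁ x ^ (α - 1) := Real.rpow_pos_of_pos hs _
  -- The parameter μ / σ^α turns r² |∇(σ^α)|² into 4 α² μ σ^(α-1) r² and puts the weight σ^α on η.
  have h1 := hA.young hl (fun i => r * pd i (fun x => sqDist Γ₁ x ^ α) x) η
    (div_pos hμ hw)
  simp only [mul_pow, ← Finset.mul_sum, mul_assoc r] at h1
  rw [h.sum_pd_weight_sq hx] at h1
  have hβ2 : α ^ 2 ≤ β ^ 2 := pow_le_pow_left₀ hα hαβ 2
  calc _ ≤ _ := h1
    _ = 2 * L * α ^ 2 * μ * (sqDist Γ₁ x ^ (α - 1) * r ^ 2)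
        + L / (2 * μ) * (sqDist Γ₁ x ^ α * ∑ i, η i ^ 2) := by
      field_simp
      ring
    _ ≤ _ := by gcongr

/-- Hardy's inequality in the form in which it is used for the weighted energy. -/
lemma IsAdmissible.hardy_energy (h : IsAdmissible ω Γ₁) {a : ℝ} {K : Set (Eucl (m + 1))}
    (hK : IsCompact K) (hKΩ : K ⊆ cylinder a ω) {φ : ℝ → ℝ} {z : Eucl (m + 1) → ℝ}
    (hφ : ContDiff ℝ 1 φ) (hz : ContDiffOn ℝ 1 z (cylinder a ω))
    (h0 : ∀ x ∉ K, φ (x 0) * z x = 0) {α β : ℝ} (hα : 0 ≤ α) (hαβ : α ≤ β) (hβ : β < 1 / 2) :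
    Integrable (fun x => φ (x 0) ^ 2 * (sqDist Γ₁ x ^ (α - 1) * z x ^ 2)) ∧
    ∫ x, φ (x 0) ^ 2 * (sqDist Γ₁ x ^ (α - 1) * z x ^ 2) ≤
      4 / (1 - 2 * β) ^ 2 * ∫ x, φ (x 0) ^ 2 * (sqDist Γ₁ x ^ α * ∑ i, pd i z x ^ 2) := by
  have hΩ := isOpen_cylinder a h.domain.isOpen
  have hφx : ContDiff ℝ 1 fun x : Eucl (m + 1) => φ (x 0) := contDiff_comp_coord hφ
  have hg : ContDiffOn ℝ 1 (fun x => φ (x 0) * z x) (cylinder a ω) := hφx.contDiffOn.mul hz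
  have hH := h.hardy hK hKΩ hg h0 hα (by linarith : α < 1 / 2)
  have e1 : ∀ x, φ (x 0) ^ 2 * (sqDist Γ₁ x ^ (α - 1) * z x ^ 2)
      = sqDist Γ₁ x ^ (α - 1) * (φ (x 0) * z x) ^ 2 := fun x => by ring
  have hw0 : ∀ x, 0 ≤ sqDist Γ₁ x ^ α := fun x => Real.rpow_nonneg (sqDist_nonneg _ _) _
  have hz0 : ∀ x ∉ K, fderiv ℝ (fun x => φ (x 0) * z x) x = 0 := fun x hx =>
    fderiv_eq_zero_of_eq_zero_off hK.isClosed h0 hx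
  constructor
  · simp only [e1]
    exact integrable_of_eq_zero_off hK hKΩ
      ((h.contDiffOn_weight a _).continuousOn.mul (hg.continuousOn.pow 2)) fun x hx => by
        simp [h0 x hx]
  simp only [e1]
  have iE := integrable_energy hΩ hK hKΩ hφ hz (h.contDiffOn_weight a α).continuousOn h0
  have hle : ∫ x, sqDist Γ₁ x ^ α * ∑ j : Fin m, pd j.succ (fun x => φ (x 0) * z x) x ^ 2 ≤
      ∫ x, φ (x 0) ^ 2 * (sqDist Γ₁ x ^ α * ∑ i, pd i z x ^ 2) := by
    refine integral_mono ?_ iE fun x => ?_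
    · exact integrable_of_eq_zero_off hK hKΩ ((h.contDiffOn_weight a α).continuousOn.mul
        (continuousOn_finsetSum _ fun j _ => (continuousOn_fderiv_apply hΩ hg _).pow 2))
        fun x hx => by simp [pd, hz0 x hx]
    · by_cases hx : x ∈ K
      · have dz : DifferentiableAt ℝ z x :=
          (hz.contDiffAt (hΩ.mem_nhds (hKΩ hx))).differentiableAt one_ne_zero
        -- Hardy's inequality contains only cross-sectional derivatives, so the cutoff in x₁ passes
        -- through them and no derivative of φ appears.
        have e2 : ∀ j : Fin m, pd j.succ (fun x => φ (x 0) * z x) x ^ 2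
            = φ (x 0) ^ 2 * pd j.succ z x ^ 2 := fun j => by
          rw [pd_mul (hφx.differentiable one_ne_zero x) dz, pd_comp_coord hφ,
            if_neg (Fin.succ_ne_zero j)]
          ring
        simp only [e2, ← Finset.mul_sum]
        rw [Fin.sum_univ_succ]
        have : 0 ≤ φ (x 0) ^ 2 * (sqDist Γ₁ x ^ α * pd 0 z x ^ 2) := by
          have := hw0 x
          positivity
        linarith
      · simp only [pd, hz0 x hx]
        have : 0 ≤ ∑ i, pd i z x ^ 2 := Finset.sum_nonneg fun _ _ => sq_nonneg _
        have h2 := hw0 x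
        simp only [zero_apply, ne_eq, OfNat.ofNat_ne_zero, not_false_eq_true,
          zero_pow, Finset.sum_const_zero, mul_zero]
        exact mul_nonneg (sq_nonneg _) (mul_nonneg h2 this)
  have nonneg : 0 ≤ ∫ x, φ (x 0) ^ 2 * (sqDist Γ₁ x ^ α * ∑ i, pd i z x ^ 2) :=
    integral_nonneg fun x => mul_nonneg (sq_nonneg _) (mul_nonneg (hw0 x)
      (Finset.sum_nonneg fun _ _ => sq_nonneg _))
  have hc : 4 / (1 - 2 * α) ^ 2 ≤ 4 / (1 - 2 * β) ^ 2 := by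
    have : 0 < 1 - 2 * β := by linarith
    gcongr
  calc _ ≤ _ := hH
    _ ≤ 4 / (1 - 2 * α) ^ 2 * ∫ x, φ (x 0) ^ 2 * (sqDist Γ₁ x ^ α * ∑ i, pd i z x ^ 2) := by
      gcongr
    _ ≤ _ := by gcongr

/-- Young's inequality leaves σ^(α-1) z², which Hardy's inequality returns to the energy.
Monotonicity in α ≤ β makes the bound uniform. -/
lemma IsAdmissible.weightBound_symPart (h : IsAdmissible ω Γ₁)
    {A : Matrix (Fin (m + 1)) (Fin (m + 1)) ℝ} {l L : ℝ} (hA : EllipticBounds A l L) (hl : 0 ≤ l)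
    (hL : 0 ≤ L) {α β μ : ℝ} (hα : 0 ≤ α) (hαβ : α ≤ β) (hβ : β < 1 / 2) (hμ : 0 < μ) (a : ℝ) :
    WeightBound (cylinder a ω) (fun x => sqDist Γ₁ x ^ α) (symPart A)
      (2 * L * β ^ 2 * μ * (4 / (1 - 2 * β) ^ 2) + L / (2 * μ)) 0 := by
  intro K φ z hK hKΩ hφ hz h0
  have hΩ := isOpen_cylinder a h.domain.isOpen
  obtain ⟨iH, hH⟩ := h.hardy_energy hK hKΩ hφ hz h0 hα hαβ hβ
  have iE := integrable_energy hΩ hK hKΩ hφ hz (h.contDiffOn_weight a α).continuousOn h0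
  have iF := integrable_first_order hΩ hK hKΩ hφ hz (h.contDiffOn_weight a α) h0 (symPart A)
  rw [zero_mul, add_zero, ← integral_neg]
  have hmono := integral_mono iF.neg ((iH.const_mul (2 * L * β ^ 2 * μ)).add
    (iE.const_mul (L / (2 * μ)))) fun x => by
    simp only [Pi.neg_apply, Pi.add_apply]
    by_cases hx : x ∈ K
    · have hy := h.young_weight hA hl hL (hKΩ hx).2 hα hαβ hμ (z x) fun j => pd j z x
      have hy' := mul_le_mul_of_nonneg_left ((neg_le_abs _).trans hy) (sq_nonneg (φ (x 0)))
      calc _ = _ := by ring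
        _ ≤ _ := hy'
        _ = _ := by ring
    · have hw : 0 ≤ sqDist Γ₁ x ^ α := Real.rpow_nonneg (sqDist_nonneg _ _) _
      have hw' : 0 ≤ sqDist Γ₁ x ^ (α - 1) := Real.rpow_nonneg (sqDist_nonneg _ _) _
      have hs : 0 ≤ ∑ i, pd i z x ^ 2 := Finset.sum_nonneg fun _ _ => sq_nonneg _
      have e : φ (x 0) ^ 2 * z x * ∑ i, pd i (fun x => sqDist Γ₁ x ^ α) x *
          ∑ j, symPart A i j * pd j z x = 0 := by
        rw [show φ (x 0) ^ 2 * z x = φ (x 0) * (φ (x 0) * z x) by ring, h0 x hx]; simp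
      rw [e, neg_zero]
      positivity
  refine hmono.trans ?_
  simp only [Pi.add_apply]
  rw [integral_add (iH.const_mul _) (iE.const_mul _),
    integral_const_mul, integral_const_mul,
    add_mul, mul_assoc (2 * L * β ^ 2 * μ)]
  gcongr

/-- The extra column is estimated with a second parameter ν. A small ν keeps the additional multiple
of the energy small, at the cost of a large multiple of the x₁-derivative alone, which is admissible
on the right of the final estimate. -/
lemma IsAdmissible.weightBound_lowered (h : IsAdmissible ω Γ₁)
    {A : Matrix (Fin (m + 1)) (Fin (m + 1)) ℝ} {l L : ℝ} (hA : EllipticBounds A l L) (hl : 0 ≤ l)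
    (hL : 0 ≤ L) {α β μ ν : ℝ} (hα : 0 ≤ α) (hαβ : α ≤ β) (hβ : β < 1 / 2) (hμ : 0 < μ)
    (hν : 0 < ν) (a : ℝ) :
    WeightBound (cylinder a ω) (fun x => sqDist Γ₁ x ^ α) (lowered A)
      (2 * L * β ^ 2 * μ * (4 / (1 - 2 * β) ^ 2) + L / (2 * μ)
        + 2 * L * β ^ 2 * ν * (4 / (1 - 2 * β) ^ 2)) (L / (2 * ν)) := by
  intro K φ z hK hKΩ hφ hz h0
  have hΩ := isOpen_cylinder a h.domain.isOpen
  obtain ⟨iH, hH⟩ := h.hardy_energy hK hKΩ hφ hz h0 hα hαβ hβ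
  have iE := integrable_energy_zero hΩ hK hKΩ hφ hz (h.contDiffOn_weight a α).continuousOn h0
  have iF := integrable_first_order hΩ hK hKΩ hφ hz (h.contDiffOn_weight a α) h0 (symPart A)
  have iG := integrable_first_order hΩ hK hKΩ hφ hz (h.contDiffOn_weight a α) h0 (lowered A)
  have hS := h.weightBound_symPart hA hl hL hα hαβ hβ hμ a K φ z hK hKΩ hφ hz h0
  rw [zero_mul, add_zero, ← integral_neg] at hS
  rw [← integral_neg]
  have i1 := iF.neg.add ((iH.const_mul (2 * L * β ^ 2 * ν)).add (iE.const_mul (L / (2 * ν))))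
  have hmono := integral_mono iG.neg i1 fun x => by
    simp only [Pi.neg_apply, Pi.add_apply]
    by_cases hx : x ∈ K
    · have hy := h.young_weight hA hl hL (hKΩ hx).2 hα hαβ hν (z x)
        fun j => if j = 0 then pd 0 z x else 0
      have hy' := mul_le_mul_of_nonneg_left ((neg_le_abs _).trans hy) (sq_nonneg (φ (x 0)))
      rw [sum_lowered A (h.pd_zero_weight (hKΩ hx).2 α)]
      have e : ∑ i : Fin (m + 1), (if i = 0 then pd 0 z x else 0) ^ 2 = pd 0 z x ^ 2 := by
        simp [ite_pow]
      rw [e] at hy'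
      linarith
    · have hw : 0 ≤ sqDist Γ₁ x ^ α := Real.rpow_nonneg (sqDist_nonneg _ _) _
      have hw' : 0 ≤ sqDist Γ₁ x ^ (α - 1) := Real.rpow_nonneg (sqDist_nonneg _ _) _
      have e : φ (x 0) ^ 2 * z x = 0 := by
        rw [show φ (x 0) ^ 2 * z x = φ (x 0) * (φ (x 0) * z x) by ring, h0 x hx, mul_zero]
      rw [e, zero_mul, zero_mul, neg_zero]
      positivity
  refine hmono.trans ?_
  simp only [Pi.add_apply, Pi.neg_apply]
  have i2 : Integrable fun x =>
      2 * L * β ^ 2 * ν * (φ (x 0) ^ 2 * (sqDist Γ₁ x ^ (α - 1) * z x ^ 2)) +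
        L / (2 * ν) * (φ (x 0) ^ 2 * (sqDist Γ₁ x ^ α * pd 0 z x ^ 2)) :=
    (iH.const_mul _).add (iE.const_mul _)
  have i3 : Integrable fun x => -(φ (x 0) ^ 2 * z x *
      ∑ i, pd i (fun x => sqDist Γ₁ x ^ α) x * ∑ j, symPart A i j * pd j z x) := iF.neg
  rw [integral_add i3 i2, integral_add (iH.const_mul _) (iE.const_mul _),
    integral_const_mul, integral_const_mul,
    add_mul, mul_assoc (2 * L * β ^ 2 * ν), add_assoc]
  gcongr

end WeightBounds

/-! ### The Laplacian over an interval. -/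

section PlanarWeight

variable {ω Γ₁ : Set (Eucl 1)}

lemma symPart_one {d : ℕ} : symPart (1 : Matrix (Fin d) (Fin d) ℝ) = 1 := by
  ext i j
  simp only [symPart, Matrix.one_apply, eq_comm (a := j)]
  split_ifs <;> norm_num

lemma lowered_one {m : ℕ} :
    lowered (1 : Matrix (Fin (m + 1)) (Fin (m + 1)) ℝ) = 1 := by
  ext i j
  simp only [lowered, symPart_one, Matrix.one_apply]
  by_cases hi : i = 0 <;> by_cases hj : j = 0 <;> simp [hi, hj, eq_comm (a := (0 : Fin (m + 1)))]

lemma ellipticBounds_one {d : ℕ} : EllipticBounds (1 : Matrix (Fin d) (Fin d) ℝ) 1 1 := by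
  intro ξ
  have : ∑ i, ∑ j, ξ i * (1 : Matrix (Fin d) (Fin d) ℝ) i j * ξ j = ‖ξ‖ ^ 2 := by
    rw [EuclideanSpace.norm_sq_eq]
    simp [Matrix.one_apply, sq]
  simp [this]

/-- If the cross section is an interval, the weights `δ ^ (2 α)`, `α ≤ 1 / 2`, are concave, so that
the first order term has a sign. -/
lemma IsAdmissible.weightBound_one (h : IsAdmissible ω Γ₁) {α : ℝ} (hα : 0 ≤ α)
    (hα2 : α ≤ 1 / 2) (a : ℝ) :
    WeightBound (cylinder a ω) (fun x => sqDist Γ₁ x ^ α) 1 0 0 := by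
  intro K φ z hK hKΩ hφ hz h0
  have hΩ := isOpen_cylinder a h.domain.isOpen
  have hfin : Module.finrank ℝ ((affineSpan ℝ Γ₁).direction)ᗮ = 1 := by
    have h1 := finrank_orthogonal_direction_pos h
    have h2 := Submodule.finrank_le ((affineSpan ℝ Γ₁).direction)ᗮ
    simp at h2
    omega
  obtain ⟨p, hp, e, he, hen, hpos⟩ := h.exists_half_space hfin
  have he2 : e 0 ^ 2 = 1 := by
    have := EuclideanSpace.norm_sq_eq e
    rw [hen] at this
    simpa using this.symm
  set y : Eucl 2 → ℝ := fun x => inner ℝ e (tail x - p) with hy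
  have hσy : ∀ x, sqDist Γ₁ x = y x ^ 2 := by
    intro x
    have ho : Orthonormal ℝ (fun _ : Unit => e) :=
      ⟨fun _ => hen, fun i j hij => absurd (Subsingleton.elim i j) hij⟩
    refine le_antisymm ?_ (by simpa using h.sum_inner_sq_le hp ho (fun _ => he) x)
    have h1 : sqDist Γ₁ x ≤ ‖tail x - p‖ ^ 2 := by
      have := Metric.infDist_le_dist_of_mem (x := tail x) hp
      rw [dist_eq_norm] at this
      exact pow_le_pow_left₀ Metric.infDist_nonneg this 2
    refine h1.trans (le_of_eq ?_)
    rw [hy, EuclideanSpace.norm_sq_eq]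
    simp only [PiLp.inner_apply, Finset.univ_unique, Fin.default_eq_zero, Finset.sum_singleton,
      RCLike.inner_apply, conj_trivial, mul_pow, he2, mul_one, Real.norm_eq_abs, sq_abs]
  have hemb : ∀ (f : Eucl 2 → ℝ) x, fderiv ℝ f x (embed e) = e 0 * pd 1 f x := by
    intro f x
    rw [fderiv_apply_embed]
    simp [PiLp.inner_apply, mul_comm]
  set g : Eucl 2 → ℝ := fun x => φ (x 0) * z x with hg
  have hφx : ContDiff ℝ 1 fun x : Eucl 2 => φ (x 0) := contDiff_comp_coord hφ
  have hgc : ContDiffOn ℝ 1 g (cylinder a ω) := hφx.contDiffOn.mul hz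
  -- This is W' g² / 2 with W = y^(2α). Its derivative is W' g g' + W'' g² / 2 with W'' ≤ 0 for α ≤
  -- 1/2, hence a lower bound for the first order term; and its integral vanishes.
  set f : Eucl 2 → ℝ := fun x => α * sqDist Γ₁ x ^ (α - 1) * y x * g x ^ 2 with hf
  have hyc : ContDiffOn ℝ 1 y (cylinder a ω) := (contDiff_inner_tail (n := 1) e p).contDiffOn
  have hfc : ContDiffOn ℝ 1 f (cylinder a ω) :=
    ((contDiffOn_const.mul (h.contDiffOn_weight a _)).mul hyc).mul (hgc.pow 2)
  have hf0 : ∀ x ∉ K, f x = 0 := fun x hx => by simp only [hf, hg, h0 x hx]; simp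
  have i3 := integrable_fderiv_of_eq_zero_off (μ := volume) hΩ hK hKΩ hfc hf0 (embed e)
  have h3 := integral_fderiv_eq_zero_of_eq_zero_off (μ := volume) hΩ hK hKΩ hfc hf0 (embed e)
  have iF := integrable_first_order hΩ hK hKΩ hφ hz (h.contDiffOn_weight a α) h0 1
  rw [zero_mul, zero_mul, add_zero, neg_nonpos, ← h3]
  refine integral_mono i3 iF fun x => ?_
  by_cases hx : x ∈ K
  swap
  · have : φ (x 0) ^ 2 * z x = 0 := by
      rw [show φ (x 0) ^ 2 * z x = φ (x 0) * (φ (x 0) * z x) by ring, h0 x hx, mul_zero]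
    simp [fderiv_eq_zero_of_eq_zero_off hK.isClosed hf0 hx, this]
  replace hx := hKΩ hx
  have l1 := hasLineDerivAt_of_contDiffOn hΩ h.contDiff_sqDist.contDiffOn hx (embed e)
  have l2 := hasLineDerivAt_of_contDiffOn hΩ hyc hx (embed e)
  have l3 := hasLineDerivAt_of_contDiffOn hΩ hgc hx (embed e)
  have hs := h.sqDist_pos hx.2
  have dz : DifferentiableAt ℝ z x := (hz.contDiffAt (hΩ.mem_nhds hx)).differentiableAt one_ne_zero
  rw [h.fderiv_sqDist hp he] at l1
  rw [fderiv_inner_tail_embed, real_inner_self_eq_norm_sq, hen, one_pow] at l2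
  have hgd : fderiv ℝ g x (embed e) = φ (x 0) * (e 0 * pd 1 z x) := by
    rw [hemb, hg, pd_mul (hφx.differentiable one_ne_zero x) dz, pd_comp_coord hφ,
      if_neg (by decide)]
    ring
  rw [hgd] at l3
  have l4 : HasLineDerivAt ℝ (fun _ : Eucl 2 => α) 0 x (embed e) := hasDerivAt_const _ _
  have hd := fderiv_apply_eq_of_hasLineDerivAt hΩ hfc hx (HasLineDerivAt.mul' (HasLineDerivAt.mul'
    (HasLineDerivAt.mul' l4 (HasLineDerivAt.rpow_const' l1 hs (α - 1))) l2)
    (HasLineDerivAt.sq' l3))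
  simp only [hd]
  have hσ1 : pd 1 (sqDist Γ₁) x = 2 * y x * e 0 := by
    have h5 := h.fderiv_sqDist hp he x
    rw [hemb] at h5
    calc pd 1 (sqDist Γ₁) x = e 0 * (e 0 * pd 1 (sqDist Γ₁) x) := by
          rw [← mul_assoc, ← sq, he2, one_mul]
      _ = _ := by rw [h5]; ring
  have hpW : ∑ i, pd i (fun x => sqDist Γ₁ x ^ α) x *
      ∑ j, (1 : Matrix (Fin 2) (Fin 2) ℝ) i j * pd j z x
      = α * sqDist Γ₁ x ^ (α - 1) * (2 * y x * e 0) * pd 1 z x := by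
    rw [Fin.sum_univ_two, h.pd_zero_weight hx.2, h.pd_weight hx.2, hσ1]
    simp [Matrix.one_apply]
  rw [hpW]
  have e3 : sqDist Γ₁ x ^ (α - 1) = sqDist Γ₁ x ^ (α - 1 - 1) * y x ^ 2 := by
    rw [Real.rpow_sub_one hs.ne' (α - 1), ← hσy]; field_simp
  have hw : 0 ≤ sqDist Γ₁ x ^ (α - 1 - 1) := Real.rpow_nonneg hs.le _
  rw [show inner ℝ e (tail x - p) = y x from rfl, e3, hg]
  simp only
  have : 0 ≤ α * (1 - 2 * α) * (sqDist Γ₁ x ^ (α - 1 - 1) * y x ^ 2) * (φ (x 0) * z x) ^ 2 := by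
    have : 0 ≤ 1 - 2 * α := by linarith
    positivity
  linarith

end PlanarWeight

/-! ### Caccioppoli inequalities for the truncated solution. -/

section Energy

variable {m : ℕ} {Ω : Set (Eucl (m + 1))}

/-- Coercivity gains `l`, the weight costs `θ`, and Young's inequality absorbs the cutoff term into
half of the remaining `l - θ`. -/
lemma caccioppoli_trunc (hΩ : IsOpen Ω) {v W : Eucl (m + 1) → ℝ} (hv : ContDiffOn ℝ 2 v Ω)
    {A : Matrix (Fin (m + 1)) (Fin (m + 1)) ℝ} (heq : ∀ x ∈ Ω, ellipticOp A v x = 0)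
    {l L θ : ℝ} (hA : EllipticBounds A l L) (hl : 0 < l) (hlL : l ≤ L) (hθ : θ < l)
    (hW : ContDiffOn ℝ 1 W Ω) (hW0 : ∀ x ∈ Ω, 0 ≤ W x)
    (hB : WeightBound Ω W (symPart A) θ 0) {φ : ℝ → ℝ} (hφ : ContDiff ℝ 1 φ)
    {K : Set (Eucl (m + 1))} (hK : IsCompact K) (hKΩ : K ⊆ Ω) {s : ℝ}
    {z : Eucl (m + 1) → ℝ} (hz : z = fun x => trunc s (v x))
    (h0 : ∀ x ∉ K, φ (x 0) * z x = 0) (h0' : ∀ x ∉ K, deriv φ (x 0) * z x = 0) :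
    Integrable (fun x => deriv φ (x 0) ^ 2 * (W x * z x ^ 2)) ∧
    ∫ x, φ (x 0) ^ 2 * (W x * ∑ i, pd i z x ^ 2) ≤
      4 * L ^ 2 / (l - θ) ^ 2 * ∫ x, deriv φ (x 0) ^ 2 * (W x * z x ^ 2) := by
  have hzc : ContDiffOn ℝ 1 z Ω := by
    rw [hz]
    exact ((contDiff_trunc s).comp_contDiffOn hv).of_le (by norm_num)
  have hφx : ContDiff ℝ 1 fun x : Eucl (m + 1) => φ (x 0) := contDiff_comp_coord hφ
  have hφ'x : Continuous fun x : Eucl (m + 1) => deriv φ (x 0) :=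
    (hφ.continuous_deriv le_rfl).comp (by fun_prop)
  have hpz : ∀ i, ContinuousOn (pd i z) Ω := fun i => continuousOn_fderiv_apply hΩ hzc _
  have hBz : ∀ i, ContinuousOn (fun x => ∑ j, symPart A i j * pd j z x) Ω := fun i =>
    continuousOn_finsetSum _ fun j _ => continuousOn_const.mul (hpz j)
  have hp0 : ∀ x ∉ K, ∀ i, φ (x 0) * pd i z x = 0 := fun x hx i =>
    mul_pd_eq_zero_off hK.isClosed hφ.continuous h0 hx i
  have hq : ∀ ζ : Fin (m + 1) → ℝ, ∑ i, ζ i * ∑ j, symPart A i j * ζ j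
      = ∑ i, ζ i * ∑ j, A i j * ζ j := quadratic_eq_of_add_transpose (symPart_add_transpose A)
  have hen := energy_inequality hΩ hv (B := symPart A) (fun x hx => by
      rw [← heq x hx]
      exact ellipticOp_eq_of_add_transpose (symPart_add_transpose A) hΩ hv hx)
    (fun ξ => by
      rw [hq]
      exact le_trans (mul_nonneg hl.le (Finset.sum_nonneg fun _ _ => sq_nonneg _))
        (hA.quadratic ξ).1) hW hW0 hφ hK hKΩ hz h0
  have iE := integrable_energy hΩ hK hKΩ hφ hzc hW.continuousOn h0
  have iZ : Integrable (fun x => deriv φ (x 0) ^ 2 * (W x * z x ^ 2)) := by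
    refine integrable_of_eq_zero_off hK hKΩ ((hφ'x.pow 2).continuousOn.mul
      (hW.continuousOn.mul (hzc.continuousOn.pow 2))) fun x hx => ?_
    rw [show deriv φ (x 0) ^ 2 * (W x * z x ^ 2) = W x * (deriv φ (x 0) * z x) ^ 2 by ring,
      h0' x hx]
    simp
  refine ⟨iZ, ?_⟩
  have j1 : Integrable (fun x =>
      φ (x 0) ^ 2 * (W x * ∑ i, pd i z x * ∑ j, symPart A i j * pd j z x)) := by
    refine integrable_of_eq_zero_off hK hKΩ ((hφx.continuous.pow 2).continuousOn.mul
      (hW.continuousOn.mul (continuousOn_finsetSum _ fun i _ => (hpz i).mul (hBz i)))) ?_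
    intro x hx
    rcases eq_or_ne (φ (x 0)) 0 with h | h
    · simp [h]
    · have : ∀ i, pd i z x = 0 := fun i => (mul_eq_zero.1 (hp0 x hx i)).resolve_left h
      simp [this]
  have j2 : Integrable (fun x => 2 * φ (x 0) * deriv φ (x 0) *
      (W x * (z x * ∑ j, symPart A 0 j * pd j z x))) := by
    refine integrable_of_eq_zero_off hK hKΩ (((hφx.continuous.const_mul 2).mul
      hφ'x).continuousOn.mul (hW.continuousOn.mul (hzc.continuousOn.mul (hBz 0)))) ?_
    intro x hx
    rcases mul_eq_zero.1 (h0 x hx) with h | h <;> simp [h]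
  have hwb := hB K φ z hK hKΩ hφ hzc h0
  have hLpos : 0 < L := hl.trans_le hlL
  set γ := l - θ with hγ
  have hγ0 : 0 < γ := by linarith
  have hcoer : l * ∫ x, φ (x 0) ^ 2 * (W x * ∑ i, pd i z x ^ 2) ≤
      ∫ x, φ (x 0) ^ 2 * (W x * ∑ i, pd i z x * ∑ j, symPart A i j * pd j z x) := by
    rw [← integral_const_mul]
    refine integral_mono (iE.const_mul l) j1 fun x => ?_
    by_cases hx : x ∈ K
    · have h1 := (hA.quadratic fun i => pd i z x).1
      rw [← hq] at h1
      have := mul_le_mul_of_nonneg_left h1 (mul_nonneg (sq_nonneg (φ (x 0))) (hW0 x (hKΩ hx)))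
      linarith
    · rcases eq_or_ne (φ (x 0)) 0 with h | h
      · simp [h]
      · have : ∀ i, pd i z x = 0 := fun i => (mul_eq_zero.1 (hp0 x hx i)).resolve_left h
        simp [this]
  have hmix : - ∫ x, 2 * φ (x 0) * deriv φ (x 0) *
        (W x * (z x * ∑ j, symPart A 0 j * pd j z x)) ≤
      L * (2 * L / γ) * (∫ x, deriv φ (x 0) ^ 2 * (W x * z x ^ 2))
        + γ / 2 * ∫ x, φ (x 0) ^ 2 * (W x * ∑ i, pd i z x ^ 2) := by
    rw [← integral_neg, ← integral_const_mul, ← integral_const_mul,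
      ← integral_add (iZ.const_mul _) (iE.const_mul _)]
    refine integral_mono j2.neg ((iZ.const_mul _).add (iE.const_mul _)) fun x => ?_
    simp only
    by_cases hx : x ∈ K
    -- The parameter 2L / γ leaves exactly γ / 2 times the energy to be absorbed.
    · have h1 := hA.young hl.le (fun i => if i = 0 then deriv φ (x 0) * z x else 0)
        (fun j => φ (x 0) * pd j z x) (by positivity : 0 < 2 * L / γ)
      have e1 : ∑ i : Fin (m + 1), (if i = 0 then deriv φ (x 0) * z x else 0) ^ 2
          = (deriv φ (x 0) * z x) ^ 2 := by simp [ite_pow]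
      have e2 : ∑ i : Fin (m + 1), (if i = 0 then deriv φ (x 0) * z x else 0) *
          ∑ j, symPart A i j * (φ (x 0) * pd j z x)
          = deriv φ (x 0) * z x * (φ (x 0) * ∑ j, symPart A 0 j * pd j z x) := by
        simp only [ite_mul, zero_mul, Finset.sum_ite_eq', Finset.mem_univ, if_true]
        congr 1
        rw [Finset.mul_sum]
        exact Finset.sum_congr rfl fun j _ => by ring
      simp only [mul_pow, ← Finset.mul_sum] at h1 e1
      rw [e1, e2] at h1
      have h2 := mul_le_mul_of_nonneg_left ((neg_le_abs _).trans h1)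
        (mul_nonneg zero_le_two (hW0 x (hKΩ hx)))
      calc _ = 2 * W x * -(deriv φ (x 0) * z x * (φ (x 0) * ∑ j, symPart A 0 j * pd j z x)) := by
            ring
        _ ≤ _ := h2
        _ = _ := by field_simp
    · rcases eq_or_ne (φ (x 0)) 0 with h | h
      · rw [show deriv φ (x 0) ^ 2 * (W x * z x ^ 2) = W x * (deriv φ (x 0) * z x) ^ 2 by ring,
          h0' x hx]
        simp [h]
      · have h2 : ∀ i, pd i z x = 0 := fun i => (mul_eq_zero.1 (hp0 x hx i)).resolve_left h
        have h3 : z x = 0 := (mul_eq_zero.1 (h0 x hx)).resolve_left h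
        simp [h2, h3]
  set X := ∫ x, φ (x 0) ^ 2 * (W x * ∑ i, pd i z x ^ 2)
  set Z := ∫ x, deriv φ (x 0) ^ 2 * (W x * z x ^ 2)
  have hfin : γ / 2 * X ≤ L * (2 * L / γ) * Z := by
    rw [zero_mul, add_zero] at hwb
    have : l * X - θ * X = γ * X := by rw [hγ]; ring
    linarith
  have := mul_le_mul_of_nonneg_left hfin (by positivity : 0 ≤ 2 / γ)
  calc X = 2 / γ * (γ / 2 * X) := by field_simp
    _ ≤ _ := this
    _ = _ := by field_simp; ring

/-- With `lowered A` the cutoff term contains only z ∂z/∂x₁. It is kept as a product rather than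
split, which is what gives the factor ‖wu‖ ‖w u_{x₁}‖ / h later. -/
lemma lowered_energy_trunc (hΩ : IsOpen Ω) {v W : Eucl (m + 1) → ℝ} (hv : ContDiffOn ℝ 2 v Ω)
    {A : Matrix (Fin (m + 1)) (Fin (m + 1)) ℝ} (heq : ∀ x ∈ Ω, ellipticOp A v x = 0)
    {l L θ κ : ℝ} (hA : EllipticBounds A l L) (hl : 0 < l)
    (hW : ContDiffOn ℝ 1 W Ω) (hW0 : ∀ x ∈ Ω, 0 ≤ W x)
    (hB : WeightBound Ω W (lowered A) θ κ) {φ : ℝ → ℝ} (hφ : ContDiff ℝ 1 φ)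
    {K : Set (Eucl (m + 1))} (hK : IsCompact K) (hKΩ : K ⊆ Ω) {s : ℝ}
    {z : Eucl (m + 1) → ℝ} (hz : z = fun x => trunc s (v x))
    (h0 : ∀ x ∉ K, φ (x 0) * z x = 0) :
    Integrable (fun x => |φ (x 0) * deriv φ (x 0)| * (W x * |z x * pd 0 z x|)) ∧
    (l - θ) * ∫ x, φ (x 0) ^ 2 * (W x * ∑ i, pd i z x ^ 2) ≤
      2 * L * (∫ x, |φ (x 0) * deriv φ (x 0)| * (W x * |z x * pd 0 z x|))
        + κ * ∫ x, φ (x 0) ^ 2 * (W x * pd 0 z x ^ 2) := by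
  have hzc : ContDiffOn ℝ 1 z Ω := by
    rw [hz]
    exact ((contDiff_trunc s).comp_contDiffOn hv).of_le (by norm_num)
  have hφx : ContDiff ℝ 1 fun x : Eucl (m + 1) => φ (x 0) := contDiff_comp_coord hφ
  have hφ'x : Continuous fun x : Eucl (m + 1) => deriv φ (x 0) :=
    (hφ.continuous_deriv le_rfl).comp (by fun_prop)
  have hpz : ∀ i, ContinuousOn (pd i z) Ω := fun i => continuousOn_fderiv_apply hΩ hzc _
  have hBz : ∀ i, ContinuousOn (fun x => ∑ j, lowered A i j * pd j z x) Ω := fun i =>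
    continuousOn_finsetSum _ fun j _ => continuousOn_const.mul (hpz j)
  have hp0 : ∀ x ∉ K, ∀ i, φ (x 0) * pd i z x = 0 := fun x hx i =>
    mul_pd_eq_zero_off hK.isClosed hφ.continuous h0 hx i
  have hq : ∀ ζ : Fin (m + 1) → ℝ, ∑ i, ζ i * ∑ j, lowered A i j * ζ j
      = ∑ i, ζ i * ∑ j, A i j * ζ j := quadratic_eq_of_add_transpose (lowered_add_transpose A)
  have hen := energy_inequality hΩ hv (B := lowered A) (fun x hx => by
      rw [← heq x hx]
      exact ellipticOp_eq_of_add_transpose (lowered_add_transpose A) hΩ hv hx)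
    (fun ξ => by
      rw [hq]
      exact le_trans (mul_nonneg hl.le (Finset.sum_nonneg fun _ _ => sq_nonneg _))
        (hA.quadratic ξ).1) hW hW0 hφ hK hKΩ hz h0
  have iE := integrable_energy hΩ hK hKΩ hφ hzc hW.continuousOn h0
  have iZ : Integrable (fun x => |φ (x 0) * deriv φ (x 0)| * (W x * |z x * pd 0 z x|)) := by
    refine integrable_of_eq_zero_off hK hKΩ ((hφx.continuous.mul hφ'x).abs.continuousOn.mul
      (hW.continuousOn.mul (hzc.continuousOn.mul (hpz 0)).abs)) fun x hx => ?_
    rcases mul_eq_zero.1 (h0 x hx) with h | h <;> simp [h]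
  refine ⟨iZ, ?_⟩
  have j1 : Integrable (fun x =>
      φ (x 0) ^ 2 * (W x * ∑ i, pd i z x * ∑ j, lowered A i j * pd j z x)) := by
    refine integrable_of_eq_zero_off hK hKΩ ((hφx.continuous.pow 2).continuousOn.mul
      (hW.continuousOn.mul (continuousOn_finsetSum _ fun i _ => (hpz i).mul (hBz i)))) ?_
    intro x hx
    rcases eq_or_ne (φ (x 0)) 0 with h | h
    · simp [h]
    · have : ∀ i, pd i z x = 0 := fun i => (mul_eq_zero.1 (hp0 x hx i)).resolve_left h
      simp [this]
  have j2 : Integrable (fun x => 2 * φ (x 0) * deriv φ (x 0) *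
      (W x * (z x * ∑ j, lowered A 0 j * pd j z x))) := by
    refine integrable_of_eq_zero_off hK hKΩ (((hφx.continuous.const_mul 2).mul
      hφ'x).continuousOn.mul (hW.continuousOn.mul (hzc.continuousOn.mul (hBz 0)))) ?_
    intro x hx
    rcases mul_eq_zero.1 (h0 x hx) with h | h <;> simp [h]
  have hwb := hB K φ z hK hKΩ hφ hzc h0
  have hcoer : l * ∫ x, φ (x 0) ^ 2 * (W x * ∑ i, pd i z x ^ 2) ≤
      ∫ x, φ (x 0) ^ 2 * (W x * ∑ i, pd i z x * ∑ j, lowered A i j * pd j z x) := by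
    rw [← integral_const_mul]
    refine integral_mono (iE.const_mul l) j1 fun x => ?_
    by_cases hx : x ∈ K
    · have h1 := (hA.quadratic fun i => pd i z x).1
      rw [← hq] at h1
      have := mul_le_mul_of_nonneg_left h1 (mul_nonneg (sq_nonneg (φ (x 0))) (hW0 x (hKΩ hx)))
      linarith
    · rcases eq_or_ne (φ (x 0)) 0 with h | h
      · simp [h]
      · have : ∀ i, pd i z x = 0 := fun i => (mul_eq_zero.1 (hp0 x hx i)).resolve_left h
        simp [this]
  have hA00 : 0 ≤ A 0 0 ∧ A 0 0 ≤ L := by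
    have h1 := hA.quadratic fun i => if i = 0 then 1 else 0
    simp only [ite_pow, one_pow, ne_eq, OfNat.ofNat_ne_zero, not_false_eq_true, zero_pow,
      Finset.sum_ite_eq', Finset.mem_univ, if_true, mul_one, ite_mul, one_mul, zero_mul,
      mul_ite, mul_zero] at h1
    exact ⟨hl.le.trans h1.1, h1.2⟩
  have hmix : - ∫ x, 2 * φ (x 0) * deriv φ (x 0) *
        (W x * (z x * ∑ j, lowered A 0 j * pd j z x)) ≤
      2 * L * ∫ x, |φ (x 0) * deriv φ (x 0)| * (W x * |z x * pd 0 z x|) := by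
    rw [← integral_neg, ← integral_const_mul]
    refine integral_mono j2.neg (iZ.const_mul _) fun x => ?_
    rw [sum_lowered_zero]
    by_cases hx : x ∈ K
    · have hw := hW0 x (hKΩ hx)
      have h1 : -(φ (x 0) * deriv φ (x 0) * (z x * pd 0 z x)) ≤
          |φ (x 0) * deriv φ (x 0)| * |z x * pd 0 z x| := by
        rw [← abs_mul]; exact neg_le_abs _
      calc _ = 2 * A 0 0 * W x * -(φ (x 0) * deriv φ (x 0) * (z x * pd 0 z x)) := by ring
        _ ≤ 2 * A 0 0 * W x * (|φ (x 0) * deriv φ (x 0)| * |z x * pd 0 z x|) :=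
          mul_le_mul_of_nonneg_left h1 (by have := hA00.1; positivity)
        _ ≤ 2 * L * W x * (|φ (x 0) * deriv φ (x 0)| * |z x * pd 0 z x|) := by
          have := hA00.2
          gcongr
        _ = _ := by ring
    · rcases mul_eq_zero.1 (h0 x hx) with h | h <;> simp [h]
  linarith

end Energy

/-! ### Removal of the truncation by Fatou's lemma. -/

section Limits

variable {m : ℕ}

/-- A differentiable function has vanishing derivative almost everywhere on its zero set. -/
lemma ae_fderiv_eq_zero_of_eq_zero {Ω : Set (Eucl (m + 1))} (hΩ : IsOpen Ω)
    {v : Eucl (m + 1) → ℝ} (hv : ContDiffOn ℝ 1 v Ω) :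
    ∀ᵐ x ∂(volume.restrict Ω), v x = 0 → fderiv ℝ v x = 0 := by
  set e : Eucl (m + 1) := EuclideanSpace.single 0 1
  have he : e ≠ 0 := by simp [e]
  set S := Ω ∩ v ⁻¹' {0} with hS
  have hSm : MeasurableSet S := by
    have h1 : IsOpen (Ω ∩ v ⁻¹' {0}ᶜ) :=
      hv.continuousOn.isOpen_inter_preimage hΩ isOpen_compl_singleton
    have h2 : S = Ω \ (Ω ∩ v ⁻¹' {0}ᶜ) := by
      ext x; simp [hS]
    rw [h2]
    exact hΩ.measurableSet.diff h1.measurableSet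
  -- On the zero set the self-map v • e is approximated by the zero map with error constant 0, which
  -- forces its derivative to vanish at almost every point of that set.
  have happ : ApproximatesLinearOn (fun x => v x • e) (0 : Eucl (m + 1) →L[ℝ] Eucl (m + 1)) S 0 := by
    intro x hx y hy
    have hx0 : v x = 0 := hx.2
    have hy0 : v y = 0 := hy.2
    simp [hx0, hy0]
  have h1 := happ.norm_fderiv_sub_le volume hSm (fun x => (fderiv ℝ v x).smulRight e) fun x hx =>
    ((((hv.contDiffAt (hΩ.mem_nhds hx.1)).differentiableAt
      one_ne_zero).hasFDerivAt).smul_const e).hasFDerivWithinAt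
  rw [ae_restrict_iff' hSm] at h1
  rw [ae_restrict_iff' hΩ.measurableSet]
  filter_upwards [h1] with x hx hxΩ hx0
  have h2 := hx ⟨hxΩ, hx0⟩
  rw [sub_zero, nonpos_iff_eq_zero, nnnorm_eq_zero] at h2
  ext w
  have h3 := congrArg (fun T : Eucl (m + 1) →L[ℝ] Eucl (m + 1) => T w) h2
  simpa [he] using h3

lemma ContinuousOn.aemeasurable_ofReal {Ω : Set (Eucl (m + 1))} (hΩ : IsOpen Ω)
    {f : Eucl (m + 1) → ℝ} (hf : ContinuousOn f Ω) :
    AEMeasurable (fun x => ENNReal.ofReal (f x)) (volume.restrict Ω) :=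
  (hf.aemeasurable hΩ.measurableSet).ennreal_ofReal

/-- Removal of the truncation in an energy estimate. -/
lemma lintegral_energy_le_of_trunc {Ω : Set (Eucl (m + 1))} (hΩ : IsOpen Ω)
    {v W : Eucl (m + 1) → ℝ} (hv : ContDiffOn ℝ 1 v Ω) (hW : ContinuousOn W Ω) {d : ℝ → ℝ}
    (hd : Continuous d) (hd0 : ∀ x ∈ Ω, 0 ≤ d (x 0)) {R : ENNReal}
    (hR : ∀ s > 0, ∫⁻ x in Ω, ENNReal.ofReal (trunc s (d (x 0)) ^ 2 *
      (W x * ∑ i, (truncDeriv s (v x) * pd i v x) ^ 2)) ≤ R) :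
    ∫⁻ x in Ω, ENNReal.ofReal (d (x 0) ^ 2 * (W x * ∑ i, pd i v x ^ 2)) ≤ R := by
  have hpv : ∀ i, ContinuousOn (pd i v) Ω := fun i => continuousOn_fderiv_apply hΩ hv _
  set s : ℕ → ℝ := fun n => 1 / ((n : ℝ) + 1) with hs
  have hs0 : ∀ n, 0 < s n := fun n => by positivity
  have hst : Filter.Tendsto s Filter.atTop (nhdsWithin 0 (Set.Ioi 0)) :=
    tendsto_nhdsWithin_iff.2 ⟨tendsto_one_div_add_atTop_nhds_zero_nat,
      Filter.Eventually.of_forall hs0⟩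
  set F : ℕ → Eucl (m + 1) → ENNReal := fun n x =>
    ENNReal.ofReal (trunc (s n) (d (x 0)) ^ 2 *
      (W x * ∑ i, (truncDeriv (s n) (v x) * pd i v x) ^ 2)) with hF
  have hFm : ∀ n, AEMeasurable (F n) (volume.restrict Ω) := by
    intro n
    refine ContinuousOn.aemeasurable_ofReal hΩ ?_
    have h1 : Continuous fun x : Eucl (m + 1) => trunc (s n) (d (x 0)) :=
      (contDiff_trunc (s n)).continuous.comp (hd.comp (by fun_prop))
    have h2 : Continuous (truncDeriv (s n)) := (contDiff_truncDeriv (n := 0) _).continuous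
    exact (h1.pow 2).continuousOn.mul (hW.mul (continuousOn_finsetSum _ fun i _ =>
      ((h2.comp_continuousOn hv.continuousOn).mul (hpv i)).pow 2))
  have hlim : ∀ᵐ x ∂(volume.restrict Ω), Filter.liminf (fun n => F n x) Filter.atTop
      = ENNReal.ofReal (d (x 0) ^ 2 * (W x * ∑ i, pd i v x ^ 2)) := by
    filter_upwards [ae_fderiv_eq_zero_of_eq_zero hΩ hv, ae_restrict_mem hΩ.measurableSet]
      with x hx hxΩ
    apply Filter.Tendsto.liminf_eq
    refine (ENNReal.continuous_ofReal.tendsto _).comp ?_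
    refine (((tendsto_trunc (hd0 x hxΩ)).comp hst).pow 2).mul
      (tendsto_const_nhds.mul (tendsto_finsetSum _ fun i _ => ?_))
    -- Where v = 0 the factors `truncDeriv` do not tend to 1, but there the gradient vanishes almost
    -- everywhere.
    by_cases hvx : v x = 0
    · have : pd i v x = 0 := by simp [pd, hx hvx]
      simp only [this, mul_zero]
      exact tendsto_const_nhds
    · have h1 := ((((tendsto_truncDeriv hvx).comp hst).mul_const (pd i v x)).pow 2)
      simpa using h1
  calc ∫⁻ x in Ω, ENNReal.ofReal (d (x 0) ^ 2 * (W x * ∑ i, pd i v x ^ 2))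
      = ∫⁻ x in Ω, Filter.liminf (fun n => F n x) Filter.atTop :=
        (lintegral_congr_ae hlim).symm
    _ ≤ Filter.liminf (fun n => ∫⁻ x in Ω, F n x) Filter.atTop := lintegral_liminf_le' hFm
    _ ≤ R := Filter.liminf_le_of_frequently_le'
        (Filter.Frequently.of_forall fun n => hR (s n) (hs0 n))

end Limits

/-! ### Cutoff in x₁ and compact support of the test functions. -/

section Solutions

variable {m : ℕ} {ω Γ₁ : Set (Eucl m)}

/-- The parabola `t (h - t) / h`, comparable to the distance to the end points of `(0, h)`. -/
def bump (h t : ℝ) : ℝ := t * (h - t) / h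

lemma contDiff_bump (h : ℝ) {n : WithTop ℕ∞} : ContDiff ℝ n (bump h) := by
  unfold bump; fun_prop

lemma hasDerivAt_bump (h t : ℝ) : HasDerivAt (bump h) ((h - 2 * t) / h) t := by
  have := (((hasDerivAt_id t).mul ((hasDerivAt_id t).const_sub h)).div_const h)
  refine this.congr_deriv ?_
  simp; ring

lemma bump_pos {h t : ℝ} (ht : t ∈ Set.Ioo 0 h) : 0 < bump h t := by
  have h1 := ht.1
  have h2 : 0 < h - t := sub_pos.2 ht.2
  have h3 : 0 < h := ht.1.trans ht.2
  unfold bump; positivity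

lemma bump_le {h t : ℝ} (ht : t ∈ Set.Ioo 0 h) : bump h t ≤ h := by
  have h3 : 0 < h := ht.1.trans ht.2
  unfold bump
  rw [div_le_iff₀ h3]
  nlinarith [ht.1, ht.2]

lemma mem_Ioo_of_bump_pos {h t : ℝ} (hh : 0 < h) (ht : 0 < bump h t) : t ∈ Set.Ioo 0 h := by
  unfold bump at ht
  have h1 : 0 < t * (h - t) := by
    by_contra! hle
    exact absurd ht (not_lt.2 (div_nonpos_of_nonpos_of_nonneg hle hh.le))
  rcases pos_and_pos_or_neg_and_neg_of_mul_pos h1 with ⟨h2, h3⟩ | ⟨h2, h3⟩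
  · exact ⟨h2, by linarith⟩
  · linarith

lemma abs_deriv_bump_le {h t : ℝ} (ht : t ∈ Set.Ioo 0 h) : |(h - 2 * t) / h| ≤ 1 := by
  have h3 : 0 < h := ht.1.trans ht.2
  rw [abs_div, abs_of_pos h3, div_le_one h3, abs_le]
  constructor <;> linarith [ht.1, ht.2]

/-- The cutoff function in the first variable. -/
def cutoff (h s t : ℝ) : ℝ := trunc s (bump h t)

lemma contDiff_cutoff (h s : ℝ) : ContDiff ℝ 1 (cutoff h s) :=
  ((contDiff_trunc s).of_le (by norm_num)).comp (contDiff_bump h)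

lemma deriv_cutoff (h s t : ℝ) :
    deriv (cutoff h s) t = truncDeriv s (bump h t) * ((h - 2 * t) / h) :=
  ((hasDerivAt_trunc s (bump h t)).comp t (hasDerivAt_bump h t)).deriv

lemma abs_deriv_cutoff_le {h s t : ℝ} (ht : t ∈ Set.Ioo 0 h) : |deriv (cutoff h s) t| ≤ 1 := by
  rw [deriv_cutoff, abs_mul, abs_of_nonneg (truncDeriv_nonneg _ _)]
  exact mul_le_one₀ (truncDeriv_le_one _ _) (abs_nonneg _) (abs_deriv_bump_le ht)

lemma abs_cutoff_le {h s t : ℝ} (ht : t ∈ Set.Ioo 0 h) : |cutoff h s t| ≤ h := by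
  refine (abs_trunc_le _ _).trans ?_
  rw [abs_of_pos (bump_pos ht)]
  exact bump_le ht

lemma closure_cylinder_subset (h : ℝ) :
    closure (cylinder h ω) ⊆ {x | x 0 ∈ Set.Icc 0 h ∧ tail x ∈ closure ω} := by
  refine closure_minimal (fun x hx => ⟨⟨hx.1.1.le, hx.1.2.le⟩, subset_closure hx.2⟩) ?_
  exact (isClosed_Icc.preimage (by fun_prop : Continuous fun x : Eucl (m + 1) => x 0)).inter
    (isClosed_closure.preimage continuous_tail)

lemma isBounded_cylinder (h : ℝ) (hω : Bornology.IsBounded ω) :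
    Bornology.IsBounded (cylinder h ω) := by
  obtain ⟨R, hR⟩ := hω.exists_norm_le
  rw [isBounded_iff_forall_norm_le]
  refine ⟨√(h ^ 2 + R ^ 2), fun x hx => ?_⟩
  refine Real.le_sqrt_of_sq_le ?_
  rw [EuclideanSpace.norm_sq_eq, Fin.sum_univ_succ]
  have h1 := hR _ hx.2
  have h2 : ‖tail x‖ ^ 2 ≤ R ^ 2 := pow_le_pow_left₀ (norm_nonneg _) h1 2
  rw [EuclideanSpace.norm_sq_eq] at h2
  have h3 : ‖x 0‖ ^ 2 ≤ h ^ 2 := by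
    rw [Real.norm_of_nonneg hx.1.1.le]
    exact pow_le_pow_left₀ hx.1.1.le hx.1.2.le 2
  have h4 : ∑ i : Fin m, ‖x i.succ‖ ^ 2 ≤ R ^ 2 := h2
  linarith

/-- The truncations of a solution, cut off in the first variable, have compact support. -/
lemma IsSolution.exists_compact {h : ℝ} (hh : 0 < h) (hω : IsLipschitzDomain ω)
    {A : Matrix (Fin (m + 1)) (Fin (m + 1)) ℝ} {v : Eucl (m + 1) → ℝ} (hv : IsSolution h ω A v)
    {s : ℝ} (hs : 0 < s) :
    ∃ K, IsCompact K ∧ K ⊆ cylinder h ω ∧ ∀ x ∉ K,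
      cutoff h s (x 0) * trunc s ((cylinder h ω).indicator v x) = 0 ∧
      deriv (cutoff h s) (x 0) * trunc s ((cylinder h ω).indicator v x) = 0 := by
  set C := closure (cylinder h ω) with hC
  have hCc : IsCompact C := Metric.isCompact_of_isClosed_isBounded isClosed_closure
    (isBounded_cylinder h hω.isBounded).closure
  -- A closed part of the compact closure: bump ≥ s keeps away from the two ends, and |v| ≥ s
  -- excludes the lateral boundary, where v = 0.
  set K : Set (Eucl (m + 1)) := (C ∩ v ⁻¹' {r | s ≤ |r|}) ∩ {x | s ≤ bump h (x 0)} with hK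
  have hKc : IsCompact K := by
    have h1 : IsClosed (C ∩ v ⁻¹' {r | s ≤ |r|}) :=
      hv.continuousOn.preimage_isClosed_of_isClosed isClosed_closure
        (isClosed_le continuous_const continuous_abs)
    have h2 : IsClosed {x : Eucl (m + 1) | s ≤ bump h (x 0)} :=
      isClosed_le continuous_const
        ((contDiff_bump h (n := 0)).continuous.comp (by fun_prop))
    exact hCc.of_isClosed_subset (h1.inter h2) fun x hx => hx.1.1
  refine ⟨K, hKc, fun x hx => ?_, fun x hx => ?_⟩
  · obtain ⟨⟨hxC, hxv⟩, hxb⟩ := hx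
    have hx0 : x 0 ∈ Set.Ioo 0 h := mem_Ioo_of_bump_pos hh (hs.trans_le hxb)
    refine ⟨hx0, ?_⟩
    by_contra hxω
    have h1 : tail x ∈ frontier ω := by
      rw [hω.isOpen.frontier_eq]
      exact ⟨(closure_cylinder_subset h hxC).2, hxω⟩
    have h2 := hv.boundary x ⟨hx0, h1⟩
    have h3 : s ≤ |v x| := hxv
    rw [h2, abs_zero] at h3
    linarith
  · have hz : trunc s (0 : ℝ) = 0 := trunc_eq_zero hs (by simpa using hs.le)
    -- Outside (0, h) the function `bump` is nonpositive and `cutoff` need not vanish there. It is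
    -- the indicator, with `trunc s 0 = 0`, that makes the product zero outside the cylinder.
    by_cases hxΩ : x ∈ cylinder h ω
    · rw [Set.indicator_of_mem hxΩ]
      by_cases hb : s ≤ bump h (x 0)
      · have : |v x| ≤ s := by
          by_contra! hlt
          exact hx ⟨⟨subset_closure hxΩ, hlt.le⟩, hb⟩
        simp [trunc_eq_zero hs this]
      · have hb' : |bump h (x 0)| ≤ s := by
          rw [abs_of_pos (bump_pos hxΩ.1)]
          linarith
        rw [deriv_cutoff, cutoff, trunc_eq_zero hs hb', truncDeriv_eq_zero hs hb']
        simp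
    · rw [Set.indicator_of_notMem hxΩ, hz]
      simp

end Solutions

/-! ### Energy inequalities for solutions. -/

section SolutionEnergy

variable {m : ℕ} {ω : Set (Eucl m)}

lemma ofReal_integral_eq_setLIntegral {Ω : Set (Eucl (m + 1))} (hΩ : MeasurableSet Ω)
    {f : Eucl (m + 1) → ℝ} (hf : Integrable f) (h0 : ∀ x ∉ Ω, f x = 0) (hnn : ∀ x ∈ Ω, 0 ≤ f x) :
    ENNReal.ofReal (∫ x, f x) = ∫⁻ x in Ω, ENNReal.ofReal (f x) := by
  have hnn' : ∀ x, 0 ≤ f x := fun x => by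
    by_cases hx : x ∈ Ω
    · exact hnn x hx
    · exact (h0 x hx).ge
  rw [ofReal_integral_eq_lintegral_ofReal hf (Filter.Eventually.of_forall hnn'),
    ← lintegral_indicator hΩ]
  refine lintegral_congr fun x => ?_
  by_cases hx : x ∈ Ω
  · simp [hx]
  · simp [hx, h0 x hx]

lemma IsSolution.indicator_congr {h : ℝ} (hω : IsOpen ω) {v : Eucl (m + 1) → ℝ}
    {x : Eucl (m + 1)} (hx : x ∈ cylinder h ω) :
    (cylinder h ω).indicator v =ᶠ[nhds x] v := by
  filter_upwards [(isOpen_cylinder h hω).mem_nhds hx] with y hy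
  simp [hy]

lemma pd_trunc_indicator {h s : ℝ} (hω : IsOpen ω) {v : Eucl (m + 1) → ℝ}
    (hv : ContDiffOn ℝ 2 v (cylinder h ω)) {x : Eucl (m + 1)} (hx : x ∈ cylinder h ω)
    (i : Fin (m + 1)) :
    pd i (fun x => trunc s ((cylinder h ω).indicator v x)) x
      = truncDeriv s (v x) * pd i v x := by
  have h1 : (fun x => trunc s ((cylinder h ω).indicator v x)) =ᶠ[nhds x] fun x => trunc s (v x) := by
    filter_upwards [IsSolution.indicator_congr hω (v := v) hx] with y hy
    rw [hy]
  rw [pd_congr h1]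
  exact pd_comp (hasDerivAt_trunc s (v x))
    ((hv.contDiffAt ((isOpen_cylinder h hω).mem_nhds hx)).differentiableAt two_ne_zero) i

variable {h : ℝ} {A : Matrix (Fin (m + 1)) (Fin (m + 1)) ℝ} {v W : Eucl (m + 1) → ℝ}
  {l L θ κ : ℝ}

/-- Weighted Caccioppoli inequality for solutions which vanish on the lateral boundary. -/
theorem IsSolution.caccioppoli (hh : 0 < h) (hω : IsLipschitzDomain ω) (hv : IsSolution h ω A v)
    (hA : EllipticBounds A l L) (hl : 0 < l) (hlL : l ≤ L) (hθ : θ < l)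
    (hW : ContDiffOn ℝ 1 W (cylinder h ω)) (hW0 : ∀ x ∈ cylinder h ω, 0 ≤ W x)
    (hB : WeightBound (cylinder h ω) W (symPart A) θ 0) :
    ∫⁻ x in cylinder h ω, ENNReal.ofReal (bump h (x 0) ^ 2 * (W x * ∑ i, pd i v x ^ 2)) ≤
      ENNReal.ofReal (4 * L ^ 2 / (l - θ) ^ 2) *
        ∫⁻ x in cylinder h ω, ENNReal.ofReal (W x * v x ^ 2) := by
  have hΩ := isOpen_cylinder h hω.isOpen
  have hγ : 0 < l - θ := by linarith
  refine lintegral_energy_le_of_trunc hΩ (hv.contDiffOn.of_le (by norm_num)) hW.continuousOn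
    (contDiff_bump h (n := 0)).continuous (fun x hx => (bump_pos hx.1).le) fun s hs => ?_
  obtain ⟨K, hK, hKΩ, hoff⟩ := hv.exists_compact hh hω hs
  -- The values of `v` outside the closed cylinder are arbitrary; extension by zero gives test
  -- functions defined on the whole space.
  set v' := (cylinder h ω).indicator v with hv'
  set z : Eucl (m + 1) → ℝ := fun x => trunc s (v' x) with hz
  have hcongr : ∀ x ∈ cylinder h ω, v' x = v x := fun x hx => Set.indicator_of_mem hx _
  have hv'c : ContDiffOn ℝ 2 v' (cylinder h ω) := hv.contDiffOn.congr hcongr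
  have heq : ∀ x ∈ cylinder h ω, ellipticOp A v' x = 0 := fun x hx => by
    rw [ellipticOp_congr_of_eventuallyEq (IsSolution.indicator_congr hω.isOpen hx),
      hv.equation x hx]
  have hφ := contDiff_cutoff h s
  have hzc : ContDiffOn ℝ 1 z (cylinder h ω) :=
    ((contDiff_trunc s).comp_contDiffOn hv'c).of_le (by norm_num)
  obtain ⟨iZ, hmain⟩ := caccioppoli_trunc hΩ hv'c heq hA hl hlL hθ hW hW0 hB hφ hK hKΩ
    (s := s) (z := z) rfl (fun x hx => (hoff x hx).1) (fun x hx => (hoff x hx).2)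
  have iE := integrable_energy hΩ hK hKΩ hφ hzc hW.continuousOn fun x hx => (hoff x hx).1
  have hz0 : ∀ x ∉ cylinder h ω, z x = 0 := fun x hx => by
    simp only [hz, hv', Set.indicator_of_notMem hx]
    exact trunc_eq_zero hs (by simpa using hs.le)
  have hp0 : ∀ x ∉ cylinder h ω, ∀ i, cutoff h s (x 0) * pd i z x = 0 := fun x hx i =>
    mul_pd_eq_zero_off hK.isClosed hφ.continuous (fun x hx => (hoff x hx).1)
      (fun hxK => hx (hKΩ hxK)) i
  have e1 := ofReal_integral_eq_setLIntegral hΩ.measurableSet iE (fun x hx => by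
    rcases eq_or_ne (cutoff h s (x 0)) 0 with hc | hc
    · simp [hc]
    · have : ∀ i, pd i z x = 0 := fun i => (mul_eq_zero.1 (hp0 x hx i)).resolve_left hc
      simp [this]) (fun x hx => mul_nonneg (sq_nonneg _) (mul_nonneg (hW0 x hx)
        (Finset.sum_nonneg fun _ _ => sq_nonneg _)))
  have e2 := ofReal_integral_eq_setLIntegral hΩ.measurableSet iZ (fun x hx => by
    simp [hz0 x hx]) (fun x hx => mul_nonneg (sq_nonneg _) (mul_nonneg (hW0 x hx) (sq_nonneg _)))
  calc ∫⁻ x in cylinder h ω, ENNReal.ofReal (trunc s (bump h (x 0)) ^ 2 *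
        (W x * ∑ i, (truncDeriv s (v x) * pd i v x) ^ 2))
      = ∫⁻ x in cylinder h ω, ENNReal.ofReal (cutoff h s (x 0) ^ 2 *
        (W x * ∑ i, pd i z x ^ 2)) := by
        refine setLIntegral_congr_fun hΩ.measurableSet fun x hx => ?_
        simp only [hz, hv', pd_trunc_indicator hω.isOpen hv.contDiffOn hx, cutoff]
    _ = ENNReal.ofReal (∫ x, cutoff h s (x 0) ^ 2 * (W x * ∑ i, pd i z x ^ 2)) := e1.symm
    _ ≤ ENNReal.ofReal (4 * L ^ 2 / (l - θ) ^ 2 *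
        ∫ x, deriv (cutoff h s) (x 0) ^ 2 * (W x * z x ^ 2)) := ENNReal.ofReal_le_ofReal hmain
    _ = ENNReal.ofReal (4 * L ^ 2 / (l - θ) ^ 2) * ∫⁻ x in cylinder h ω,
        ENNReal.ofReal (deriv (cutoff h s) (x 0) ^ 2 * (W x * z x ^ 2)) := by
        rw [ENNReal.ofReal_mul (by positivity), e2]
    _ ≤ _ := by
        refine mul_le_mul' le_rfl ?_
        refine setLIntegral_mono' hΩ.measurableSet fun x hx => ENNReal.ofReal_le_ofReal ?_
        have h1 : deriv (cutoff h s) (x 0) ^ 2 ≤ 1 :=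
          (sq_le_one_iff_abs_le_one _).2 (abs_deriv_cutoff_le hx.1)
        have h2 : z x ^ 2 ≤ v x ^ 2 := by
          rw [sq_le_sq]
          simpa [hz, hcongr x hx] using abs_trunc_le s (v x)
        have h3 := hW0 x hx
        calc _ ≤ 1 * (W x * v x ^ 2) := by gcongr
          _ = _ := one_mul _

/-- Interior energy estimate in terms of `v` and `∂v/∂x₁`. -/
theorem IsSolution.interior_energy (hh : 0 < h) (hω : IsLipschitzDomain ω)
    (hv : IsSolution h ω A v)
    (hA : EllipticBounds A l L) (hl : 0 < l) (hlL : l ≤ L) (hθ : θ < l) (hκ : 0 ≤ κ)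
    (hW : ContDiffOn ℝ 1 W (cylinder h ω)) (hW0 : ∀ x ∈ cylinder h ω, 0 ≤ W x)
    (hB : WeightBound (cylinder h ω) W (lowered A) θ κ) :
    ∫⁻ x in cylinder h ω, ENNReal.ofReal (bump h (x 0) ^ 2 * (W x * ∑ i, pd i v x ^ 2)) ≤
      ENNReal.ofReal (2 * L * h / (l - θ)) *
          (∫⁻ x in cylinder h ω, ENNReal.ofReal (W x * |v x * pd 0 v x|)) +
        ENNReal.ofReal (κ * h ^ 2 / (l - θ)) *
          ∫⁻ x in cylinder h ω, ENNReal.ofReal (W x * pd 0 v x ^ 2) := by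
  have hΩ := isOpen_cylinder h hω.isOpen
  have hγ : 0 < l - θ := by linarith
  have hL : 0 < L := hl.trans_le hlL
  refine lintegral_energy_le_of_trunc hΩ (hv.contDiffOn.of_le (by norm_num)) hW.continuousOn
    (contDiff_bump h (n := 0)).continuous (fun x hx => (bump_pos hx.1).le) fun s hs => ?_
  obtain ⟨K, hK, hKΩ, hoff⟩ := hv.exists_compact hh hω hs
  set v' := (cylinder h ω).indicator v with hv'
  set z : Eucl (m + 1) → ℝ := fun x => trunc s (v' x) with hz
  have hcongr : ∀ x ∈ cylinder h ω, v' x = v x := fun x hx => Set.indicator_of_mem hx _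
  have hv'c : ContDiffOn ℝ 2 v' (cylinder h ω) := hv.contDiffOn.congr hcongr
  have heq : ∀ x ∈ cylinder h ω, ellipticOp A v' x = 0 := fun x hx => by
    rw [ellipticOp_congr_of_eventuallyEq (IsSolution.indicator_congr hω.isOpen hx),
      hv.equation x hx]
  have hφ := contDiff_cutoff h s
  have hzc : ContDiffOn ℝ 1 z (cylinder h ω) :=
    ((contDiff_trunc s).comp_contDiffOn hv'c).of_le (by norm_num)
  obtain ⟨iZ, hmain⟩ := lowered_energy_trunc hΩ hv'c heq hA hl hW hW0 hB hφ hK hKΩ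
    (s := s) (z := z) rfl (fun x hx => (hoff x hx).1)
  have iE := integrable_energy hΩ hK hKΩ hφ hzc hW.continuousOn fun x hx => (hoff x hx).1
  have iE0 := integrable_energy_zero hΩ hK hKΩ hφ hzc hW.continuousOn fun x hx => (hoff x hx).1
  have hz0 : ∀ x ∉ cylinder h ω, z x = 0 := fun x hx => by
    simp only [hz, hv', Set.indicator_of_notMem hx]
    exact trunc_eq_zero hs (by simpa using hs.le)
  have hp0 : ∀ x ∉ cylinder h ω, ∀ i, cutoff h s (x 0) * pd i z x = 0 := fun x hx i =>
    mul_pd_eq_zero_off hK.isClosed hφ.continuous (fun x hx => (hoff x hx).1)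
      (fun hxK => hx (hKΩ hxK)) i
  have hpz : ∀ x ∈ cylinder h ω, ∀ i, pd i z x = truncDeriv s (v x) * pd i v x := fun x hx i =>
    pd_trunc_indicator hω.isOpen hv.contDiffOn hx i
  have e1 := ofReal_integral_eq_setLIntegral hΩ.measurableSet iE (fun x hx => by
    rcases eq_or_ne (cutoff h s (x 0)) 0 with hc | hc
    · simp [hc]
    · have : ∀ i, pd i z x = 0 := fun i => (mul_eq_zero.1 (hp0 x hx i)).resolve_left hc
      simp [this]) (fun x hx => mul_nonneg (sq_nonneg _) (mul_nonneg (hW0 x hx)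
        (Finset.sum_nonneg fun _ _ => sq_nonneg _)))
  have e2 := ofReal_integral_eq_setLIntegral hΩ.measurableSet iZ (fun x hx => by
    simp [hz0 x hx]) (fun x hx => mul_nonneg (abs_nonneg _) (mul_nonneg (hW0 x hx) (abs_nonneg _)))
  have e3 := ofReal_integral_eq_setLIntegral hΩ.measurableSet iE0 (fun x hx => by
    rcases mul_eq_zero.1 (hp0 x hx 0) with hc | hc <;> simp [hc])
    (fun x hx => mul_nonneg (sq_nonneg _) (mul_nonneg (hW0 x hx) (sq_nonneg _)))
  have hmain' : ∫ x, cutoff h s (x 0) ^ 2 * (W x * ∑ i, pd i z x ^ 2) ≤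
      2 * L / (l - θ) *
        (∫ x, |cutoff h s (x 0) * deriv (cutoff h s) (x 0)| * (W x * |z x * pd 0 z x|))
      + κ / (l - θ) * ∫ x, cutoff h s (x 0) ^ 2 * (W x * pd 0 z x ^ 2) := by
    rw [div_mul_eq_mul_div, div_mul_eq_mul_div, ← add_div, le_div_iff₀ hγ]
    linarith
  have hzle : ∀ x ∈ cylinder h ω, |z x| ≤ |v x| := fun x hx => by
    simpa [hz, hcongr x hx] using abs_trunc_le s (v x)
  have hple : ∀ x ∈ cylinder h ω, |pd 0 z x| ≤ |pd 0 v x| := fun x hx => by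
    rw [hpz x hx, abs_mul, abs_of_nonneg (truncDeriv_nonneg _ _)]
    exact mul_le_of_le_one_left (abs_nonneg _) (truncDeriv_le_one _ _)
  have b1 : ∫⁻ x in cylinder h ω, ENNReal.ofReal
      (|cutoff h s (x 0) * deriv (cutoff h s) (x 0)| * (W x * |z x * pd 0 z x|)) ≤
      ENNReal.ofReal h * ∫⁻ x in cylinder h ω, ENNReal.ofReal (W x * |v x * pd 0 v x|) := by
    rw [← lintegral_const_mul' _ _ ENNReal.ofReal_ne_top]
    refine setLIntegral_mono' hΩ.measurableSet fun x hx => ?_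
    rw [← ENNReal.ofReal_mul hh.le]
    refine ENNReal.ofReal_le_ofReal ?_
    have h1 : |cutoff h s (x 0) * deriv (cutoff h s) (x 0)| ≤ h := by
      rw [abs_mul]
      calc _ ≤ h * 1 := mul_le_mul (abs_cutoff_le hx.1) (abs_deriv_cutoff_le hx.1) (abs_nonneg _)
            hh.le
        _ = h := mul_one h
    have h2 : |z x * pd 0 z x| ≤ |v x * pd 0 v x| := by
      rw [abs_mul, abs_mul]
      exact mul_le_mul (hzle x hx) (hple x hx) (abs_nonneg _) (abs_nonneg _)
    have h3 := hW0 x hx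
    gcongr
  have b2 : ∫⁻ x in cylinder h ω, ENNReal.ofReal
      (cutoff h s (x 0) ^ 2 * (W x * pd 0 z x ^ 2)) ≤
      ENNReal.ofReal (h ^ 2) * ∫⁻ x in cylinder h ω, ENNReal.ofReal (W x * pd 0 v x ^ 2) := by
    rw [← lintegral_const_mul' _ _ ENNReal.ofReal_ne_top]
    refine setLIntegral_mono' hΩ.measurableSet fun x hx => ?_
    rw [← ENNReal.ofReal_mul (sq_nonneg h)]
    refine ENNReal.ofReal_le_ofReal ?_
    have h1 : cutoff h s (x 0) ^ 2 ≤ h ^ 2 := by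
      rw [sq_le_sq, abs_of_pos hh]
      exact abs_cutoff_le hx.1
    have h2 : pd 0 z x ^ 2 ≤ pd 0 v x ^ 2 := sq_le_sq.2 (hple x hx)
    have h3 := hW0 x hx
    gcongr
  calc ∫⁻ x in cylinder h ω, ENNReal.ofReal (trunc s (bump h (x 0)) ^ 2 *
        (W x * ∑ i, (truncDeriv s (v x) * pd i v x) ^ 2))
      = ∫⁻ x in cylinder h ω, ENNReal.ofReal (cutoff h s (x 0) ^ 2 *
        (W x * ∑ i, pd i z x ^ 2)) := by
        refine setLIntegral_congr_fun hΩ.measurableSet fun x hx => ?_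
        simp only [hpz x hx, cutoff]
    _ = ENNReal.ofReal (∫ x, cutoff h s (x 0) ^ 2 * (W x * ∑ i, pd i z x ^ 2)) := e1.symm
    _ ≤ _ := ENNReal.ofReal_le_ofReal hmain'
    _ ≤ _ := ENNReal.ofReal_add_le
    _ = ENNReal.ofReal (2 * L / (l - θ)) * (∫⁻ x in cylinder h ω, ENNReal.ofReal
          (|cutoff h s (x 0) * deriv (cutoff h s) (x 0)| * (W x * |z x * pd 0 z x|))) +
        ENNReal.ofReal (κ / (l - θ)) * ∫⁻ x in cylinder h ω, ENNReal.ofReal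
          (cutoff h s (x 0) ^ 2 * (W x * pd 0 z x ^ 2)) := by
        rw [ENNReal.ofReal_mul (by positivity), ENNReal.ofReal_mul (by positivity), e2, e3]
    _ ≤ ENNReal.ofReal (2 * L / (l - θ)) * (ENNReal.ofReal h *
          ∫⁻ x in cylinder h ω, ENNReal.ofReal (W x * |v x * pd 0 v x|)) +
        ENNReal.ofReal (κ / (l - θ)) * (ENNReal.ofReal (h ^ 2) *
          ∫⁻ x in cylinder h ω, ENNReal.ofReal (W x * pd 0 v x ^ 2)) := by
        gcongr
    _ = _ := by
        rw [← mul_assoc, ← mul_assoc, ← ENNReal.ofReal_mul (by positivity),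
          ← ENNReal.ofReal_mul (by positivity)]
        congr 3 <;> ring_nf

end SolutionEnergy

/-! ### The Caccioppoli inequality for the x₁-derivative. -/

section DifferenceQuotients

variable {m : ℕ} {ω : Set (Eucl m)}

/-- The first unit vector. -/
def e₀ (m : ℕ) : Eucl (m + 1) := EuclideanSpace.single 0 1

/-- The difference quotient in the direction `x₁`. -/
def diffQuot (τ : ℝ) (u : Eucl (m + 1) → ℝ) (x : Eucl (m + 1)) : ℝ :=
  (u (x + τ • e₀ m) - u x) / τ

@[simp] lemma tail_add_smul_e₀ (x : Eucl (m + 1)) (t : ℝ) : tail (x + t • e₀ m) = tail x := by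
  ext i; simp [tail, e₀]

@[simp] lemma add_smul_e₀_zero (x : Eucl (m + 1)) (t : ℝ) : (x + t • e₀ m) 0 = x 0 + t := by
  simp [e₀]

lemma add_smul_e₀_mem {h τ t : ℝ} {S : Set (Eucl m)} (ht : 0 ≤ t) (htτ : t ≤ τ)
    {x : Eucl (m + 1)} (hx : x ∈ cylinder (h - τ) S) : x + t • e₀ m ∈ cylinder h S := by
  refine ⟨?_, by simpa using hx.2⟩
  rw [add_smul_e₀_zero]
  exact ⟨by linarith [hx.1.1], by linarith [hx.1.2]⟩

lemma cylinder_sub_subset {h τ : ℝ} (hτ : 0 ≤ τ) (S : Set (Eucl m)) :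
    cylinder (h - τ) S ⊆ cylinder h S := fun x hx =>
  ⟨⟨hx.1.1, by linarith [hx.1.2]⟩, hx.2⟩

lemma pd_diffQuot {f : Eucl (m + 1) → ℝ} {x : Eucl (m + 1)} {τ : ℝ}
    (h1 : DifferentiableAt ℝ f (x + τ • e₀ m)) (h2 : DifferentiableAt ℝ f x) (i : Fin (m + 1)) :
    pd i (diffQuot τ f) x = diffQuot τ (pd i f) x := by
  have h3 : DifferentiableAt ℝ (fun y => f (y + τ • e₀ m)) x :=
    DifferentiableAt.comp (g := f) (f := fun y => y + τ • e₀ m) x h1 (by fun_prop)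
  have e : diffQuot τ f = fun y => τ⁻¹ * (f (y + τ • e₀ m) - f y) := by
    ext y; rw [diffQuot, div_eq_inv_mul]
  rw [e, pd, fderiv_const_mul (h3.fun_sub h2), fderiv_fun_sub h3 h2, fderiv_comp_add_right]
  simp only [diffQuot, pd]
  simp [div_eq_inv_mul]

/-- Constant coefficients and translation in x₁ preserve the equation and the lateral condition.
Unlike u_{x₁}, the quotient inherits C² regularity and continuity up to the boundary, on a cylinder
shortened by τ. -/
lemma IsSolution.diffQuot {h τ : ℝ} (hω : IsOpen ω) (hτ : 0 < τ)
    {A : Matrix (Fin (m + 1)) (Fin (m + 1)) ℝ} {u : Eucl (m + 1) → ℝ} (hu : IsSolution h ω A u) :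
    IsSolution (h - τ) ω A (diffQuot τ u) := by
  have hsub := cylinder_sub_subset (h := h) hτ.le ω
  have hmaps : Set.MapsTo (fun x => x + τ • e₀ m) (cylinder (h - τ) ω) (cylinder h ω) :=
    fun x hx => add_smul_e₀_mem hτ.le le_rfl hx
  have hΩ := isOpen_cylinder h hω
  have hΩ' := isOpen_cylinder (h - τ) hω
  have hc : ContDiffOn ℝ 2 (Separation.diffQuot τ u) (cylinder (h - τ) ω) := by
    have h1 : ContDiffOn ℝ 2 (fun x => u (x + τ • e₀ m)) (cylinder (h - τ) ω) :=
      hu.contDiffOn.comp (by fun_prop) hmaps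
    exact (h1.sub (hu.contDiffOn.mono hsub)).div_const τ
  refine ⟨hc, ?_, fun x hx => ?_, fun x hx => ?_⟩
  · have h1 : ContinuousOn (fun x => u (x + τ • e₀ m)) (closure (cylinder (h - τ) ω)) :=
      hu.continuousOn.comp (by fun_prop) (hmaps.closure (by fun_prop))
    exact (h1.sub (hu.continuousOn.mono (closure_mono hsub))).div_const τ
  · have hd : ∀ y ∈ cylinder h ω, DifferentiableAt ℝ u y := fun y hy =>
      (hu.contDiffOn.contDiffAt (hΩ.mem_nhds hy)).differentiableAt two_ne_zero
    have hd' : ∀ j, ∀ y ∈ cylinder h ω, DifferentiableAt ℝ (pd j u) y := fun j y hy =>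
      ((ContDiffOn.pd hΩ hu.contDiffOn j).contDiffAt (hΩ.mem_nhds hy)).differentiableAt one_ne_zero
    have hpp : ∀ i j, pd i (pd j (Separation.diffQuot τ u)) x
        = (pd i (pd j u) (x + τ • e₀ m) - pd i (pd j u) x) / τ := by
      intro i j
      have h1 : pd j (Separation.diffQuot τ u) =ᶠ[nhds x] Separation.diffQuot τ (pd j u) := by
        filter_upwards [hΩ'.mem_nhds hx] with y hy
        exact pd_diffQuot (hd _ (hmaps hy)) (hd _ (hsub hy)) j
      rw [pd_congr h1]
      exact pd_diffQuot (hd' j _ (hmaps hx)) (hd' j _ (hsub hx)) i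
    have e1 := hu.equation _ (hmaps hx)
    have e2 := hu.equation _ (hsub hx)
    rw [ellipticOp_eq_sum hΩ hu.contDiffOn (hmaps hx)] at e1
    rw [ellipticOp_eq_sum hΩ hu.contDiffOn (hsub hx)] at e2
    rw [ellipticOp_eq_sum hΩ' hc hx]
    simp only [hpp, mul_div_assoc', mul_sub, ← Finset.sum_div, Finset.sum_sub_distrib, e1, e2]
    simp
  · have h1 := hu.boundary _ (add_smul_e₀_mem hτ.le le_rfl hx)
    have h2 := hu.boundary x (cylinder_sub_subset hτ.le _ hx)
    simp [Separation.diffQuot, h1, h2]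

lemma sq_intervalIntegral_le {f : ℝ → ℝ} (hf : ContinuousOn f (Set.Icc 0 1)) :
    (∫ t in (0 : ℝ)..1, f t) ^ 2 ≤ ∫ t in (0 : ℝ)..1, f t ^ 2 := by
  have hu : Set.uIcc (0 : ℝ) 1 = Set.Icc 0 1 := Set.uIcc_of_le zero_le_one
  set c := ∫ t in (0 : ℝ)..1, f t with hc
  have i1 : IntervalIntegrable f volume 0 1 := (hu ▸ hf).intervalIntegrable
  have i2 : IntervalIntegrable (fun t => f t ^ 2) volume 0 1 :=
    (hu ▸ hf.pow 2 : ContinuousOn (fun t => f t ^ 2) (Set.uIcc 0 1)).intervalIntegrable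
  -- The variance is nonnegative.
  have h1 : 0 ≤ ∫ t in (0 : ℝ)..1, (f t - c) ^ 2 :=
    intervalIntegral.integral_nonneg zero_le_one fun _ _ => sq_nonneg _
  have h2 : ∫ t in (0 : ℝ)..1, (f t - c) ^ 2
      = (∫ t in (0 : ℝ)..1, f t ^ 2) - 2 * c * c + c ^ 2 := by
    have e : ∀ t, (f t - c) ^ 2 = f t ^ 2 - 2 * c * f t + c ^ 2 := fun t => by ring
    simp only [e]
    rw [intervalIntegral.integral_add (i2.sub (i1.const_mul (2 * c))) intervalIntegrable_const,
      intervalIntegral.integral_sub i2 (i1.const_mul (2 * c)),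
      intervalIntegral.integral_const_mul]
    simp [hc]
  nlinarith

/-- The quotient is the mean of u_{x₁} over a segment of length τ, and the square of a mean is at
most the mean of the squares. -/
lemma ofReal_diffQuot_sq_le {h τ : ℝ} (hω : IsOpen ω) (hτ : 0 < τ)
    {u : Eucl (m + 1) → ℝ} (hu : ContDiffOn ℝ 2 u (cylinder h ω)) {x : Eucl (m + 1)}
    (hx : x ∈ cylinder (h - τ) ω) :
    ENNReal.ofReal (diffQuot τ u x ^ 2) ≤
      ∫⁻ r in Set.Icc (0 : ℝ) 1, ENNReal.ofReal (pd 0 u (x + (r * τ) • e₀ m) ^ 2) := by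
  have hΩ := isOpen_cylinder h hω
  have hmem : ∀ r ∈ Set.Icc (0 : ℝ) 1, x + (r * τ) • e₀ m ∈ cylinder h ω := fun r hr =>
    add_smul_e₀_mem (by have := hr.1; positivity) (by nlinarith [hr.2]) hx
  have hline : Continuous fun r : ℝ => x + (r * τ) • e₀ m := by fun_prop
  have hcont : ContinuousOn (fun r : ℝ => pd 0 u (x + (r * τ) • e₀ m)) (Set.Icc 0 1) :=
    (ContDiffOn.pd hΩ hu 0).continuousOn.comp hline.continuousOn hmem
  have hu01 : Set.uIcc (0 : ℝ) 1 = Set.Icc 0 1 := Set.uIcc_of_le zero_le_one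
  have hder : ∀ r ∈ Set.uIcc (0 : ℝ) 1, HasDerivAt (fun r : ℝ => u (x + (r * τ) • e₀ m) / τ)
      (pd 0 u (x + (r * τ) • e₀ m)) r := by
    intro r hr
    rw [hu01] at hr
    have h1 : HasFDerivAt u (fderiv ℝ u (x + (r * τ) • e₀ m)) (x + (r * τ) • e₀ m) :=
      ((hu.contDiffAt (hΩ.mem_nhds (hmem r hr))).differentiableAt two_ne_zero).hasFDerivAt
    have h2 : HasDerivAt (fun r : ℝ => x + (r * τ) • e₀ m) (τ • e₀ m) r := by
      have := (((hasDerivAt_id r).mul_const τ).smul_const (e₀ m)).const_add x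
      simpa using this
    have h3 := (h1.comp_hasDerivAt r h2).div_const τ
    refine h3.congr_deriv ?_
    rw [map_smul, smul_eq_mul, mul_div_cancel_left₀ _ hτ.ne']
    rfl
  have hftc := intervalIntegral.integral_eq_sub_of_hasDerivAt hder
    ((hu01 ▸ hcont).intervalIntegrable)
  have e : diffQuot τ u x = ∫ r in (0 : ℝ)..1, pd 0 u (x + (r * τ) • e₀ m) := by
    rw [hftc, diffQuot]; simp; ring
  rw [e]
  refine (ENNReal.ofReal_le_ofReal (sq_intervalIntegral_le hcont)).trans (le_of_eq ?_)
  rw [intervalIntegral.integral_of_le zero_le_one, ← integral_Icc_eq_integral_Ioc,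
    ofReal_integral_eq_lintegral_ofReal]
  · exact (hcont.pow 2).integrableOn_Icc
  · exact Filter.Eventually.of_forall fun _ => sq_nonneg _

lemma measurable_indicator_ofReal {Ω : Set (Eucl (m + 1))} (hΩ : IsOpen Ω)
    {f : Eucl (m + 1) → ℝ} (hf : ContinuousOn f Ω) :
    Measurable (Ω.indicator fun x => ENNReal.ofReal (f x)) := by
  classical
  have h1 : ContinuousOn (fun x => ENNReal.ofReal (f x)) Ω :=
    ENNReal.continuous_ofReal.comp_continuousOn hf
  have := ContinuousOn.measurable_piecewise h1
    (continuous_zero : Continuous (0 : Eucl (m + 1) → ENNReal)).continuousOn hΩ.measurableSet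
  rwa [Set.piecewise_eq_indicator] at this

/-- The weighted norm of a difference quotient is bounded by that of the derivative. -/
lemma lintegral_diffQuot_le {h τ : ℝ} (hω : IsOpen ω) (hτ : 0 < τ)
    {u W : Eucl (m + 1) → ℝ} (hu : ContDiffOn ℝ 2 u (cylinder h ω))
    (hW : ContinuousOn W (cylinder h ω)) (hW0 : ∀ x, 0 ≤ W x)
    (hWinv : ∀ (x : Eucl (m + 1)) (t : ℝ), W (x + t • e₀ m) = W x) :
    ∫⁻ x in cylinder (h - τ) ω, ENNReal.ofReal (W x * diffQuot τ u x ^ 2) ≤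
      ∫⁻ x in cylinder h ω, ENNReal.ofReal (W x * pd 0 u x ^ 2) := by
  have hΩ := isOpen_cylinder h hω
  have hΩ' := isOpen_cylinder (h - τ) hω
  set G : Eucl (m + 1) → ENNReal :=
    (cylinder h ω).indicator fun x => ENNReal.ofReal (W x * pd 0 u x ^ 2) with hG
  have hGm : Measurable G := measurable_indicator_ofReal hΩ
    (hW.mul ((ContDiffOn.pd hΩ hu 0).continuousOn.pow 2))
  have hjoint : Measurable (Function.uncurry fun (x : Eucl (m + 1)) (r : ℝ) =>
      G (x + (r * τ) • e₀ m)) := by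
    refine hGm.comp ?_
    have : Continuous fun q : Eucl (m + 1) × ℝ => q.1 + (q.2 * τ) • e₀ m := by fun_prop
    exact this.measurable
  calc ∫⁻ x in cylinder (h - τ) ω, ENNReal.ofReal (W x * diffQuot τ u x ^ 2)
      ≤ ∫⁻ x in cylinder (h - τ) ω, ∫⁻ r in Set.Icc (0 : ℝ) 1, G (x + (r * τ) • e₀ m) := by
        refine setLIntegral_mono' hΩ'.measurableSet fun x hx => ?_
        rw [ENNReal.ofReal_mul (hW0 x)]
        refine (mul_le_mul' le_rfl (ofReal_diffQuot_sq_le hω hτ hu hx)).trans ?_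
        rw [← lintegral_const_mul' _ _ ENNReal.ofReal_ne_top]
        refine setLIntegral_mono' measurableSet_Icc fun r hr => ?_
        have hmem : x + (r * τ) • e₀ m ∈ cylinder h ω :=
          add_smul_e₀_mem (by have := hr.1; positivity) (by nlinarith [hr.2]) hx
        rw [hG, Set.indicator_of_mem hmem, hWinv, ENNReal.ofReal_mul (hW0 x)]
    _ ≤ ∫⁻ x, ∫⁻ r in Set.Icc (0 : ℝ) 1, G (x + (r * τ) • e₀ m) := setLIntegral_le_lintegral _ _
    _ = ∫⁻ r in Set.Icc (0 : ℝ) 1, ∫⁻ x, G (x + (r * τ) • e₀ m) :=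
        lintegral_lintegral_swap hjoint.aemeasurable
    -- Translation invariance of Lebesgue measure; the weight was already moved to the shifted point
    -- because it is independent of x₁.
    _ = ∫⁻ r in Set.Icc (0 : ℝ) 1, ∫⁻ x, G x := by
        simp only [lintegral_add_right_eq_self]
    _ = ∫⁻ x in cylinder h ω, ENNReal.ofReal (W x * pd 0 u x ^ 2) := by
        simp [hG, lintegral_indicator hΩ.measurableSet]

lemma tendsto_diffQuot {f : Eucl (m + 1) → ℝ} {x : Eucl (m + 1)} (hf : DifferentiableAt ℝ f x) :
    Filter.Tendsto (fun τ => diffQuot τ f x) (nhdsWithin 0 {0}ᶜ) (nhds (pd 0 f x)) := by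
  have h1 : HasDerivAt (fun τ : ℝ => f (x + τ • e₀ m)) (pd 0 f x) 0 :=
    hf.hasFDerivAt.hasLineDerivAt (e₀ m)
  rw [hasDerivAt_iff_tendsto_slope_zero] at h1
  refine h1.congr fun τ => ?_
  simp [Separation.diffQuot, div_eq_inv_mul]

variable {h : ℝ} {A : Matrix (Fin (m + 1)) (Fin (m + 1)) ℝ} {u W : Eucl (m + 1) → ℝ}
  {l L θ : ℝ}

/-- Weighted Caccioppoli inequality for the derivative `∂u/∂x₁` of a solution. -/
theorem IsSolution.caccioppoli_deriv (hh : 0 < h) (hω : IsLipschitzDomain ω)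
    (hu : IsSolution h ω A u)
    (hA : EllipticBounds A l L) (hl : 0 < l) (hlL : l ≤ L) (hθ : θ < l)
    (hW : ∀ a, ContDiffOn ℝ 1 W (cylinder a ω)) (hW0 : ∀ x, 0 ≤ W x)
    (hWinv : ∀ (x : Eucl (m + 1)) (t : ℝ), W (x + t • e₀ m) = W x)
    (hB : ∀ a, WeightBound (cylinder a ω) W (symPart A) θ 0) :
    ∫⁻ x in cylinder h ω,
        ENNReal.ofReal (bump h (x 0) ^ 2 * (W x * ∑ i, pd 0 (pd i u) x ^ 2)) ≤
      ENNReal.ofReal (4 * L ^ 2 / (l - θ) ^ 2) *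
        ∫⁻ x in cylinder h ω, ENNReal.ofReal (W x * pd 0 u x ^ 2) := by
  have hΩ := isOpen_cylinder h hω.isOpen
  -- The shift h / (n + 2) is strictly less than `h` also for n = 0, so every shortened cylinder has
  -- positive length.
  set τ : ℕ → ℝ := fun n => h * (1 / ((n : ℝ) + 1 + 1)) with hτdef
  have hτ0 : ∀ n, 0 < τ n := fun n => by positivity
  have hτh : ∀ n, τ n < h := fun n => by
    have h1 : 1 / ((n : ℝ) + 1 + 1) < 1 := by
      rw [div_lt_one (by positivity)]
      have : (0 : ℝ) ≤ n := n.cast_nonneg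
      linarith
    calc τ n < h * 1 := mul_lt_mul_of_pos_left h1 hh
      _ = h := mul_one h
  have hτt : Filter.Tendsto τ Filter.atTop (nhds 0) := by
    have h1 := (tendsto_one_div_add_atTop_nhds_zero_nat (𝕜 := ℝ)).comp
      (Filter.tendsto_add_atTop_nat 1)
    have h2 := h1.const_mul h
    rw [mul_zero] at h2
    refine h2.congr fun n => ?_
    simp [hτdef]
  have hτt' : Filter.Tendsto τ Filter.atTop (nhdsWithin 0 {0}ᶜ) :=
    tendsto_nhdsWithin_iff.2 ⟨hτt, Filter.Eventually.of_forall fun n => (hτ0 n).ne'⟩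
  set F : ℕ → Eucl (m + 1) → ENNReal := fun n => (cylinder (h - τ n) ω).indicator fun x =>
    ENNReal.ofReal (bump (h - τ n) (x 0) ^ 2 *
      (W x * ∑ i, pd i (Separation.diffQuot (τ n) u) x ^ 2)) with hF
  have hFm : ∀ n, Measurable (F n) := by
    intro n
    have hΩ' := isOpen_cylinder (h - τ n) hω.isOpen
    refine measurable_indicator_ofReal hΩ' ?_
    have h1 : Continuous fun x : Eucl (m + 1) => bump (h - τ n) (x 0) :=
      (contDiff_bump _ (n := 0)).continuous.comp (by fun_prop)
    exact (h1.pow 2).continuousOn.mul ((hW _).continuousOn.mul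
      (continuousOn_finsetSum _ fun i _ => (ContDiffOn.pd hΩ'
        (IsSolution.diffQuot hω.isOpen (hτ0 n) hu).contDiffOn i).continuousOn.pow 2))
  have hlim : ∀ x ∈ cylinder h ω, Filter.liminf (fun n => F n x) Filter.atTop
      = ENNReal.ofReal (bump h (x 0) ^ 2 * (W x * ∑ i, pd 0 (pd i u) x ^ 2)) := by
    intro x hx
    apply Filter.Tendsto.liminf_eq
    have hev : ∀ᶠ n in Filter.atTop, x ∈ cylinder (h - τ n) ω := by
      have h1 : Filter.Tendsto (fun n => h - τ n) Filter.atTop (nhds (h - 0)) := hτt.const_sub h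
      rw [sub_zero] at h1
      filter_upwards [h1.eventually (lt_mem_nhds hx.1.2)] with n hn
      exact ⟨⟨hx.1.1, hn⟩, hx.2⟩
    have hd : ∀ y ∈ cylinder h ω, DifferentiableAt ℝ u y := fun y hy =>
      (hu.contDiffOn.contDiffAt (hΩ.mem_nhds hy)).differentiableAt two_ne_zero
    have hd' : ∀ j, DifferentiableAt ℝ (pd j u) x := fun j =>
      ((ContDiffOn.pd hΩ hu.contDiffOn j).contDiffAt (hΩ.mem_nhds hx)).differentiableAt one_ne_zero
    have hb : Filter.Tendsto (fun n => bump (h - τ n) (x 0)) Filter.atTop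
        (nhds (bump h (x 0))) := by
      have h1 : ContinuousAt (fun a : ℝ => bump (h - a) (x 0)) 0 := by
        unfold bump
        exact ContinuousAt.div (by fun_prop) (by fun_prop) (by simpa using hh.ne')
      simpa [Function.comp_def] using h1.tendsto.comp hτt
    have hmain : Filter.Tendsto (fun n => ENNReal.ofReal (bump (h - τ n) (x 0) ^ 2 *
        (W x * ∑ i, Separation.diffQuot (τ n) (pd i u) x ^ 2))) Filter.atTop
        (nhds (ENNReal.ofReal (bump h (x 0) ^ 2 * (W x * ∑ i, pd 0 (pd i u) x ^ 2)))) := by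
      refine (ENNReal.continuous_ofReal.tendsto _).comp ((hb.pow 2).mul
        (tendsto_const_nhds.mul (tendsto_finsetSum _ fun i _ => ?_)))
      exact ((tendsto_diffQuot (hd' i)).comp hτt').pow 2
    refine hmain.congr' ?_
    filter_upwards [hev] with n hn
    simp only [hF, Set.indicator_of_mem hn]
    have : ∀ i, pd i (Separation.diffQuot (τ n) u) x =
        Separation.diffQuot (τ n) (pd i u) x := fun i =>
      pd_diffQuot (hd _ (add_smul_e₀_mem (hτ0 n).le le_rfl hn)) (hd _ hx) i
    simp only [this]
  calc ∫⁻ x in cylinder h ω,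
        ENNReal.ofReal (bump h (x 0) ^ 2 * (W x * ∑ i, pd 0 (pd i u) x ^ 2))
      = ∫⁻ x in cylinder h ω, Filter.liminf (fun n => F n x) Filter.atTop :=
        (setLIntegral_congr_fun hΩ.measurableSet hlim).symm
    _ ≤ Filter.liminf (fun n => ∫⁻ x in cylinder h ω, F n x) Filter.atTop :=
        lintegral_liminf_le hFm
    _ ≤ _ := by
        refine Filter.liminf_le_of_frequently_le' (Filter.Frequently.of_forall fun n => ?_)
        have hpos : 0 < h - τ n := sub_pos.2 (hτh n)
        calc ∫⁻ x in cylinder h ω, F n x ≤ ∫⁻ x, F n x := setLIntegral_le_lintegral _ _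
          _ = ∫⁻ x in cylinder (h - τ n) ω, ENNReal.ofReal (bump (h - τ n) (x 0) ^ 2 *
              (W x * ∑ i, pd i (Separation.diffQuot (τ n) u) x ^ 2)) :=
            lintegral_indicator (isOpen_cylinder _ hω.isOpen).measurableSet _
          _ ≤ ENNReal.ofReal (4 * L ^ 2 / (l - θ) ^ 2) * ∫⁻ x in cylinder (h - τ n) ω,
              ENNReal.ofReal (W x * Separation.diffQuot (τ n) u x ^ 2) :=
            IsSolution.caccioppoli hpos hω (IsSolution.diffQuot hω.isOpen (hτ0 n) hu) hA hl hlL hθ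
              (hW _) (fun x _ => hW0 x) (hB _)
          _ ≤ _ := mul_le_mul' le_rfl
            (lintegral_diffQuot_le hω.isOpen (hτ0 n) hu.contDiffOn (hW _).continuousOn hW0 hWinv)

end DifferenceQuotients

/-! ### A one-dimensional inequality without boundary conditions. -/

section OneDimensional

variable {ι : Type*} [Fintype ι] {h : ℝ} {f f' : ι → ℝ → ℝ}

/-- With d = `bump h`, d'² + d d'' = 1 - 6 d / h. For x = f and y = f' the first bracket is thus the
derivative of d d' f², and the lemma is the pointwise form of the integral inequality. -/
lemma le_deriv_bump_mul (hh : 0 < h) (t x y : ℝ) :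
    x ^ 2 ≤ 4 * ((1 - 6 * bump h t / h) * x ^ 2 + bump h t * ((h - 2 * t) / h) * (2 * x * y)) +
      bump h t ^ 2 * (72 / h ^ 2 * x ^ 2 + 16 * y ^ 2) := by
  set d := bump h t with hd
  set d' := (h - 2 * t) / h with hd'
  set s := d / h with hs
  have h1 : d' ^ 2 = 1 - 4 * s := by
    rw [hs, hd, hd', bump]; field_simp; ring
  have h2 : d ^ 2 * (72 / h ^ 2 * x ^ 2 + 16 * y ^ 2) = 72 * s ^ 2 * x ^ 2 + 16 * (d * y) ^ 2 := by
    rw [hs]; field_simp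
  have h3 : 6 * d / h = 6 * s := by rw [hs]; ring
  have h4 : 0 ≤ (d' * x + 4 * (d * y)) ^ 2 := sq_nonneg _
  -- The constant 72 is large enough to make this quadratic in `s` positive definite: 20² < 4 · 2 ·
  -- 72.
  have h5 : 0 ≤ (2 - 20 * s + 72 * s ^ 2) * x ^ 2 :=
    mul_nonneg (by nlinarith [sq_nonneg (s * 6 - 5 / 6)]) (sq_nonneg x)
  have h6 : (d' * x + 4 * (d * y)) ^ 2
      = (1 - 4 * s) * x ^ 2 + 8 * d' * x * (d * y) + 16 * (d * y) ^ 2 := by rw [← h1]; ring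
  rw [h2, h3]
  rw [h6] at h4
  nlinarith

/-- A one-dimensional inequality with the distance-like weight `bump h`. -/
lemma lintegral_sum_sq_le (hh : 0 < h) (hf : ∀ i, ∀ t ∈ Set.Ioo 0 h, HasDerivAt (f i) (f' i t) t)
    (hf' : ∀ i, ContinuousOn (f' i) (Set.Ioo 0 h)) :
    ∫⁻ t in Set.Ioo 0 h, ENNReal.ofReal (∑ i, f i t ^ 2) ≤
      ∫⁻ t in Set.Ioo 0 h, ENNReal.ofReal
        (bump h t ^ 2 * (72 / h ^ 2 * ∑ i, f i t ^ 2 + 16 * ∑ i, f' i t ^ 2)) := by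
  set R : ℝ → ℝ := fun t => bump h t ^ 2 * (72 / h ^ 2 * ∑ i, f i t ^ 2 + 16 * ∑ i, f' i t ^ 2)
    with hR
  have hfc : ∀ i, ContinuousOn (f i) (Set.Ioo 0 h) := fun i t ht =>
    (hf i t ht).continuousAt.continuousWithinAt
  have hb : Continuous (bump h) := (contDiff_bump h (n := 0)).continuous
  have hQc : ContinuousOn (fun t => ∑ i, f i t ^ 2) (Set.Ioo 0 h) :=
    continuousOn_finsetSum _ fun i _ => (hfc i).pow 2
  have hRc : ContinuousOn R (Set.Ioo 0 h) := (hb.pow 2).continuousOn.mul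
    ((hQc.const_smul (72 / h ^ 2)).add
      ((continuousOn_finsetSum _ fun i _ => (hf' i).pow 2 :
        ContinuousOn (fun t => ∑ i, f' i t ^ 2) (Set.Ioo 0 h)).const_smul (16 : ℝ)))
  have hR0 : ∀ t, 0 ≤ R t := fun t => by positivity
  have key : ∀ ε : ℝ, 0 < ε → ε < h / 2 →
      ∫⁻ t in Set.Icc ε (h - ε), ENNReal.ofReal (∑ i, f i t ^ 2) ≤
        ∫⁻ t in Set.Ioo 0 h, ENNReal.ofReal (R t) := by
    intro ε hε hε2
    have hle : ε ≤ h - ε := by linarith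
    have hsub : Set.Icc ε (h - ε) ⊆ Set.Ioo 0 h := fun t ht =>
      ⟨by linarith [ht.1], by linarith [ht.2]⟩
    have hu : Set.uIcc ε (h - ε) = Set.Icc ε (h - ε) := Set.uIcc_of_le hle
    set G : ℝ → ℝ := fun t => bump h t * ((h - 2 * t) / h) * ∑ i, f i t ^ 2 with hG
    set G' : ℝ → ℝ := fun t => (1 - 6 * bump h t / h) * (∑ i, f i t ^ 2) +
      bump h t * ((h - 2 * t) / h) * ∑ i, 2 * f i t * f' i t with hG'
    have hder : ∀ t ∈ Set.uIcc ε (h - ε), HasDerivAt G (G' t) t := by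
      intro t ht
      have ht' := hsub (hu ▸ ht)
      have h1 : HasDerivAt (fun t : ℝ => (h - 2 * t) / h) (-2 / h) t := by
        have := (((hasDerivAt_id t).const_mul 2).const_sub h).div_const h
        simpa using this
      have h2 : HasDerivAt (fun t => ∑ i, f i t ^ 2) (∑ i, 2 * f i t * f' i t) t := by
        refine HasDerivAt.fun_sum fun i _ => ?_
        simpa using (hf i t ht').fun_pow 2
      refine (((hasDerivAt_bump h t).mul h1).mul h2).congr_deriv ?_
      simp only [hG', Pi.mul_apply]
      congr 2
      unfold bump
      field_simp
      ring
    have hG'c : ContinuousOn G' (Set.Icc ε (h - ε)) := by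
      have h1 : Continuous fun t : ℝ => (h - 2 * t) / h := by fun_prop
      have h2 : Continuous fun t : ℝ => 1 - 6 * bump h t / h := by fun_prop
      exact ((h2.continuousOn.mul hQc).add ((hb.mul h1).continuousOn.mul
        (continuousOn_finsetSum _ fun i _ => (continuousOn_const.mul (hfc i)).mul (hf' i)))).mono
          hsub
    have iG : IntervalIntegrable G' volume ε (h - ε) := (hu ▸ hG'c).intervalIntegrable
    have iQ : IntervalIntegrable (fun t => ∑ i, f i t ^ 2) volume ε (h - ε) :=
      (hu ▸ hQc.mono hsub : ContinuousOn _ (Set.uIcc ε (h - ε))).intervalIntegrable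
    have iR : IntervalIntegrable R volume ε (h - ε) :=
      (hu ▸ hRc.mono hsub : ContinuousOn _ (Set.uIcc ε (h - ε))).intervalIntegrable
    -- d' is nonnegative at the left end and nonpositive at the right end, so both boundary terms
    -- have the good sign whatever the values of the f_i.
    have hGle : ∫ t in ε..(h - ε), G' t ≤ 0 := by
      rw [intervalIntegral.integral_eq_sub_of_hasDerivAt hder iG]
      have h1 : G (h - ε) ≤ 0 := by
        refine mul_nonpos_of_nonpos_of_nonneg (mul_nonpos_of_nonneg_of_nonpos
          (bump_pos (hsub ⟨hle, le_rfl⟩)).le ?_) (Finset.sum_nonneg fun _ _ => sq_nonneg _)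
        exact div_nonpos_of_nonpos_of_nonneg (by linarith) hh.le
      have h2 : 0 ≤ G ε := by
        refine mul_nonneg (mul_nonneg (bump_pos (hsub ⟨le_rfl, hle⟩)).le ?_)
          (Finset.sum_nonneg fun _ _ => sq_nonneg _)
        exact div_nonneg (by linarith) hh.le
      linarith
    have hpt : ∀ t, ∑ i, f i t ^ 2 ≤ 4 * G' t + R t := by
      intro t
      refine (Finset.sum_le_sum fun i _ => le_deriv_bump_mul hh t (f i t) (f' i t)).trans
        (le_of_eq ?_)
      simp only [hG', hR, Finset.sum_add_distrib, ← Finset.mul_sum]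
    have hintegral : ∫ t in ε..(h - ε), ∑ i, f i t ^ 2 ≤ ∫ t in ε..(h - ε), R t := by
      have h1 := intervalIntegral.integral_mono_on hle iQ ((iG.const_mul 4).add iR)
        fun t _ => hpt t
      rw [intervalIntegral.integral_add (iG.const_mul 4) iR,
        intervalIntegral.integral_const_mul] at h1
      linarith
    have conv : ∀ g : ℝ → ℝ, ContinuousOn g (Set.Icc ε (h - ε)) → (∀ t, 0 ≤ g t) →
        ∫⁻ t in Set.Icc ε (h - ε), ENNReal.ofReal (g t)
          = ENNReal.ofReal (∫ t in ε..(h - ε), g t) := by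
      intro g hg hg0
      rw [intervalIntegral.integral_of_le hle, ← integral_Icc_eq_integral_Ioc,
        ofReal_integral_eq_lintegral_ofReal hg.integrableOn_Icc
          (Filter.Eventually.of_forall hg0)]
    calc ∫⁻ t in Set.Icc ε (h - ε), ENNReal.ofReal (∑ i, f i t ^ 2)
        = ENNReal.ofReal (∫ t in ε..(h - ε), ∑ i, f i t ^ 2) :=
          conv _ (hQc.mono hsub) fun t => Finset.sum_nonneg fun _ _ => sq_nonneg _
      _ ≤ ENNReal.ofReal (∫ t in ε..(h - ε), R t) := ENNReal.ofReal_le_ofReal hintegral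
      _ = ∫⁻ t in Set.Icc ε (h - ε), ENNReal.ofReal (R t) := (conv _ (hRc.mono hsub) hR0).symm
      _ ≤ _ := lintegral_mono_set hsub
  set ε : ℕ → ℝ := fun n => h / 4 * (1 / ((n : ℝ) + 1)) with hε
  have hεt : Filter.Tendsto ε Filter.atTop (nhds 0) := by
    simpa [hε] using (tendsto_one_div_add_atTop_nhds_zero_nat (𝕜 := ℝ)).const_mul (h / 4)
  have hcover : AECover (volume.restrict (Set.Ioo 0 h)) Filter.atTop
      fun n => Set.Icc (ε n) (h - ε n) := by
    refine aecover_Ioo_of_Icc hεt ?_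
    simpa using hεt.const_sub h
  have hmeas : AEMeasurable (fun t => ENNReal.ofReal (∑ i, f i t ^ 2))
      (volume.restrict (Set.Ioo 0 h)) :=
    (hQc.aemeasurable measurableSet_Ioo).ennreal_ofReal
  refine le_of_tendsto (hcover.lintegral_tendsto_of_countably_generated hmeas)
    (Filter.Eventually.of_forall fun n => ?_)
  rw [Measure.restrict_restrict measurableSet_Icc]
  refine (lintegral_mono_set Set.inter_subset_left).trans (key _ (by positivity) ?_)
  have h1 : 1 / ((n : ℝ) + 1) ≤ 1 := by
    rw [div_le_one (by positivity)]
    have : (0 : ℝ) ≤ n := n.cast_nonneg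
    linarith
  have h2 : ε n ≤ h / 4 * 1 := mul_le_mul_of_nonneg_left h1 (by positivity)
  linarith

end OneDimensional

/-! ### Fubini along lines parallel to the x₁-axis. -/

section Slices

variable {m : ℕ} {ω : Set (Eucl m)}

/-- The point `(t, y)` of `ℝ^{m+1}`. -/
def consPt (t : ℝ) (y : Fin m → ℝ) : Eucl (m + 1) := WithLp.toLp 2 (Fin.cons t y)

@[simp] lemma consPt_zero (t : ℝ) (y : Fin m → ℝ) : consPt t y 0 = t := rfl

@[simp] lemma tail_consPt (t : ℝ) (y : Fin m → ℝ) : tail (consPt t y) = WithLp.toLp 2 y := rfl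

lemma consPt_eq (t : ℝ) (y : Fin m → ℝ) : consPt t y = consPt 0 y + t • e₀ m := by
  ext i
  refine Fin.cases ?_ (fun j => ?_) i <;> simp [consPt, e₀]

lemma lintegral_eq_lintegral_consPt {H : Eucl (m + 1) → ENNReal} (hH : Measurable H) :
    ∫⁻ x, H x = ∫⁻ y : Fin m → ℝ, ∫⁻ t : ℝ, H (consPt t y) := by
  have hmp := (PiLp.volume_preserving_toLp (Fin (m + 1))).comp
    (volume_preserving_piFinSuccAbove (fun _ : Fin (m + 1) => ℝ) 0).symm
  have h1 := hmp.lintegral_comp hH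
  rw [← h1, Measure.volume_eq_prod]
  refine (lintegral_prod_symm' _ (hH.comp hmp.measurable)).trans ?_
  refine lintegral_congr fun y => lintegral_congr fun t => ?_
  change H (WithLp.toLp 2 (Fin.insertNth 0 t y)) = _
  rw [Fin.insertNth_zero]
  rfl

lemma setLIntegral_cylinder {h : ℝ} (hω : IsOpen ω) {g : Eucl (m + 1) → ℝ}
    (hg : ContinuousOn g (cylinder h ω)) :
    ∫⁻ x in cylinder h ω, ENNReal.ofReal (g x) = ∫⁻ y in {y : Fin m → ℝ | WithLp.toLp 2 y ∈ ω},
      ∫⁻ t in Set.Ioo 0 h, ENNReal.ofReal (g (consPt t y)) := by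
  have hΩ := isOpen_cylinder h hω
  have hS : MeasurableSet {y : Fin m → ℝ | WithLp.toLp 2 y ∈ ω} :=
    (hω.preimage (PiLp.continuous_toLp 2 _)).measurableSet
  rw [← lintegral_indicator hΩ.measurableSet,
    lintegral_eq_lintegral_consPt (measurable_indicator_ofReal hΩ hg), ← lintegral_indicator hS]
  refine lintegral_congr fun y => ?_
  by_cases hy : WithLp.toLp 2 y ∈ ω
  · rw [Set.indicator_of_mem (by exact hy), ← lintegral_indicator measurableSet_Ioo]
    refine lintegral_congr fun t => ?_
    by_cases ht : t ∈ Set.Ioo 0 h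
    · rw [Set.indicator_of_mem ht, Set.indicator_of_mem (show consPt t y ∈ cylinder h ω from
        ⟨ht, hy⟩)]
    · rw [Set.indicator_of_notMem ht, Set.indicator_of_notMem fun hx => ht hx.1]
  · rw [Set.indicator_of_notMem (by exact hy)]
    refine (lintegral_congr fun t => ?_).trans lintegral_zero
    exact Set.indicator_of_notMem (fun hx => hy hx.2) _

/-- The energy of `u` is controlled by interior energies of `u` and `∂u/∂x₁`. -/
theorem lintegral_energy_le {h : ℝ} (hh : 0 < h) (hω : IsOpen ω) {u W : Eucl (m + 1) → ℝ}
    (hu : ContDiffOn ℝ 2 u (cylinder h ω)) (hW : ContinuousOn W (cylinder h ω))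
    (hW0 : ∀ x, 0 ≤ W x) (hWinv : ∀ (x : Eucl (m + 1)) (t : ℝ), W (x + t • e₀ m) = W x) :
    ∫⁻ x in cylinder h ω, ENNReal.ofReal (W x * ∑ i, pd i u x ^ 2) ≤
      ENNReal.ofReal (72 / h ^ 2) * (∫⁻ x in cylinder h ω,
          ENNReal.ofReal (bump h (x 0) ^ 2 * (W x * ∑ i, pd i u x ^ 2))) +
        16 * ∫⁻ x in cylinder h ω,
          ENNReal.ofReal (bump h (x 0) ^ 2 * (W x * ∑ i, pd 0 (pd i u) x ^ 2)) := by
  have hΩ := isOpen_cylinder h hω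
  have hc1 : ∀ i, ContDiffOn ℝ 1 (pd i u) (cylinder h ω) := ContDiffOn.pd hΩ hu
  have hb : Continuous fun x : Eucl (m + 1) => bump h (x 0) :=
    (contDiff_bump h (n := 0)).continuous.comp (by fun_prop)
  have hQ : ContinuousOn (fun x => ∑ i, pd i u x ^ 2) (cylinder h ω) :=
    continuousOn_finsetSum _ fun i _ => (hc1 i).continuousOn.pow 2
  have hc2 : ∀ i, ContinuousOn (pd 0 (pd i u)) (cylinder h ω) := fun i =>
    continuousOn_fderiv_apply hΩ (hc1 i) _
  have hQ' : ContinuousOn (fun x => ∑ i, pd 0 (pd i u) x ^ 2) (cylinder h ω) :=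
    continuousOn_finsetSum _ fun i _ => (hc2 i).pow 2
  have hA1 : ContinuousOn (fun x => bump h (x 0) ^ 2 * (W x * ∑ i, pd i u x ^ 2))
    (cylinder h ω) := (hb.pow 2).continuousOn.mul (hW.mul hQ)
  have hA2 : ContinuousOn (fun x => bump h (x 0) ^ 2 * (W x * ∑ i, pd 0 (pd i u) x ^ 2))
    (cylinder h ω) := (hb.pow 2).continuousOn.mul (hW.mul hQ')
  set R : Eucl (m + 1) → ℝ := fun x => W x * (bump h (x 0) ^ 2 *
    (72 / h ^ 2 * (∑ i, pd i u x ^ 2) + 16 * ∑ i, pd 0 (pd i u) x ^ 2)) with hR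
  have hRc : ContinuousOn R (cylinder h ω) := hW.mul ((hb.pow 2).continuousOn.mul
    ((continuousOn_const.mul hQ).add (continuousOn_const.mul hQ')))
  have hsplit : ∫⁻ x in cylinder h ω, ENNReal.ofReal (R x) =
      ENNReal.ofReal (72 / h ^ 2) * (∫⁻ x in cylinder h ω,
          ENNReal.ofReal (bump h (x 0) ^ 2 * (W x * ∑ i, pd i u x ^ 2))) +
        16 * ∫⁻ x in cylinder h ω,
          ENNReal.ofReal (bump h (x 0) ^ 2 * (W x * ∑ i, pd 0 (pd i u) x ^ 2)) := by
    have h16 : (16 : ENNReal) = ENNReal.ofReal 16 := by norm_num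
    rw [h16, ← lintegral_const_mul' _ _ ENNReal.ofReal_ne_top,
      ← lintegral_const_mul' _ _ ENNReal.ofReal_ne_top, ← lintegral_add_left']
    · refine lintegral_congr fun x => ?_
      have h1 := hW0 x
      rw [← ENNReal.ofReal_mul (by positivity), ← ENNReal.ofReal_mul (by positivity),
        ← ENNReal.ofReal_add (by positivity) (by positivity)]
      congr 1
      simp only [hR]
      ring
    · exact ((hA1.aemeasurable hΩ.measurableSet).ennreal_ofReal).const_mul _
  rw [← hsplit, setLIntegral_cylinder hω (hW.fun_mul hQ), setLIntegral_cylinder hω hRc]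
  have hS : MeasurableSet {y : Fin m → ℝ | WithLp.toLp 2 y ∈ ω} :=
    (hω.preimage (PiLp.continuous_toLp 2 _)).measurableSet
  refine setLIntegral_mono' hS fun y hy => ?_
  -- The weight is constant on each line and can be taken out of the one-dimensional integrals.
  have hWy : ∀ t, W (consPt t y) = W (consPt 0 y) := fun t => by rw [consPt_eq, hWinv]
  simp only [hR, hWy, consPt_zero, ENNReal.ofReal_mul (hW0 (consPt 0 y))]
  rw [lintegral_const_mul' _ _ ENNReal.ofReal_ne_top,
    lintegral_const_mul' _ _ ENNReal.ofReal_ne_top]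
  refine mul_le_mul' le_rfl (lintegral_sum_sq_le (f := fun i t => pd i u (consPt t y))
    (f' := fun i t => pd 0 (pd i u) (consPt t y)) hh (fun i t ht => ?_) fun i => ?_)
  · have hx : consPt t y ∈ cylinder h ω := ⟨ht, hy⟩
    have h1 : HasFDerivAt (pd i u) (fderiv ℝ (pd i u) (consPt t y)) (consPt t y) :=
      (((hc1 i).contDiffAt (hΩ.mem_nhds hx)).differentiableAt one_ne_zero).hasFDerivAt
    have h2 : HasDerivAt (fun t : ℝ => consPt t y) (e₀ m) t := by
      have := ((hasDerivAt_id t).smul_const (e₀ m)).const_add (consPt 0 y)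
      simp only [id_eq, one_smul] at this
      exact this.congr_of_eventuallyEq (Filter.Eventually.of_forall fun s => consPt_eq s y)
    exact h1.comp_hasDerivAt t h2
  · have h2 : Continuous fun t : ℝ => consPt t y := by
      rw [funext fun t => consPt_eq t y]; fun_prop
    exact (hc2 i).comp h2.continuousOn fun t ht => ⟨ht, hy⟩

end Slices

/-! ### Assembly of the estimate and choice of the parameters. -/

section Estimate

variable {m : ℕ} {ω Γ₁ : Set (Eucl m)} {h : ℝ} {u : Eucl (m + 1) → ℝ}

lemma normL2_sq {d : ℕ} {F : Type*} [NormedAddCommGroup F] (Ω : Set (Eucl d)) (f : Eucl d → F) :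
    normL2 Ω f ^ 2 = ∫⁻ x in Ω, ENNReal.ofReal (‖f x‖ ^ 2) := by
  have h1 := eLpNorm_nnreal_pow_eq_lintegral (f := f) (μ := volume.restrict Ω) (p := 2) two_ne_zero
  simp only [NNReal.coe_ofNat, ENNReal.coe_ofNat, ENNReal.rpow_ofNat] at h1
  rw [normL2, h1]
  refine lintegral_congr fun x => ?_
  rw [ENNReal.ofReal_pow (norm_nonneg _), ofReal_norm]

lemma norm_gradient_sq {d : ℕ} (f : Eucl d → ℝ) (x : Eucl d) :
    ‖gradient f x‖ ^ 2 = ∑ i, pd i f x ^ 2 := by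
  rw [EuclideanSpace.norm_sq_eq]
  refine Finset.sum_congr rfl fun i _ => ?_
  have h1 : inner ℝ (gradient f x) (EuclideanSpace.single i 1) = pd i f x := by
    rw [gradient, InnerProductSpace.toDual_symm_apply, pd]
  rw [← h1, EuclideanSpace.inner_single_right]
  simp

lemma lintegral_mul_le_normL2 {d : ℕ} {Ω : Set (Eucl d)} (hΩ : MeasurableSet Ω) {f g : Eucl d → ℝ}
    (hf : ContinuousOn f Ω) (hg : ContinuousOn g Ω) :
    ∫⁻ x in Ω, ENNReal.ofReal |f x * g x| ≤ normL2 Ω f * normL2 Ω g := by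
  have h1 := eLpNorm_smul_le_mul_eLpNorm (p := 2) (q := 2) (r := 1)
    (hg.aestronglyMeasurable (μ := volume) hΩ) (hf.aestronglyMeasurable (μ := volume) hΩ)
  rw [eLpNorm_one_eq_lintegral_enorm] at h1
  refine le_trans (le_of_eq (lintegral_congr fun x => ?_)) h1
  rw [← Real.norm_eq_abs, ofReal_norm]
  rfl

/-- The estimate for a weight follows from energy estimates for the squares of its summands. -/
lemma separationEstimate_of_energy {k : ℕ} {C₀ C : ℝ} (hω : IsOpen ω)
    (hu : ContDiffOn ℝ 2 u (cylinder h ω)) {v : Fin k → Eucl (m + 1) → ℝ} {c : Fin k → ℝ}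
    {w : Eucl (m + 1) → ℝ} (hv : ∀ i, ContinuousOn (v i) (cylinder h ω)) (hv0 : ∀ i x, 0 ≤ v i x)
    (hc : ∀ i, 0 ≤ c i) (hw : ∀ x ∈ cylinder h ω, w x = ∑ i, c i * v i x)
    (hC : k ^ 2 * C₀ ≤ C)
    (henergy : ∀ i, ∫⁻ x in cylinder h ω, ENNReal.ofReal (v i x ^ 2 * ∑ j, pd j u x ^ 2) ≤
      ENNReal.ofReal C₀ *
        ((∫⁻ x in cylinder h ω, ENNReal.ofReal (v i x ^ 2 * |u x * pd 0 u x|)) / ENNReal.ofReal h +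
          ∫⁻ x in cylinder h ω, ENNReal.ofReal (v i x ^ 2 * pd 0 u x ^ 2))) :
    SeparationEstimate C h ω w u := by
  have hΩ := isOpen_cylinder h hω
  have hpd : ∀ i, ContinuousOn (pd i u) (cylinder h ω) := fun i =>
    (ContDiffOn.pd hΩ hu i).continuousOn
  have hwc : ContinuousOn w (cylinder h ω) := ContinuousOn.congr
    (continuousOn_finsetSum _ fun i _ => continuousOn_const.mul (hv i)) hw
  set X := normL2 (cylinder h ω) (fun x => w x * u x) *
    normL2 (cylinder h ω) (fun x => w x * pd 0 u x) / ENNReal.ofReal h +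
      normL2 (cylinder h ω) (fun x => w x * pd 0 u x) ^ 2 with hX
  -- All summands are nonnegative, so each squared summand is below w². Each single energy estimate
  -- can therefore be closed with the full weight on the right; the square of the sum on the left
  -- costs one factor `k` by Cauchy-Schwarz, and the number of summands another.
  have hterm : ∀ i, ∀ x ∈ cylinder h ω, c i ^ 2 * v i x ^ 2 ≤ w x ^ 2 := by
    intro i x hx
    rw [hw x hx, ← mul_pow]
    exact pow_le_pow_left₀ (mul_nonneg (hc i) (hv0 i x)) (Finset.single_le_sum
      (f := fun i => c i * v i x) (fun j _ => mul_nonneg (hc j) (hv0 j x)) (Finset.mem_univ i)) 2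
  have hscale : ∀ i (g : Eucl (m + 1) → ℝ), (∀ x, 0 ≤ g x) →
      ENNReal.ofReal (c i ^ 2) * (∫⁻ x in cylinder h ω, ENNReal.ofReal (v i x ^ 2 * g x)) ≤
        ∫⁻ x in cylinder h ω, ENNReal.ofReal (w x ^ 2 * g x) := by
    intro i g hg
    rw [← lintegral_const_mul' _ _ ENNReal.ofReal_ne_top]
    refine setLIntegral_mono' hΩ.measurableSet fun x hx => ?_
    rw [← ENNReal.ofReal_mul (sq_nonneg _), ← mul_assoc]
    exact ENNReal.ofReal_le_ofReal (mul_le_mul_of_nonneg_right (hterm i x hx) (hg x))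
  have hone : ∀ i, ENNReal.ofReal (c i ^ 2) *
      (∫⁻ x in cylinder h ω, ENNReal.ofReal (v i x ^ 2 * ∑ j, pd j u x ^ 2)) ≤
        ENNReal.ofReal C₀ * X := by
    intro i
    refine (mul_le_mul' le_rfl (henergy i)).trans ?_
    rw [mul_left_comm, mul_add, ← mul_div_assoc]
    refine mul_le_mul' le_rfl (add_le_add (ENNReal.div_le_div_right ?_ _) ?_)
    · refine (hscale i _ fun x => abs_nonneg _).trans (le_trans (le_of_eq (lintegral_congr
        fun x => ?_)) (lintegral_mul_le_normL2 hΩ.measurableSet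
          (hwc.mul (hu.continuousOn)) (hwc.mul (hpd 0))))
      congr 1
      simp only [abs_mul]
      rw [← sq_abs (w x)]
      ring
    · refine (hscale i _ fun x => sq_nonneg _).trans (le_of_eq ?_)
      rw [normL2_sq]
      refine lintegral_congr fun x => ?_
      rw [Real.norm_eq_abs, sq_abs, mul_pow]
  have hmeas : ∀ i ∈ Finset.univ, AEMeasurable (fun x => ENNReal.ofReal (c i ^ 2) *
      ENNReal.ofReal (v i x ^ 2 * ∑ j, pd j u x ^ 2)) (volume.restrict (cylinder h ω)) := fun i _ =>
    ((((hv i).pow 2).mul (continuousOn_finsetSum _ fun j _ =>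
      (hpd j).pow 2)).aemeasurable hΩ.measurableSet).ennreal_ofReal.const_mul _
  unfold SeparationEstimate
  calc normL2 (cylinder h ω) (fun x => w x • gradient u x) ^ 2
      = ∫⁻ x in cylinder h ω, ENNReal.ofReal (w x ^ 2 * ∑ j, pd j u x ^ 2) := by
        rw [normL2_sq]
        refine lintegral_congr fun x => ?_
        rw [norm_smul, mul_pow, norm_gradient_sq, Real.norm_eq_abs, sq_abs]
    _ ≤ ∫⁻ x in cylinder h ω, ENNReal.ofReal k * ∑ i, ENNReal.ofReal (c i ^ 2) *
          ENNReal.ofReal (v i x ^ 2 * ∑ j, pd j u x ^ 2) := by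
        refine setLIntegral_mono' hΩ.measurableSet fun x hx => ?_
        have hq : 0 ≤ ∑ j, pd j u x ^ 2 := Finset.sum_nonneg fun _ _ => sq_nonneg _
        simp only [← ENNReal.ofReal_mul (sq_nonneg (c _))]
        rw [← ENNReal.ofReal_sum_of_nonneg fun i _ => by positivity,
          ← ENNReal.ofReal_mul (Nat.cast_nonneg k)]
        refine ENNReal.ofReal_le_ofReal ?_
        have h1 := sq_sum_le_card_mul_sum_sq (s := Finset.univ) (f := fun i => c i * v i x)
        rw [← hw x hx, Finset.card_univ, Fintype.card_fin] at h1
        refine (mul_le_mul_of_nonneg_right h1 hq).trans (le_of_eq ?_)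
        rw [mul_assoc, Finset.sum_mul]
        congr 1
        exact Finset.sum_congr rfl fun i _ => by ring
    _ = ENNReal.ofReal k * ∑ i, ENNReal.ofReal (c i ^ 2) *
          ∫⁻ x in cylinder h ω, ENNReal.ofReal (v i x ^ 2 * ∑ j, pd j u x ^ 2) := by
        rw [lintegral_const_mul' _ _ ENNReal.ofReal_ne_top, lintegral_finsetSum' _ hmeas]
        simp only [lintegral_const_mul' _ _ ENNReal.ofReal_ne_top]
    _ ≤ ENNReal.ofReal k * ∑ _i : Fin k, ENNReal.ofReal C₀ * X :=
        mul_le_mul' le_rfl (Finset.sum_le_sum fun i _ => hone i)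
    _ = ENNReal.ofReal (k ^ 2 * C₀) * X := by
        rw [Finset.sum_const, Finset.card_univ, Fintype.card_fin, nsmul_eq_mul,
          ENNReal.ofReal_mul (by positivity), ENNReal.ofReal_pow (Nat.cast_nonneg k),
          ENNReal.ofReal_natCast]
        ring
    _ ≤ ENNReal.ofReal C * X := mul_le_mul' (ENNReal.ofReal_le_ofReal hC) le_rfl

/-- The energy estimate for a weight that is independent of `x₁`. -/
theorem IsSolution.energy_le {A : Matrix (Fin (m + 1)) (Fin (m + 1)) ℝ} {W : Eucl (m + 1) → ℝ}
    {l L θ θ' κ : ℝ} (hh : 0 < h) (hω : IsLipschitzDomain ω) (hu : IsSolution h ω A u)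
    (hA : EllipticBounds A l L) (hl : 0 < l) (hlL : l ≤ L) (hθ : θ < l) (hθ' : θ' < l)
    (hκ : 0 ≤ κ) (hW : ∀ a, ContDiffOn ℝ 1 W (cylinder a ω)) (hW0 : ∀ x, 0 ≤ W x)
    (hWinv : ∀ (x : Eucl (m + 1)) (t : ℝ), W (x + t • e₀ m) = W x)
    (hB : ∀ a, WeightBound (cylinder a ω) W (symPart A) θ 0)
    (hB' : WeightBound (cylinder h ω) W (lowered A) θ' κ) :
    ∫⁻ x in cylinder h ω, ENNReal.ofReal (W x * ∑ i, pd i u x ^ 2) ≤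
      ENNReal.ofReal ((144 * L + 72 * κ) / (l - θ') + 64 * L ^ 2 / (l - θ) ^ 2) *
        ((∫⁻ x in cylinder h ω, ENNReal.ofReal (W x * |u x * pd 0 u x|)) / ENNReal.ofReal h +
          ∫⁻ x in cylinder h ω, ENNReal.ofReal (W x * pd 0 u x ^ 2)) := by
  have hL : 0 < L := hl.trans_le hlL
  have hg : 0 < l - θ := sub_pos.2 hθ
  have hg' : 0 < l - θ' := sub_pos.2 hθ'
  refine (lintegral_energy_le hh hω.isOpen hu.contDiffOn (hW h).continuousOn hW0 hWinv).trans ?_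
  refine (add_le_add (mul_le_mul' le_rfl (hu.interior_energy hh hω hA hl hlL hθ' hκ (hW h)
    (fun x _ => hW0 x) hB')) (mul_le_mul' le_rfl
      (hu.caccioppoli_deriv hh hω hA hl hlL hθ hW hW0 hWinv hB))).trans ?_
  set a := ∫⁻ x in cylinder h ω, ENNReal.ofReal (W x * |u x * pd 0 u x|)
  set b := ∫⁻ x in cylinder h ω, ENNReal.ofReal (W x * pd 0 u x ^ 2)
  have h16 : (16 : ENNReal) = ENNReal.ofReal 16 := by norm_num
  rw [h16, mul_add, ← mul_assoc, ← mul_assoc, ← mul_assoc, ← ENNReal.ofReal_mul (by positivity),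
    ← ENNReal.ofReal_mul (by positivity), ← ENNReal.ofReal_mul (by positivity), add_assoc,
    ← add_mul, ← ENNReal.ofReal_add (by positivity) (by positivity), mul_add]
  refine add_le_add ?_ (mul_le_mul' (ENNReal.ofReal_le_ofReal ?_) le_rfl)
  · rw [div_eq_mul_inv a, mul_comm a, ← mul_assoc, ← ENNReal.ofReal_inv_of_pos hh,
      ← ENNReal.ofReal_mul (by positivity)]
    refine mul_le_mul' (ENNReal.ofReal_le_ofReal ?_) le_rfl
    have e : 72 / h ^ 2 * (2 * L * h / (l - θ')) = 144 * L / (l - θ') * h⁻¹ := by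
      field_simp; norm_num
    rw [e]
    refine mul_le_mul_of_nonneg_right ?_ (by positivity)
    have h1 : 0 ≤ 72 * κ / (l - θ') := by positivity
    have h2 : 0 ≤ 64 * L ^ 2 / (l - θ) ^ 2 := by positivity
    rw [add_div]
    linarith
  · have e : 72 / h ^ 2 * (κ * h ^ 2 / (l - θ')) = 72 * κ / (l - θ') := by
      field_simp
    have e2 : 16 * (4 * L ^ 2 / (l - θ) ^ 2) = 64 * L ^ 2 / (l - θ) ^ 2 := by ring
    have h1 : 0 ≤ 144 * L / (l - θ') := by positivity
    rw [e, e2, add_div]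
    linarith

/-- For x₁ ∈ (0, h) each point of Γ₁ has a copy in the cylinder at the same height as `x`, so the
open ends of the cylinder do not matter. -/
lemma infDist_cylinder {x : Eucl (m + 1)} (hx : x 0 ∈ Set.Ioo 0 h) (hΓ : Γ₁.Nonempty) :
    Metric.infDist x (cylinder h Γ₁) = Metric.infDist (tail x) Γ₁ := by
  have hd : ∀ y : Eucl (m + 1), dist x y ^ 2 = (x 0 - y 0) ^ 2 + dist (tail x) (tail y) ^ 2 := by
    intro y
    rw [EuclideanSpace.dist_sq_eq, EuclideanSpace.dist_sq_eq, Fin.sum_univ_succ, Real.dist_eq,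
      sq_abs]
    rfl
  have hmem : ∀ p ∈ Γ₁, consPt (x 0) p.ofLp ∈ cylinder h Γ₁ := fun p hp => ⟨hx, hp⟩
  have hdist : ∀ p, dist x (consPt (x 0) p.ofLp) = dist (tail x) p := by
    intro p
    have h1 := hd (consPt (x 0) p.ofLp)
    simp only [consPt_zero, sub_self, tail_consPt, WithLp.toLp_ofLp] at h1
    exact (sq_eq_sq₀ dist_nonneg dist_nonneg).1 (by linarith)
  refine le_antisymm ((Metric.le_infDist hΓ).2 fun {p} hp => ?_) ?_
  · rw [← hdist p]
    exact Metric.infDist_le_dist_of_mem (hmem p hp)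
  · obtain ⟨p, hp⟩ := hΓ
    refine (Metric.le_infDist ⟨_, hmem p hp⟩).2 fun {y} hy => ?_
    refine (Metric.infDist_le_dist_of_mem hy.2).trans ?_
    refine abs_le_of_sq_le_sq' ?_ dist_nonneg |>.2
    rw [hd y]
    linarith [sq_nonneg (x 0 - y 0)]

lemma infDist_rpow_sq (x : Eucl (m + 1)) (α : ℝ) :
    (Metric.infDist (tail x) Γ₁ ^ α) ^ 2 = sqDist Γ₁ x ^ α := by
  rw [sqDist, ← Real.rpow_natCast, ← Real.rpow_natCast, ← Real.rpow_mul Metric.infDist_nonneg,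
    ← Real.rpow_mul Metric.infDist_nonneg, mul_comm]

/-- The separation estimate for a weight `∑ c_i δ^{α_i}`, given bounds for the error terms caused by
the powers `δ^{2 α_i}`. -/
theorem IsAdmissible.separationEstimate (hω : IsAdmissible ω Γ₁)
    {A : Matrix (Fin (m + 1)) (Fin (m + 1)) ℝ} {l L θ θ' κ : ℝ} (hh : 0 < h)
    (hu : IsSolution h ω A u) (hA : EllipticBounds A l L) (hl : 0 < l) (hlL : l ≤ L)
    (hθ : θ < l) (hθ' : θ' < l) (hκ : 0 ≤ κ) {k : ℕ} {c α : Fin k → ℝ} (hc : ∀ i, 0 ≤ c i)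
    (hB : ∀ i a, WeightBound (cylinder a ω) (fun x => sqDist Γ₁ x ^ α i) (symPart A) θ 0)
    (hB' : ∀ i, WeightBound (cylinder h ω) (fun x => sqDist Γ₁ x ^ α i) (lowered A) θ' κ) :
    SeparationEstimate
      (k ^ 2 * ((144 * L + 72 * κ) / (l - θ') + 64 * L ^ 2 / (l - θ) ^ 2) + 1)
      h ω (weight h Γ₁ c α) u := by
  refine separationEstimate_of_energy (v := fun i x => Metric.infDist (tail x) Γ₁ ^ α i) (c := c)
    hω.domain.isOpen hu.contDiffOn (fun i => ?_)
    (fun i x => Real.rpow_nonneg Metric.infDist_nonneg _) hc (fun x hx => ?_)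
    (C₀ := (144 * L + 72 * κ) / (l - θ') + 64 * L ^ 2 / (l - θ) ^ 2)
    (by linarith) fun i => ?_
  · refine ContinuousOn.rpow_const
      ((Metric.continuous_infDist_pt Γ₁).comp continuous_tail).continuousOn fun x hx => Or.inl ?_
    have := hω.sqDist_pos hx.2
    exact fun h0 => this.ne' (by simp [sqDist, show Metric.infDist (tail x) Γ₁ = 0 from h0])
  · simp only [weight, infDist_cylinder hx.1 hω.nonempty]
  · simp only [infDist_rpow_sq]
    exact hu.energy_le hh hω.domain hA hl hlL hθ hθ' hκ (fun a => hω.contDiffOn_weight a (α i))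
      (fun x => Real.rpow_nonneg (sqDist_nonneg _ _) _) (fun x t => by simp [sqDist]) (hB i) (hB' i)

/-- Minimizing the first expression over μ gives 4Lβ / (1 - 2β), which is below `l` because 1 - 2β ≤
1 ≤ m + 1. The strict inequality leaves room for ν. -/
lemma exists_lt_of_lt {m : ℕ} {l L β : ℝ} (hl : 0 < l) (hlL : l ≤ L) (hβ : 0 ≤ β)
    (hβ2 : β < 1 / 2) (h : 4 * ((m : ℝ) + 1) * L * β / (1 - 2 * β) ^ 2 < l) :
    ∃ μ > 0, ∃ ν > 0, 2 * L * β ^ 2 * μ * (4 / (1 - 2 * β) ^ 2) + L / (2 * μ) < l ∧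
      2 * L * β ^ 2 * μ * (4 / (1 - 2 * β) ^ 2) + L / (2 * μ)
        + 2 * L * β ^ 2 * ν * (4 / (1 - 2 * β) ^ 2) < l := by
  have hL : 0 < L := hl.trans_le hlL
  have hb : 0 < 1 - 2 * β := by linarith
  suffices hμ : ∃ μ > 0, 2 * L * β ^ 2 * μ * (4 / (1 - 2 * β) ^ 2) + L / (2 * μ) < l by
    obtain ⟨μ, hμ, hlt⟩ := hμ
    set θ := 2 * L * β ^ 2 * μ * (4 / (1 - 2 * β) ^ 2) + L / (2 * μ) with hθ
    set s := 2 * L * β ^ 2 * (4 / (1 - 2 * β) ^ 2) with hs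
    have hs0 : 0 ≤ s := by positivity
    have hg : 0 < l - θ := sub_pos.2 hlt
    -- The ν-term becomes (l - θ) s / (s + 1), strictly less than the available gap.
    refine ⟨μ, hμ, (l - θ) / (s + 1), by positivity, hlt, ?_⟩
    have e : 2 * L * β ^ 2 * ((l - θ) / (s + 1)) * (4 / (1 - 2 * β) ^ 2)
        = (l - θ) * (s / (s + 1)) := by rw [hs]; ring
    have h1 : s / (s + 1) < 1 := by rw [div_lt_one (by positivity)]; linarith
    have h2 := mul_lt_mul_of_pos_left h1 hg
    rw [e]
    linarith
  rcases hβ.eq_or_lt with rfl | hβ0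
  -- For β = 0 only L / (2μ) is left, and this choice makes it l / 2.
  · refine ⟨L / l, by positivity, ?_⟩
    have e : L / (2 * (L / l)) = l / 2 := by field_simp
    rw [e]
    simp only [ne_eq, OfNat.ofNat_ne_zero, not_false_eq_true, zero_pow, mul_zero, zero_mul]
    linarith
  -- The minimizer in μ, at which both summands equal 2Lβ / (1 - 2β).
  · refine ⟨(1 - 2 * β) / (4 * β), by positivity, lt_of_le_of_lt ?_ h⟩
    have e : 2 * L * β ^ 2 * ((1 - 2 * β) / (4 * β)) * (4 / (1 - 2 * β) ^ 2)
        + L / (2 * ((1 - 2 * β) / (4 * β))) = 4 * L * β * (1 - 2 * β) / (1 - 2 * β) ^ 2 := by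
      field_simp
      ring
    rw [e]
    refine div_le_div_of_nonneg_right ?_ (by positivity)
    have hm : (0 : ℝ) ≤ m := m.cast_nonneg
    have h1 : 1 - 2 * β ≤ (m : ℝ) + 1 := by linarith
    have h2 := mul_le_mul_of_nonneg_left h1 (by positivity : 0 ≤ 4 * L * β)
    linarith

end Estimate

end Separation

end

/-- The ambient dimension is `n = m + 1 ≥ 2`, and `l`, `L` are the ellipticity constants. -/
theorem theorem2p1 :
    (∀ (m k : ℕ) (l L β : ℝ), 1 ≤ m → 0 < l → l ≤ L → 0 ≤ β → β < 1 / 2 →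
      4 * ((m : ℝ) + 1) * L * β / (1 - 2 * β) ^ 2 < l →
      ∃ C : ℝ, 0 < C ∧
        ∀ (ω Γ₁ : Set (Separation.Eucl m)) (h : ℝ)
          (A : Matrix (Fin (m + 1)) (Fin (m + 1)) ℝ)
          (c α : Fin k → ℝ) (u : Separation.Eucl (m + 1) → ℝ),
          Separation.IsAdmissible ω Γ₁ → 0 < h → Separation.EllipticBounds A l L →
          (∀ i, 0 ≤ c i) → (∀ i, α i ∈ Set.Icc 0 β) →
          Separation.IsSolution h ω A u →
          Separation.SeparationEstimate C h ω (Separation.weight h Γ₁ c α) u) ∧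
    (∀ (k : ℕ) (β : ℝ), 0 ≤ β → β ≤ 1 / 2 →
      ∃ C : ℝ, 0 < C ∧
        ∀ (a b : ℝ) (ω Γ₁ : Set (Separation.Eucl 1)) (h : ℝ)
          (c α : Fin k → ℝ) (u : Separation.Eucl 2 → ℝ),
          a < b → ω = {x | x 0 ∈ Set.Ioo a b} →
          Separation.IsAdmissible ω Γ₁ → 0 < h →
          (∀ i, 0 ≤ c i) → (∀ i, α i ∈ Set.Icc 0 β) →
          Separation.IsSolution h ω 1 u →
          Separation.SeparationEstimate C h ω (Separation.weight h Γ₁ c α) u) := by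
  constructor
  · intro m k l L β _ hl hlL hβ hβ2 hlt
    have hL : 0 < L := hl.trans_le hlL
    obtain ⟨μ, hμ, ν, hν, hθ, hθ'⟩ := Separation.exists_lt_of_lt hl hlL hβ hβ2 hlt
    have hg := sub_pos.2 hθ'
    -- The constant is read off from `separationEstimate`. It involves only `k`, `l`, `L`, `β` and
    -- the parameters μ, ν, which were fixed before the geometry.
    refine ⟨_, ?_, fun ω Γ₁ h A c α u hω hh hA hc hα hu =>
      hω.separationEstimate hh hu hA hl hlL hθ hθ' (by positivity : 0 ≤ L / (2 * ν)) hc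
        (fun i => hω.weightBound_symPart hA hl.le hL.le (hα i).1 (hα i).2 hβ2 hμ)
        fun i => hω.weightBound_lowered hA hl.le hL.le (hα i).1 (hα i).2 hβ2 hμ hν h⟩
    -- The summand 1 in the constant keeps it positive when k = 0.
    positivity
  · intro k β _ hβ
    refine ⟨_, ?_, fun a b ω Γ₁ h c α u _ _ hω hh hc hα hu =>
      hω.separationEstimate hh hu Separation.ellipticBounds_one one_pos le_rfl
        -- For the identity matrix the first order term has a sign and costs nothing, so β = 1/2 is
        -- allowed.
        (θ := 0) (θ' := 0) (κ := 0) one_pos one_pos le_rfl hc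
        (fun i a => by
          rw [Separation.symPart_one]
          exact hω.weightBound_one (hα i).1 ((hα i).2.trans hβ) a)
        fun i => by
          rw [Separation.lowered_one]
          exact hω.weightBound_one (hα i).1 ((hα i).2.trans hβ) h⟩
    positivity
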